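/- **Setting.** A *serial number* of size $n$ consists of two lists of polynomials $p_1,\dots,p_m$ and $q_1,\dots,q_m$ in $n$ variables over $\mathbb F_2$, of degree at most $3$ ($m$ is part of the serial number). A *banknote* of size $n$ is a pair $(s,|S\rangle)$, where $S\le\mathbb F_2^n$ is a subspace with $\dim S=n/2$, $|S\rangle=|S|^{-1/2}\sum_{x\in S}|x\rangle$, and $s=(p_1,\dots,p_m,q_1,\dots,q_m)$ is a serial number such that the common zeros of the $p_i$ are exactly $S$ and the common zeros of the $q_i$ are exactly $S^\perp=\{y: x\cdot y=0\ \forall x\in S\}$. Verification of an $n$-qubit register with respect to $s$: check that all $p_i$ vanish, apply $H^{\otimes n}$, check that all $q_i$ vanish, apply $H^{\otimes n}$; accept if both checks succeed. A *bank* for size $n$ is a probability distribution on the banknotes of size $n$. A *polynomial-time quantum algorithm* on serial numbers is an assignment of a quantum circuit over $\{\text{Hadamard},\text{Phase},\text{Toffoli}\}$ (with ancilla qubits initialised to $|0\rangle$) to every serial number, such that a description of the circuit is computed from a bit-string encoding of the serial number by a deterministic machine in time polynomial in the length of the encoding. A *counterfeiter* is such an algorithm whose circuits are applied to $|S\rangle|0\cdots0\rangle$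 and have two $n$-qubit output registers; it *succeeds* on a banknote if both (possibly entangled) registers pass verification. **Theorem.** Let $C$ be a polynomial-time quantum counterfeiter and let $r$ be a polynomial with natural number coefficients. Then there are a polynomial-time quantum algorithm $D$, which is given only $p_1,\dots,p_m$ and $q_1,\dots,q_m$ (its circuits start on $|0\cdots0\rangle$) and outputs a list of $n/2$ vectors of $\mathbb F_2^n$, and a constant $c>0$, such that for every $n$ and every bank for size $n$: if $C$ succeeds with probability at least $1/r(n)$ on a random banknote of the bank, then the probability that $D$ outputs a basis of $S$, for a random banknote of the bank, is at least $c\,2^{-n/2}$. (The probabilities are over the bank and over the quantum measurements. The case of a bank that produces one fixed banknote is included. For $r(n)=0$ the condition on $C$ is regarded as not satisfied.) -/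

import Mathlib

open scoped ENNReal

noncomputable section

namespace HiddenSubspace

/-! ### Quantum circuits over the gate set {Hadamard, Phase, Toffoli} -/

/-- A pure (possibly subnormalised) state of `N` qubits: the amplitude of each basis state
`x ∈ 𝔽₂ᴺ`. -/
abbrev QState (N : ℕ) := (Fin N → ZMod 2) → ℂ

/-- A gate placed on specified wires out of `N`. -/
inductive Gate (N : ℕ) where
  | hadamard (i : Fin N)
  | phase (i : Fin N)
  | toffoli (i j k : Fin N) (hij : i ≠ j) (hik : i ≠ k) (hjk : j ≠ k)

/-- The action of a gate on amplitudes: `|b⟩ ↦ (|0⟩ + (-1)ᵇ|1⟩)/√2`, `|b⟩ ↦ iᵇ|b⟩`, and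
`|a, b, c⟩ ↦ |a, b, c + ab⟩` (an involution). -/
def Gate.apply {N : ℕ} : Gate N → QState N → QState N
  | .hadamard i, ψ => fun x =>
      (ψ (Function.update x i 0) + (if x i = 1 then -1 else 1) * ψ (Function.update x i 1))
        / (Real.sqrt 2 : ℂ)
  | .phase i, ψ => fun x => (if x i = 1 then Complex.I else 1) * ψ x
  | .toffoli i j k _ _ _, ψ => fun x => ψ (Function.update x k (x k + x i * x j))

/-- A circuit acting on `w` registers of `n` qubits each, followed by ancilla qubits. -/
structure QCircuit (w n : ℕ) where
  ancillas : ℕ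
  gates : List (Gate (w * n + ancillas))

namespace QCircuit

variable {w n : ℕ}

/-- The number of qubits of the circuit. -/
abbrev qubits (Q : QCircuit w n) : ℕ := w * n + Q.ancillas

/-- The circuit applied to a state; the head of the list of gates is applied first. -/
def run (Q : QCircuit w n) (ψ : QState Q.qubits) : QState Q.qubits :=
  Q.gates.foldl (fun φ g => g.apply φ) ψ

end QCircuit

/-- The `i`-th qubit of the `b`-th of the `w` registers: qubit number `b * n + i`. -/
def wire {w n : ℕ} (a : ℕ) (b : Fin w) (i : Fin n) : Fin (w * n + a) :=
  Fin.castAdd a (finProdFinEquiv (b, i))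

/-- The content of the `b`-th register in the basis state `x`. -/
def reg {w n a : ℕ} (x : Fin (w * n + a) → ZMod 2) (b : Fin w) : Fin n → ZMod 2 :=
  fun i => x (wire a b i)

/-- Self-delimiting unary code of a natural number. -/
def unary (k : ℕ) : List Bool := List.replicate k true ++ [false]

/-- Bit-string code of a gate. -/
def Gate.encode {N : ℕ} : Gate N → List Bool
  | .hadamard i => unary 0 ++ unary i
  | .phase i => unary 1 ++ unary i
  | .toffoli i j k _ _ _ => unary 2 ++ unary i ++ unary j ++ unary k

/-- Bit-string code of a circuit. -/
def QCircuit.encode {w n : ℕ} (Q : QCircuit w n) : List Bool :=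
  unary Q.ancillas ++ Q.gates.flatMap Gate.encode

/-! ### Deterministic classical computation with a step count -/

/-- Programs of a machine with finitely many stacks of bits, named by natural numbers. The only
basic operations are pushing and popping one bit; control flow inspects the top of a stack. -/
inductive Prog where
  | skip
  | push (r : ℕ) (b : Bool)
  | pop (r : ℕ)
  | seq (P Q : Prog)
  /-- run `P`, `Q` or `R` if stack `r` is empty, has top `false`, has top `true`, resp. -/
  | branch (r : ℕ) (P Q R : Prog)
  /-- run `P` as long as stack `r` is not empty -/
  | loop (r : ℕ) (P : Prog)

/-- The contents of the stacks; the top of a stack is the head of the list. -/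
abbrev Store := ℕ → List Bool

/-- `P.Runs σ t τ`: started on `σ`, the program `P` halts after `t` steps with contents `τ`.
Every basic operation and every test costs one step. -/
inductive Prog.Runs : Prog → Store → ℕ → Store → Prop
  | skip (σ : Store) : Runs .skip σ 1 σ
  | push (σ : Store) (r : ℕ) (b : Bool) :
      Runs (.push r b) σ 1 (Function.update σ r (b :: σ r))
  | pop (σ : Store) (r : ℕ) : Runs (.pop r) σ 1 (Function.update σ r (σ r).tail)
  | seq {P Q : Prog} {σ τ ρ : Store} {t u : ℕ} :
      Runs P σ t τ → Runs Q τ u ρ → Runs (.seq P Q) σ (t + u) ρ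
  | branch_nil {P Q R : Prog} {σ τ : Store} {r t : ℕ} :
      σ r = [] → Runs P σ t τ → Runs (.branch r P Q R) σ (t + 1) τ
  | branch_false {P Q R : Prog} {σ τ : Store} {r t : ℕ} {l : List Bool} :
      σ r = false :: l → Runs Q σ t τ → Runs (.branch r P Q R) σ (t + 1) τ
  | branch_true {P Q R : Prog} {σ τ : Store} {r t : ℕ} {l : List Bool} :
      σ r = true :: l → Runs R σ t τ → Runs (.branch r P Q R) σ (t + 1) τ
  | loop_done {P : Prog} {σ : Store} {r : ℕ} : σ r = [] → Runs (.loop r P) σ 1 σ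
  | loop_step {P : Prog} {σ τ ρ : Store} {r t u : ℕ} :
      σ r ≠ [] → Runs P σ t τ → Runs (.loop r P) τ u ρ → Runs (.loop r P) σ (t + u + 1) ρ

/-- The store that holds the input in stack `0` while all other stacks are empty. -/
def inputStore (l : List Bool) : Store := Function.update (fun _ => []) 0 l

/-! ### The hidden subspace mini-scheme with degree-3 polynomials -/

/-- The public classical part of a banknote: two lists of `m` polynomials of degree at most `3`
in `n` variables over `𝔽₂`. -/
structure SerialNumber (n : ℕ) where
  m : ℕ
  p : Fin m → MvPolynomial (Fin n) (ZMod 2)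
  q : Fin m → MvPolynomial (Fin n) (ZMod 2)
  p_deg : ∀ i, (p i).totalDegree ≤ 3
  q_deg : ∀ i, (q i).totalDegree ≤ 3

/-- Exponent vector of the `a`-th element of the list `1, X₁, …, Xₙ`. -/
def factor {n : ℕ} : Fin (n + 1) → (Fin n →₀ ℕ) :=
  Fin.cons 0 (fun i => Finsupp.single i 1)

/-- The coefficients of a polynomial of degree at most `3`: one bit for every product of three
elements of the list `1, X₁, …, Xₙ`. -/
def encodePoly {n : ℕ} (f : MvPolynomial (Fin n) (ZMod 2)) : List Bool :=
  (List.finRange (n + 1)).flatMap fun a =>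
    (List.finRange (n + 1)).flatMap fun b =>
      (List.finRange (n + 1)).map fun c =>
        decide (f.coeff (factor a + factor b + factor c) = 1)

/-- Bit-string code of a serial number. -/
def SerialNumber.encode {n : ℕ} (s : SerialNumber n) : List Bool :=
  unary n ++ unary s.m ++ (List.finRange s.m).flatMap (fun i => encodePoly (s.p i))
    ++ (List.finRange s.m).flatMap (fun i => encodePoly (s.q i))

/-- A banknote `(s, |S⟩)`: the hidden subspace `S ≤ 𝔽₂ⁿ` has dimension `n / 2`, the polynomials
`pᵢ` vanish simultaneously exactly on `S`, and the `qᵢ` exactly on `S^⊥`. -/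
structure Banknote (n : ℕ) where
  serial : SerialNumber n
  S : Submodule (ZMod 2) (Fin n → ZMod 2)
  dim_S : 2 * Module.finrank (ZMod 2) S = n
  p_zeros : ∀ x, (∀ i, MvPolynomial.eval x (serial.p i) = 0) ↔ x ∈ S
  q_zeros : ∀ y, (∀ i, MvPolynomial.eval y (serial.q i) = 0) ↔ ∀ x ∈ S, x ⬝ᵥ y = 0

open Classical in
/-- The uniform superposition `|S⟩`. -/
def subspaceState {n : ℕ} (S : Submodule (ZMod 2) (Fin n → ZMod 2)) : QState n :=
  fun x => if x ∈ S then ((1 / Real.sqrt (Nat.card S) : ℝ) : ℂ) else 0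

section Verification

variable {w n a : ℕ}

open Classical in
/-- Check that all polynomials `f j` vanish on register `b`, keeping the component on which they
do. -/
def checkZero {m : ℕ} (f : Fin m → MvPolynomial (Fin n) (ZMod 2)) (b : Fin w)
    (ψ : QState (w * n + a)) : QState (w * n + a) :=
  fun x => if ∀ j, MvPolynomial.eval (reg x b) (f j) = 0 then ψ x else 0

/-- Hadamard gates on all qubits of register `b`. -/
def hadamardReg (b : Fin w) (ψ : QState (w * n + a)) : QState (w * n + a) :=
  (List.finRange n).foldl (fun φ i => (Gate.hadamard (wire a b i)).apply φ) ψ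

/-- The verification procedure run on register `b`; the result is the (subnormalised) state in
the event that it accepts: check membership in `S`, apply Hadamards, check membership in `S^⊥`,
apply Hadamards. -/
def verify (s : SerialNumber n) (b : Fin w) (ψ : QState (w * n + a)) : QState (w * n + a) :=
  hadamardReg b (checkZero s.q b (hadamardReg b (checkZero s.p b ψ)))

end Verification

/-! ### Polynomial-time quantum algorithms -/

/-- An assignment of a quantum circuit on `w n` registers of `n` qubits (and ancillas) to every
serial number. -/
abbrev QAlgorithm (w : ℕ → ℕ) := (n : ℕ) → SerialNumber n → QCircuit (w n) n

/-- The algorithm runs in quantum polynomial time: the circuits are generated from the serial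
number by one deterministic program within a number of steps polynomial in the input length. -/
def QAlgorithm.PolyTime {w : ℕ → ℕ} (A : QAlgorithm w) : Prop :=
  ∃ (P : Prog) (t : Polynomial ℕ), ∀ (n : ℕ) (s : SerialNumber n), ∃ (k : ℕ) (τ : Store),
    P.Runs (inputStore s.encode) k τ ∧ k ≤ t.eval s.encode.length ∧ τ 0 = (A n s).encode

open Classical in
/-- The input `|S⟩|0⋯0⟩` of a counterfeiter: `|S⟩` on register `0`, all other qubits `|0⟩`. -/
def counterfeitInput {n a : ℕ} (S : Submodule (ZMod 2) (Fin n → ZMod 2)) :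
    QState (2 * n + a) :=
  fun x => if ∀ k : Fin (2 * n + a), n ≤ (k : ℕ) → x k = 0 then subspaceState S (reg x 0) else 0

/-- The probability that the counterfeiter `C`, given one banknote, outputs two (possibly
entangled) registers that both pass verification. -/
def counterfeitProb (C : QAlgorithm fun _ => 2) {n : ℕ} (B : Banknote n) : ℝ :=
  ∑ x, ‖verify B.serial 1 (verify B.serial 0
    ((C n B.serial).run (counterfeitInput B.S))) x‖ ^ 2

/-- The probability that the algorithm `D`, given only the polynomials and started on `|0⋯0⟩`,
yields a basis of `S` when its `n / 2` registers are measured. -/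
def basisProb (D : QAlgorithm fun n => n / 2) {n : ℕ} (B : Banknote n) : ℝ :=
  open Classical in
  ∑ x, if LinearIndependent (ZMod 2) (reg x) ∧ Submodule.span (ZMod 2) (Set.range (reg x)) = B.S
    then ‖(D n B.serial).run (Pi.single 0 1) x‖ ^ 2 else 0

/-- The average over the banknotes produced by a bank of a success probability `f`. -/
def average {n : ℕ} (bank : PMF (Banknote n)) (f : Banknote n → ℝ) : ℝ≥0∞ :=
  ∑' B, bank B * ENNReal.ofReal (f B)

end HiddenSubspace

end

noncomputable section

namespace HiddenSubspace

/-! ### Elementary programs -/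

/-! A counterfeiter turns one copy of |S⟩ into many, and measuring d = n/2 copies gives independent
uniform elements of S. These form a basis with probability ∏_{i<d} (1 - 2^{i-d}) ≥ 1/4
(`le_prod_two_pow_sub`, `nrm_proj_basis`). What is missing is a first copy. Verification is public
and is exactly the projection on |S⟩: averaging over the translations by S is the Hadamard conjugate
of testing membership in S^⊥ (`hads_mul_proj_mul_hads`, `verify_eq`). Since 0 ∈ S, it accepts |0…0⟩
with probability q = 1/|S| = 2^{-n/2} (`projReg_subProj`).

Let ε be the success probability of C on a given banknote. If the average of ε is at least 1/r, then
the banknotes with ε ≥ 1/(2r) may still have weight only of order 1/r. For the final constant to be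
independent of n, the first copy must therefore be found with probability of order r q instead of q.
Hence amplitude amplification is used twice, both times with F = r(n)(n+1) rounds: for the first
copy, and for every use of C.

Amplification (`amplify`) concerns projections A, B and a state Ψ with AΨ = Ψ and ABΨ = εΨ. The part
BΨ is marked by a flag, and g = Ψ - BΨ remains. The reflection 1 - 2A sends g to (2ε-1)g plus a
vector in the range of B, which is marked by a fresh flag, and so on. After F rounds the failing
part is (2ε-1)^F g, so the failure probability is (1-ε)(2ε-1)^{2F}. The value of ε need not be
known, and extra rounds do no harm.

For a copying stage (`stage_spec`), A projects on the input |S⟩|0…0⟩ of C and B = U⁻¹ΠU, where U is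
the circuit of C and Π is the verification of both registers. On the wires of one copy of C the
projection A has rank one, so ABΨ = εΨ; entanglement with the other wires is handled by looking at
slices (`stageInput_afterProj`). If ε ≥ 1/(2r), each stage fails with probability at most
1/(2(n+1)), and n stages succeed with probability at least 1/2. For the first copy
(`firstStage_spec`), A projects on |0…0⟩, B is the verification of register 0, and the success
probability is at least 2rq/(1+2κ), where κ bounds F(n) 2^{-n/2} for all n. Altogether a basis is
found with probability at least b = rq/(4(1+2κ)) whenever ε ≥ 1/(2r). Averaging ε ≤ basisProb/b +
1/(2r) over the bank gives the theorem.

Marking and reflecting are done coherently. Conditions are computed into clean wires, their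
conjunction flips a target wire, and everything is uncomputed (`Tests`, `run_toggle`). The target is
a flag, or a wire in the state |0⟩ - |1⟩ (up to scale), where the flip becomes a sign.

For polynomial time, the functions computed by stack programs in polynomial time (`PolyFn`) are
closed under composition, case distinction and loops with bounded states. The code of the whole
circuit is assembled within this class, with the program that generates C as a subroutine
(`polyTime_basisFinder`). -/

theorem eval_mono (p : Polynomial ℕ) {x y : ℕ} (h : x ≤ y) : p.eval x ≤ p.eval y := by
  rw [Polynomial.eval_eq_sum, Polynomial.eval_eq_sum]
  exact Finset.sum_le_sum fun i _ => Nat.mul_le_mul_left _ (Nat.pow_le_pow_left h i)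

theorem Prog.Runs.of_eq {P : Prog} {σ τ τ' : Store} {k k' : ℕ} (h : P.Runs σ k τ) (hk : k' = k)
    (hτ : τ' = τ) : P.Runs σ k' τ' := by
  rwa [hk, hτ]

/-- A step pushes at most one bit. Time bounds therefore yield length bounds for all results. -/
theorem Prog.Runs.length_le {P : Prog} {σ τ : Store} {k : ℕ} (h : P.Runs σ k τ) (r : ℕ) :
    (τ r).length ≤ (σ r).length + k := by
  induction h with
  | skip σ => simp
  | push σ r' b =>
    by_cases hr : r = r'
    · subst hr; simp
    · simp [Function.update_of_ne hr]
  | pop σ r' =>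
    by_cases hr : r = r'
    · subst hr; simp; omega
    · simp [Function.update_of_ne hr]
  | seq _ _ h1 h2 => omega
  | branch_nil _ _ h => omega
  | branch_false _ _ h => omega
  | branch_true _ _ h => omega
  | loop_done _ => omega
  | loop_step _ _ _ h1 h2 => omega

/-- The program with all stack names increased by `d`. -/
def Prog.shift (d : ℕ) : Prog → Prog
  | .skip => .skip
  | .push r b => .push (d + r) b
  | .pop r => .pop (d + r)
  | .seq P Q => .seq (P.shift d) (Q.shift d)
  | .branch r P Q R => .branch (d + r) (P.shift d) (Q.shift d) (R.shift d)
  | .loop r P => .loop (d + r) (P.shift d)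

/-- The store with the first `d` stacks taken from `F` and the others from `σ`. -/
def Store.behind (d : ℕ) (F σ : Store) : Store := fun r => if r < d then F r else σ (r - d)

theorem Store.behind_add (d : ℕ) (F σ : Store) (r : ℕ) : Store.behind d F σ (d + r) = σ r := by
  simp [Store.behind]

theorem Store.behind_update (d : ℕ) (F σ : Store) (r : ℕ) (l : List Bool) :
    Store.behind d F (Function.update σ r l)
      = Function.update (Store.behind d F σ) (d + r) l := by
  funext x
  by_cases hx : x = d + r
  · subst hx; simp [Store.behind]
  · rw [Function.update_of_ne hx]
    unfold Store.behind
    split_ifs with h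
    · rfl
    · rw [Function.update_of_ne]; omega

/-- A program is insensitive to stacks it does not name, so after renaming it can run as a
subroutine next to stacks that are already in use. -/
theorem Prog.Runs.shift {P : Prog} {σ τ : Store} {k : ℕ} (h : P.Runs σ k τ) (d : ℕ)
    (F : Store) : (P.shift d).Runs (Store.behind d F σ) k (Store.behind d F τ) := by
  induction h with
  | skip σ => exact .skip _
  | push σ r b =>
    rw [Store.behind_update]
    have h := Prog.Runs.push (Store.behind d F σ) (d + r) b
    rwa [Store.behind_add] at h
  | pop σ r =>
    rw [Store.behind_update]
    have h := Prog.Runs.pop (Store.behind d F σ) (d + r)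
    rwa [Store.behind_add] at h
  | seq _ _ h1 h2 => exact .seq h1 h2
  | branch_nil h0 _ h => exact .branch_nil (by rwa [Store.behind_add]) h
  | branch_false h0 _ h => exact .branch_false (by rwa [Store.behind_add]) h
  | branch_true h0 _ h => exact .branch_true (by rwa [Store.behind_add]) h
  | loop_done h0 => exact .loop_done (by rwa [Store.behind_add])
  | loop_step h0 _ _ h1 h2 => exact .loop_step (by rwa [Store.behind_add]) h1 h2

/-- A strict upper bound for the stacks a program uses. -/
def Prog.width : Prog → ℕ
  | .skip => 0
  | .push r _ => r + 1
  | .pop r => r + 1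
  | .seq P Q => max P.width Q.width
  | .branch r P Q R => max (r + 1) (max P.width (max Q.width R.width))
  | .loop r P => max (r + 1) P.width

/-- This limits the stacks on which an arbitrary program can leave garbage. -/
theorem Prog.Runs.eq_of_width_le {P : Prog} {σ τ : Store} {k : ℕ} (h : P.Runs σ k τ) (r : ℕ)
    (hr : P.width ≤ r) : τ r = σ r := by
  induction h with
  | skip σ => rfl
  | push σ r' b => rw [Function.update_of_ne]; simp [Prog.width] at hr; omega
  | pop σ r' => rw [Function.update_of_ne]; simp [Prog.width] at hr; omega
  | seq _ _ h1 h2 => simp [Prog.width] at hr; rw [h2 (by omega), h1 (by omega)]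
  | branch_nil _ _ h => simp [Prog.width] at hr; exact h (by omega)
  | branch_false _ _ h => simp [Prog.width] at hr; exact h (by omega)
  | branch_true _ _ h => simp [Prog.width] at hr; exact h (by omega)
  | loop_done _ => rfl
  | loop_step _ _ _ h1 h2 =>
    rw [h2 hr, h1 (by simp [Prog.width] at hr; omega)]

/-- Push `b` on each of the stacks of a list. -/
def Prog.pushAll (b : Bool) : List ℕ → Prog
  | [] => .skip
  | r :: rs => .seq (.push r b) (pushAll b rs)

theorem Prog.pushAll_runs (b : Bool) (ts : List ℕ) (hts : ts.Nodup) (σ : Store) :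
    (Prog.pushAll b ts).Runs σ (ts.length + 1) (fun x => if x ∈ ts then b :: σ x else σ x) := by
  induction ts generalizing σ with
  | nil => exact (Prog.Runs.skip σ).of_eq rfl (by simp)
  | cons r rs ih =>
    have h := Prog.Runs.seq (Prog.Runs.push σ r b)
      (ih (List.nodup_cons.1 hts).2 (Function.update σ r (b :: σ r)))
    refine Prog.Runs.of_eq (h) ?_ ?_
    · simp; omega
    · funext x
      by_cases hx : x = r
      · subst hx; simp [(List.nodup_cons.1 hts).1]
      · simp [hx]

/-- Move the content of stack `r` to each of the stacks `ts`, reversing it. -/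
def Prog.pour (r : ℕ) (ts : List ℕ) : Prog :=
  .loop r (.branch r .skip (.seq (.pop r) (pushAll false ts)) (.seq (.pop r) (pushAll true ts)))

/-- Each bit costs a loop test, a branch test, a pop and the `ts.length + 1` steps of `pushAll`; the
last `+ 1` is the loop test that fails. -/
theorem Prog.pour_runs (r : ℕ) (ts : List ℕ) (hts : ts.Nodup) (hr : r ∉ ts) (σ : Store) :
    (Prog.pour r ts).Runs σ ((σ r).length * (ts.length + 4) + 1)
      (fun x => if x = r then [] else if x ∈ ts then (σ r).reverse ++ σ x else σ x) := by
  obtain ⟨l, hl⟩ : ∃ l, σ r = l := ⟨_, rfl⟩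
  rw [hl]
  induction l generalizing σ with
  | nil =>
    refine Prog.Runs.of_eq (Prog.Runs.loop_done hl) ?_ ?_
    · simp
    · funext x
      by_cases hx : x = r
      · subst hx; simp [hl]
      · simp [hx]
  | cons b l ih =>
    set σ' : Store := fun x => if x ∈ ts then b :: (Function.update σ r l) x
      else (Function.update σ r l) x with hσ'
    have hσr : σ' r = l := by simp [hσ', hr]
    have hpop : (Prog.pop r).Runs σ 1 (Function.update σ r l) := by
      have := Prog.Runs.pop σ r
      rwa [hl] at this
    have hbody : (Prog.branch r .skip (.seq (.pop r) (pushAll false ts))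
        (.seq (.pop r) (pushAll true ts))).Runs σ (1 + (ts.length + 1) + 1) σ' := by
      cases b with
      | false => exact .branch_false hl (.seq hpop (Prog.pushAll_runs _ ts hts _))
      | true => exact .branch_true hl (.seq hpop (Prog.pushAll_runs _ ts hts _))
    have h := Prog.Runs.loop_step (by simp [hl]) hbody (ih σ' hσr)
    refine Prog.Runs.of_eq (h) ?_ ?_
    · simp only [List.length_cons]; ring
    · funext x
      by_cases hx : x = r
      · simp [hx]
      · by_cases hxt : x ∈ ts
        · simp [hx, hxt, hσ']
        · simp [hx, hxt, hσ']

/-- Put a copy of stack `r` on top of stack `t`, using the empty stack `u`. -/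
def Prog.copyOnto (r t u : ℕ) : Prog := .seq (.pour r [u]) (.pour u [r, t])

/-- Pouring reverses a stack, so pouring twice restores the order; the second pour fills `r` again
along with `t`. -/
theorem Prog.copyOnto_runs {r t u : ℕ} (hrt : r ≠ t) (hru : r ≠ u) (htu : t ≠ u) (σ : Store)
    (hu : σ u = []) :
    (Prog.copyOnto r t u).Runs σ ((σ r).length * 11 + 2)
      (Function.update σ t (σ r ++ σ t)) := by
  have h1 := Prog.pour_runs r [u] (by simp) (by simpa using hru) σ
  have h2 := Prog.pour_runs u [r, t] (by simp [hrt]) (by simp [hru.symm, htu.symm])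
    (fun x => if x = r then [] else if x ∈ [u] then (σ r).reverse ++ σ x else σ x)
  refine Prog.Runs.of_eq (Prog.Runs.seq h1 h2) ?_ ?_
  · simp [hru.symm, hu]; ring
  · funext x
    by_cases hxt : x = t
    · subst hxt; simp [hru.symm, hrt.symm, htu, hu]
    · rw [Function.update_of_ne hxt]
      by_cases hxu : x = u
      · subst hxu; simp [hu]
      · by_cases hxr : x = r
        · subst hxr; simp [hru, hru.symm, hu]
        · simp [hxt, hxu, hxr]

/-! ### Stores given by lists of stacks -/

/-- The store with the given contents of the first stacks, all others empty. -/
def st (l : List (List Bool)) : Store := fun r => l.getD r []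

theorem st_append_left {l m : List (List Bool)} {r : ℕ} (h : r < l.length) :
    st (l ++ m) r = st l r := by
  simp [st, List.getElem?_append_left h]

theorem st_append_right {l m : List (List Bool)} {r : ℕ} (h : l.length ≤ r) :
    st (l ++ m) r = st m (r - l.length) := by
  simp [st, List.getElem?_append_right h]

theorem st_of_le {l : List (List Bool)} {r : ℕ} (h : l.length ≤ r) : st l r = [] := by
  simp [st, h]

theorem st_append (l m : List (List Bool)) :
    st (l ++ m) = Store.behind l.length (st l) (st m) := by
  funext r
  unfold Store.behind
  split_ifs with h
  · exact st_append_left h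
  · exact st_append_right (by omega)

theorem update_st (l : List (List Bool)) (x : List Bool) :
    Function.update (st l) l.length x = st (l ++ [x]) := by
  funext r
  by_cases h : r = l.length
  · subst h; simp [st]
  · rw [Function.update_of_ne h]
    rcases Nat.lt_or_gt_of_ne h with h | h
    · rw [st_append_left h]
    · rw [st_of_le h.le, st_of_le (by simp; omega)]

theorem update_st_snoc (l : List (List Bool)) (x y : List Bool) :
    Function.update (st (l ++ [x])) l.length y = st (l ++ [y]) := by
  rw [← update_st, Function.update_idem, update_st]

theorem st_snoc_nil (l : List (List Bool)) : st (l ++ [[]]) = st l := by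
  rw [← update_st, Function.update_eq_self_iff, st_of_le le_rfl]

theorem inputStore_eq (l : List Bool) : inputStore l = st [l] := by
  rw [show ([l] : List (List Bool)) = [] ++ [l] from rfl, ← update_st]
  rfl

/-- Remove the last but one of `b + 2` stacks. -/
def Prog.dropSnd (b : ℕ) : Prog :=
  .seq (.pour b []) (.seq (.pour (b + 1) [b + 2]) (.pour (b + 2) [b]))

theorem Prog.dropSnd_runs (l : List (List Bool)) (x y : List Bool) :
    (Prog.dropSnd l.length).Runs (st (l ++ [x] ++ [y])) (x.length * 4 + y.length * 10 + 3)
      (st (l ++ [y])) := by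
  set σ := st (l ++ [x] ++ [y]) with hσ
  have hx : σ l.length = x := by simp [hσ, st]
  have hy : σ (l.length + 1) = y := by simp [hσ, st]
  have hz : σ (l.length + 2) = [] := by simp [hσ, st]
  have h1 := Prog.pour_runs l.length [] (by simp) (by simp) σ
  have h2 := Prog.pour_runs (l.length + 1) [l.length + 2] (by simp) (by simp)
    (fun x => if x = l.length then [] else if x ∈ [] then (σ l.length).reverse ++ σ x else σ x)
  have h3 := h1.seq (h2.seq (Prog.pour_runs (l.length + 2) [l.length] (by simp) (by simp) _))
  refine Prog.Runs.of_eq (h3) ?_ ?_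
  · simp [hx, hy, hz]; ring
  · funext r
    by_cases h0 : r = l.length
    · subst h0; simp [hy, hz]; simp [st]
    · by_cases h1 : r = l.length + 1
      · subst h1; simp; rw [st_of_le (by simp)]
      · by_cases h2 : r = l.length + 2
        · subst h2; simp; rw [st_of_le (by simp)]
        · simp [h0, h1, h2]
          rcases Nat.lt_or_ge r l.length with h | h
          · rw [hσ, List.append_assoc, st_append_left h, st_append_left h]
          · rw [hσ, st_of_le (by simp; omega), st_of_le (by simp; omega)]

/-! ### Functions computable in polynomial time -/

/-- The values of a list of functions. -/
def ev {α : Type} (env : List (α → List Bool)) (a : α) : List (List Bool) := env.map fun e => e a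

/-- Total length of a list of stacks. -/
def size (l : List (List Bool)) : ℕ := (l.map List.length).sum

@[simp] theorem ev_append {α : Type} (e e' : List (α → List Bool)) (a : α) :
    ev (e ++ e') a = ev e a ++ ev e' a := by simp [ev]

@[simp] theorem ev_nil {α : Type} (a : α) : ev ([] : List (α → List Bool)) a = [] := rfl

@[simp] theorem ev_cons {α : Type} (f : α → List Bool) (e : List (α → List Bool)) (a : α) :
    ev (f :: e) a = f a :: ev e a := rfl

@[simp] theorem length_ev {α : Type} (e : List (α → List Bool)) (a : α) :
    (ev e a).length = e.length := by simp [ev]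

@[simp] theorem size_append (l m : List (List Bool)) : size (l ++ m) = size l + size m := by
  simp [size]

@[simp] theorem size_nil : size [] = 0 := rfl

@[simp] theorem size_cons (x : List Bool) (l : List (List Bool)) :
    size (x :: l) = x.length + size l := by simp [size]

theorem size_le_of_forall (l : List (List Bool)) (B : ℕ) (h : ∀ x ∈ l, x.length ≤ B) :
    size l ≤ l.length * B := by
  induction l with
  | nil => simp
  | cons x l ih =>
    simp only [size_cons, List.length_cons]
    have := ih fun y hy => h y (List.mem_cons_of_mem _ hy)
    have := h x List.mem_cons_self
    nlinarith

/-- Some program appends the stacks `fs a` to the stacks `env a` in time polynomial in the total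
length of `env a`. -/
def PolyMany {α : Type} (env fs : List (α → List Bool)) : Prop :=
  ∃ (P : Prog) (t : Polynomial ℕ), ∀ a, ∃ k, P.Runs (st (ev env a)) k (st (ev (env ++ fs) a)) ∧
    k ≤ t.eval (size (ev env a))

/-- The function `f` is computable from the functions `env` in polynomial time. -/
def PolyFn {α : Type} (env : List (α → List Bool)) (f : α → List Bool) : Prop :=
  PolyMany env [f]

section

variable {α β : Type} {env es fs : List (α → List Bool)}

/-- The stacks that receive the results are empty at the start, so their final length is at most the
running time. -/
theorem PolyMany.size_le (h : PolyMany env fs) :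
    ∃ q : Polynomial ℕ, ∀ a, size (ev fs a) ≤ q.eval (size (ev env a)) := by
  obtain ⟨P, t, hP⟩ := h
  refine ⟨fs.length * t, fun a => ?_⟩
  obtain ⟨k, hk, hkt⟩ := hP a
  have : size (ev fs a) ≤ (ev fs a).length * k := by
    refine size_le_of_forall _ _ fun x hx => ?_
    obtain ⟨i, hi, rfl⟩ := List.getElem_of_mem hx
    have := hk.length_le ((ev env a).length + i)
    rw [ev_append, st_append_right (by omega), st_of_le (l := ev env a) (by omega),
      Nat.add_sub_cancel_left, st, List.getD_eq_getElem _ _ hi] at this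
    simpa using this
  rw [length_ev] at this
  simp only [Polynomial.eval_mul, Polynomial.eval_natCast]
  exact this.trans (Nat.mul_le_mul_left _ hkt)

theorem PolyFn.length_le {f : α → List Bool} (h : PolyFn env f) :
    ∃ q : Polynomial ℕ, ∀ a, (f a).length ≤ q.eval (size (ev env a)) := by
  simpa using PolyMany.size_le h

theorem PolyMany.nil : PolyMany env [] :=
  ⟨.skip, 1, fun a => ⟨1, by simpa using Prog.Runs.skip _, by simp⟩⟩

theorem PolyMany.trans (h1 : PolyMany env es) (h2 : PolyMany (env ++ es) fs) :
    PolyMany env (es ++ fs) := by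
  obtain ⟨q, hq⟩ := h1.size_le
  obtain ⟨P, t, hP⟩ := h1
  obtain ⟨Q, u, hQ⟩ := h2
  -- The second program also has the intermediate results among its inputs, and `q` bounds their
  -- size.
  refine ⟨.seq P Q, t + u.comp (Polynomial.X + q), fun a => ?_⟩
  obtain ⟨k, hk, hkt⟩ := hP a
  obtain ⟨k', hk', hkt'⟩ := hQ a
  refine ⟨k + k', by simpa using hk.seq hk', ?_⟩
  simp only [Polynomial.eval_add, Polynomial.eval_comp, Polynomial.eval_X]
  refine Nat.add_le_add hkt (hkt'.trans (eval_mono _ ?_))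
  simpa using hq a

/-- Local variables may be used freely: each is erased afterwards by `dropSnd`. -/
theorem PolyMany.trim {f : α → List Bool} (h : PolyMany env (fs ++ [f])) : PolyFn env f := by
  induction fs using List.reverseRecOn with
  | nil => exact h
  | append_singleton fs g ih =>
    apply ih
    obtain ⟨q, hq⟩ := h.size_le
    obtain ⟨P, t, hP⟩ := h
    refine ⟨.seq P (.dropSnd (env ++ fs).length), t + (10 * q + 3), fun a => ?_⟩
    obtain ⟨k, hk, hkt⟩ := hP a
    have hd := Prog.dropSnd_runs (ev (env ++ fs) a) (g a) (f a)
    rw [length_ev] at hd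
    refine ⟨_, by simpa using hk.seq (by simpa using hd), ?_⟩
    have := hq a
    simp at this
    simp only [Polynomial.eval_add, Polynomial.eval_mul, Polynomial.eval_ofNat]
    omega

theorem PolyFn.var {f : α → List Bool} (hf : f ∈ env) : PolyFn env f := by
  obtain ⟨i, hi, rfl⟩ := List.getElem_of_mem hf
  refine ⟨.copyOnto i env.length (env.length + 1), 11 * Polynomial.X + 2, fun a => ?_⟩
  have h := Prog.copyOnto_runs (r := i) (t := env.length) (u := env.length + 1) (by omega)
    (by omega) (by omega) (st (ev env a)) (st_of_le (by simp))
  have hi' : st (ev env a) i = env[i] a := by simp [st, ev, hi]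
  rw [hi', st_of_le (r := env.length) (by simp)] at h
  have h2 := update_st (ev env a) (env[i] a)
  rw [length_ev] at h2
  rw [List.append_nil, h2] at h
  refine ⟨_, by simpa using h, ?_⟩
  have : (env[i] a).length ≤ size (ev env a) :=
    List.le_sum_of_mem (List.mem_map_of_mem (List.mem_map_of_mem (List.getElem_mem hi)))
  simp only [Polynomial.eval_add, Polynomial.eval_mul, Polynomial.eval_ofNat, Polynomial.eval_X]
  omega

/-- The context grows with every result already computed, so computability is required over all
extensions `es`. -/
theorem PolyMany.of_forall (fs : List (α → List Bool))
    (h : ∀ es, ∀ f ∈ fs, PolyFn (env ++ es) f) : PolyMany env fs := by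
  induction fs using List.reverseRecOn with
  | nil => exact .nil
  | append_singleton fs g ih =>
    exact (ih fun es f hf => h es f (List.mem_append_left _ hf)).trans (h fs g (by simp))

/-- A subroutine call: the arguments are evaluated onto new stacks, the program is shifted past the
caller's stacks, and the arguments are then trimmed. -/
theorem PolyMany.call {env : List (β → List Bool)} {f : α → List Bool} (φ : β → α)
    (h : PolyMany env (es.map fun e => e ∘ φ)) (hf : PolyFn es f) : PolyFn env (f ∘ φ) := by
  refine PolyMany.trim (h.trans ?_)
  obtain ⟨P, t, hP⟩ := hf
  have hev : ∀ b, ev (es.map fun e => e ∘ φ) b = ev es (φ b) := fun b => by simp [ev]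
  refine ⟨P.shift env.length, t, fun b => ?_⟩
  obtain ⟨k, hk, hkt⟩ := hP (φ b)
  have h := hk.shift (ev env b).length (st (ev env b))
  rw [← st_append, ← st_append, length_ev] at h
  refine ⟨k, by simpa [hev] using h, hkt.trans (eval_mono _ ?_)⟩
  simp [hev]

theorem PolyFn.weaken {f : α → List Bool} (h : PolyFn env f) (es : List (α → List Bool)) :
    PolyFn (env ++ es) f := by
  refine PolyMany.call id (PolyMany.of_forall _ ?_) h
  intro es' f hf
  refine PolyFn.var ?_
  simp at hf ⊢
  exact Or.inl hf

theorem PolyFn.call {env : List (β → List Bool)} {f : α → List Bool} (hf : PolyFn es f)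
    (φ : β → α) (h : ∀ e ∈ es, PolyFn env (e ∘ φ)) : PolyFn env (f ∘ φ) := by
  refine PolyMany.call φ (PolyMany.of_forall _ ?_) hf
  intro es' f hf
  obtain ⟨e, he, rfl⟩ := List.mem_map.1 hf
  exact (h e he).weaken es'

theorem PolyFn.nil : PolyFn env fun _ => [] :=
  ⟨.skip, 1, fun a => ⟨1, by simpa [st_snoc_nil] using Prog.Runs.skip _, by simp⟩⟩

theorem PolyFn.cons {f : α → List Bool} (b : Bool) (hf : PolyFn env f) :
    PolyFn env fun a => b :: f a := by
  obtain ⟨P, t, hP⟩ := hf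
  refine ⟨.seq P (.push env.length b), t + 1, fun a => ?_⟩
  obtain ⟨k, hk, hkt⟩ := hP a
  have h := Prog.Runs.push (st (ev env a ++ [f a])) (ev env a).length b
  have h0 : st (ev env a ++ [f a]) (ev env a).length = f a := by simp [st]
  rw [h0, update_st_snoc, length_ev] at h
  exact ⟨k + 1, by simpa using hk.seq (by simpa using h), by simpa using hkt⟩

theorem PolyFn.tail {f : α → List Bool} (hf : PolyFn env f) :
    PolyFn env fun a => (f a).tail := by
  obtain ⟨P, t, hP⟩ := hf
  refine ⟨.seq P (.pop env.length), t + 1, fun a => ?_⟩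
  obtain ⟨k, hk, hkt⟩ := hP a
  have h := Prog.Runs.pop (st (ev env a ++ [f a])) (ev env a).length
  have h0 : st (ev env a ++ [f a]) (ev env a).length = f a := by simp [st]
  rw [h0, update_st_snoc, length_ev] at h
  exact ⟨k + 1, by simpa using hk.seq (by simpa using h), by simpa using hkt⟩

theorem PolyFn.append {f g : α → List Bool} (hf : PolyFn env f) (hg : PolyFn env g) :
    PolyFn env fun a => f a ++ g a := by
  have key : PolyFn [fun p : List Bool × List Bool => p.1, fun p => p.2]
      fun p => p.1 ++ p.2 := by
    refine ⟨.seq (.copyOnto 1 2 3) (.copyOnto 0 2 3), 11 * Polynomial.X + 4, fun p => ?_⟩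
    have h1 := Prog.copyOnto_runs (r := 1) (t := 2) (u := 3) (by omega) (by omega) (by omega)
      (st [p.1, p.2]) rfl
    have h2 := Prog.copyOnto_runs (r := 0) (t := 2) (u := 3) (by omega) (by omega) (by omega)
      (st ([p.1, p.2] ++ [p.2])) rfl
    have e1 := update_st [p.1, p.2] p.2
    have e2 := update_st_snoc [p.1, p.2] p.2 (p.1 ++ p.2)
    refine ⟨p.2.length * 11 + 2 + (p.1.length * 11 + 2), ?_, ?_⟩
    · refine Prog.Runs.seq (τ := st ([p.1, p.2] ++ [p.2])) ?_ ?_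
      · rw [← e1]; simpa [st] using h1
      · simp only [ev_append, ev_cons, ev_nil]
        rw [← e2]; simpa [st] using h2
    · simp; omega
  have := key.call (env := env) (fun a => (f a, g a)) (by
    intro e he
    simp at he
    rcases he with rfl | rfl
    · exact hf
    · exact hg)
  exact this

/-- Case distinction on the top of a stack. -/
def caseTop {γ : Sort*} (c : List Bool) (x y z : γ) : γ :=
  match c with
  | [] => x
  | false :: _ => y
  | true :: _ => z

theorem PolyFn.caseTop {c f g h : α → List Bool} (hc : PolyFn env c) (hf : PolyFn env f)
    (hg : PolyFn env g) (hh : PolyFn env h) :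
    PolyFn env fun a => caseTop (c a) (f a) (g a) (h a) := by
  refine PolyMany.trim (hc.trans ?_)
  obtain ⟨P, t, hP⟩ := hf.weaken [c]
  obtain ⟨Q, u, hQ⟩ := hg.weaken [c]
  obtain ⟨R, v, hR⟩ := hh.weaken [c]
  refine ⟨.branch env.length P Q R, t + u + v + 1, fun a => ?_⟩
  have h0 : st (ev (env ++ [c]) a) env.length = c a := by simp [st]
  obtain ⟨k, hk, hkt⟩ := hP a
  obtain ⟨k', hk', hkt'⟩ := hQ a
  obtain ⟨k'', hk'', hkt''⟩ := hR a
  simp only [Polynomial.eval_add, Polynomial.eval_one]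
  rcases hca : c a with _ | ⟨_ | _, l⟩
  · exact ⟨k + 1, .branch_nil (h0.trans hca) (by simpa [HiddenSubspace.caseTop, hca] using hk),
      by omega⟩
  · exact ⟨k' + 1, .branch_false (h0.trans hca)
      (by simpa [HiddenSubspace.caseTop, hca] using hk'), by omega⟩
  · exact ⟨k'' + 1, .branch_true (h0.trans hca)
      (by simpa [HiddenSubspace.caseTop, hca] using hk''), by omega⟩

end

/-! ### Bounded loops -/

/-- The state of a loop after `i` rounds. -/
def iterate (x : List Bool) (step : ℕ → List Bool → List Bool) : ℕ → List Bool
  | 0 => x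
  | i + 1 => step i (iterate x step i)

/-- The body of a loop with step program `P` on `b` parameter stacks, a counter, the index and the
state. -/
def Prog.round (b : ℕ) (P : Prog) : Prog :=
  .seq P (.seq (.dropSnd (b + 2)) (.seq (.pop b) (.push (b + 1) true)))

theorem Prog.round_runs {P : Prog} {e : List (List Bool)} {c i x y : List Bool} {k : ℕ}
    (h : P.Runs (st (e ++ [c, i, x])) k (st (e ++ [c, i, x, y]))) :
    (Prog.round e.length P).Runs (st (e ++ [c, i, x])) (k + (x.length * 4 + y.length * 10 + 5))
      (st (e ++ [c.tail, true :: i, y])) := by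
  have h1 := Prog.dropSnd_runs (e ++ [c, i]) x y
  rw [show (e ++ [c, i]).length = e.length + 2 by simp] at h1
  have h2 := h.seq ((show (Prog.dropSnd (e.length + 2)).Runs (st (e ++ [c, i, x, y])) _
    (st (e ++ [c, i, y])) by simpa using h1).seq ((Prog.Runs.pop _ e.length).seq
      (Prog.Runs.push _ (e.length + 1) true)))
  refine h2.of_eq (by ring) ?_
  funext r
  rcases Nat.lt_or_ge r e.length with hr | hr
  · rw [Function.update_of_ne (by omega), Function.update_of_ne (by omega), st_append_left hr,
      st_append_left hr]
  · obtain ⟨j, rfl⟩ := Nat.exists_eq_add_of_le hr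
    rcases j with _ | _ | j
    · simp [st]
    · simp [st]
    · rw [Function.update_of_ne (by omega), Function.update_of_ne (by omega),
        st_append_right hr, st_append_right hr, Nat.add_sub_cancel_left]
      simp [st]

/-- Induction on the number `j` of remaining rounds. The constant `T` covers one execution of `P`
and the bookkeeping of the round; one more step per round is the loop test. -/
theorem Prog.loop_round_runs {P : Prog} {e : List (List Bool)} (x : List Bool)
    (step : ℕ → List Bool → List Bool) (c : List Bool) (T : ℕ)
    (h : ∀ i ≤ c.length, ∃ k, P.Runs
      (st (e ++ [c.drop i, List.replicate i true, iterate x step i])) k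
      (st (e ++ [c.drop i, List.replicate i true, iterate x step i, iterate x step (i + 1)])) ∧
        k + ((iterate x step i).length * 4 + (iterate x step (i + 1)).length * 10 + 5) ≤ T)
    (j : ℕ) : ∀ i, i + j = c.length → ∃ k, (Prog.loop e.length (Prog.round e.length P)).Runs
      (st (e ++ [c.drop i, List.replicate i true, iterate x step i])) k
      (st (e ++ [[], List.replicate c.length true, iterate x step c.length])) ∧
        k ≤ j * (T + 1) + 1 := by
  induction j with
  | zero =>
    rintro i rfl
    refine ⟨1, ?_, by omega⟩
    have : c.drop c.length = [] := by simp
    simp only [this]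
    exact .loop_done (by simp [st])
  | succ j ih =>
    intro i hi
    obtain ⟨k, hk, hkT⟩ := h i (by omega)
    obtain ⟨k', hk', hkT'⟩ := ih (i + 1) (by omega)
    have hne : c.drop i ≠ [] := by simp; omega
    have hr := Prog.round_runs hk
    rw [List.tail_drop] at hr
    refine ⟨_, .loop_step (by simpa [st] using hne) hr hk', ?_⟩
    nlinarith

section

variable {α : Type} {env : List (α → List Bool)}

/-- The bound on the intermediate states is essential: a polynomial-time step might double its
state, and the states would then grow exponentially. -/
theorem PolyFn.loop {cnt init : α → List Bool} {step : α → ℕ → List Bool → List Bool}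
    (hcnt : PolyFn env cnt) (hinit : PolyFn env init)
    (hstep : PolyFn (α := α × ℕ × List Bool)
      (env.map (fun e p => e p.1) ++ [fun p => List.replicate p.2.1 true, fun p => p.2.2])
      fun p => step p.1 p.2.1 p.2.2)
    (hbound : ∃ q : Polynomial ℕ, ∀ a i, i ≤ (cnt a).length →
      (iterate (init a) (step a) i).length ≤ q.eval (size (ev env a))) :
    PolyFn env fun a => iterate (init a) (step a) (cnt a).length := by
  obtain ⟨q, hq⟩ := hbound
  obtain ⟨qc, hqc⟩ := hcnt.length_le
  -- Inside the loop the remaining counter is one more stack, which the step does not read.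
  have hstep' : PolyFn (α := α × List Bool × ℕ × List Bool)
      (env.map (fun e p => e p.1) ++
        [fun p => p.2.1, fun p => List.replicate p.2.2.1 true, fun p => p.2.2.2])
      fun p => step p.1 p.2.2.1 p.2.2.2 := by
    refine hstep.call (fun p : α × List Bool × ℕ × List Bool => (p.1, p.2.2.1, p.2.2.2)) ?_
    intro e he
    refine PolyFn.var ?_
    simp only [List.mem_append, List.mem_map, List.mem_cons, List.not_mem_nil, or_false] at he ⊢
    rcases he with ⟨e, he, rfl⟩ | rfl | rfl
    · exact Or.inl ⟨e, he, rfl⟩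
    · exact Or.inr (Or.inr (Or.inl rfl))
    · exact Or.inr (Or.inr (Or.inr rfl))
  obtain ⟨q', hq'⟩ := hstep'.length_le
  obtain ⟨P, t, hP⟩ := hstep'
  have hpre : PolyMany env [cnt, fun _ => [], init] := by
    refine hcnt.trans (PolyMany.trans (es := [fun _ => []]) PolyFn.nil ?_)
    exact (hinit.weaken _).weaken _
  refine PolyMany.trim (fs := [fun _ => [], fun a => List.replicate (cnt a).length true]) ?_
  obtain ⟨P0, t0, hP0⟩ := hpre
  -- the size of the stacks at the start of a round
  set B : Polynomial ℕ := Polynomial.X + 2 * qc + q with hB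
  set T : Polynomial ℕ := t.comp B + 4 * q + 10 * q'.comp B + 5 with hT
  refine ⟨.seq P0 (.loop env.length (.round env.length P)), t0 + qc * (T + 1) + 1, fun a => ?_⟩
  obtain ⟨k0, hk0, hkt0⟩ := hP0 a
  have key := Prog.loop_round_runs (P := P) (e := ev env a) (init a) (step a) (cnt a)
    (T.eval (size (ev env a))) (by
      intro i hi
      obtain ⟨k, hk, hkt⟩ := hP (a, (cnt a).drop i, i, iterate (init a) (step a) i)
      have hev : ev (env.map (fun e (p : α × List Bool × ℕ × List Bool) => e p.1) ++
        [fun p => p.2.1, fun p => List.replicate p.2.2.1 true, fun p => p.2.2.2])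
        (a, (cnt a).drop i, i, iterate (init a) (step a) i) =
        ev env a ++ [(cnt a).drop i, List.replicate i true, iterate (init a) (step a) i] := by
          simp [ev]
      have hsz : size (ev env a ++
          [(cnt a).drop i, List.replicate i true, iterate (init a) (step a) i])
          ≤ B.eval (size (ev env a)) := by
        have := hq a i hi
        have := hqc a
        simp [hB]
        omega
      refine ⟨k, ?_, ?_⟩
      · rw [ev_append _ [_], hev] at hk
        simpa [iterate] using hk
      · have h1 := hq a i hi
        have h2 := hq' (a, (cnt a).drop i, i, iterate (init a) (step a) i)
        rw [hev] at hkt h2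
        have h3 := eval_mono t hsz
        have h4 := eval_mono q' hsz
        have h5 : (iterate (init a) (step a) (i + 1)).length ≤
            (q'.comp B).eval (size (ev env a)) := by
          rw [Polynomial.eval_comp]; exact h2.trans h4
        simp only [hT, Polynomial.eval_add, Polynomial.eval_mul, Polynomial.eval_ofNat] at h5 ⊢
        have h6 : k ≤ (t.comp B).eval (size (ev env a)) := by
          rw [Polynomial.eval_comp]; exact hkt.trans h3
        omega)
    (cnt a).length 0 (by omega)
  obtain ⟨k1, hk1, hkt1⟩ := key
  rw [length_ev] at hk1
  refine ⟨k0 + k1, ?_, ?_⟩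
  · refine Prog.Runs.seq hk0 ?_
    simpa [iterate] using hk1
  · have := Nat.mul_le_mul_right (T.eval (size (ev env a)) + 1) (hqc a)
    simp only [Polynomial.eval_add, Polynomial.eval_mul, Polynomial.eval_one]
    omega

/-- A context extended by a number in unary notation. -/
def ext (env : List (α → List Bool)) : List (α × ℕ → List Bool) :=
  env.map (fun e p => e p.1) ++ [fun p => List.replicate p.2 true]

theorem PolyFn.lift {f : α → List Bool} (hf : PolyFn env f) :
    PolyFn (ext env) fun p => f p.1 := by
  refine hf.call (fun p : α × ℕ => p.1) fun e he => PolyFn.var ?_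
  exact List.mem_append_left _ (List.mem_map_of_mem he)

theorem PolyFn.index : PolyFn (ext env) fun p => List.replicate p.2 true :=
  PolyFn.var (by simp [ext])

theorem PolyFn.flatMap {cnt : α → List Bool} {g : α → ℕ → List Bool} (hcnt : PolyFn env cnt)
    (hg : PolyFn (ext env) fun p => g p.1 p.2) :
    PolyFn env fun a => (List.range (cnt a).length).flatMap (g a) := by
  have hit : ∀ a i, iterate [] (fun i x => x ++ g a i) i = (List.range i).flatMap (g a) := by
    intro a i
    induction i with
    | zero => rfl
    | succ i ih => simp [iterate, ih, List.range_succ]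
  have := PolyFn.loop (env := env) (cnt := cnt) (init := fun _ => [])
    (step := fun a i x => x ++ g a i) hcnt PolyFn.nil ?_ ?_
  · simpa only [hit] using this
  · refine PolyFn.append (PolyFn.var (by simp)) ?_
    refine hg.call (fun p : α × ℕ × List Bool => (p.1, p.2.1)) fun e he => PolyFn.var ?_
    simp only [ext, List.mem_append, List.mem_map, List.mem_cons, List.not_mem_nil,
      or_false] at he ⊢
    rcases he with ⟨e, he, rfl⟩ | rfl
    · exact Or.inl ⟨e, he, rfl⟩
    · exact Or.inr (Or.inl rfl)
  · obtain ⟨q, hq⟩ := hg.length_le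
    obtain ⟨qc, hqc⟩ := hcnt.length_le
    refine ⟨qc * q.comp (Polynomial.X + qc), fun a i hi => ?_⟩
    rw [hit, List.length_flatMap]
    have h1 : (List.map (fun j => (g a j).length) (List.range i)).sum
        ≤ (List.map (fun j => (g a j).length) (List.range i)).length •
          q.eval (size (ev env a) + qc.eval (size (ev env a))) := by
      refine List.sum_le_card_nsmul _ _ fun x hx => ?_
      obtain ⟨j, hj, rfl⟩ := List.mem_map.1 hx
      refine (hq (a, j)).trans (eval_mono q ?_)
      have hj' := List.mem_range.1 hj
      have : ev (ext env) (a, j) = ev env a ++ [List.replicate j true] := by simp [ev, ext]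
      rw [this]
      have := hqc a
      simp
      omega
    refine h1.trans ?_
    simp only [List.length_map, List.length_range, smul_eq_mul, Polynomial.eval_mul,
      Polynomial.eval_comp, Polynomial.eval_add, Polynomial.eval_X]
    exact Nat.mul_le_mul_right _ (hi.trans (hqc a))

theorem PolyFn.congr {f g : α → List Bool} (hf : PolyFn env f) (h : ∀ a, g a = f a) :
    PolyFn env g := by
  rwa [show g = f from funext h]

/-! ### Unary arithmetic and access to lists -/

/-- A function with values in `ℕ`, written in unary, is computable in polynomial time. -/
def PolyNat (env : List (α → List Bool)) (f : α → ℕ) : Prop :=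
  PolyFn env fun a => List.replicate (f a) true

theorem PolyFn.drop {c f : α → List Bool} (hc : PolyFn env c) (hf : PolyFn env f) :
    PolyFn env fun a => (f a).drop (c a).length := by
  have hit : ∀ a i, iterate (f a) (fun _ x => x.tail) i = (f a).drop i := by
    intro a i
    induction i with
    | zero => rfl
    | succ i ih => simp [iterate, ih]
  have := PolyFn.loop (env := env) (cnt := c) (init := f) (step := fun _ _ x => x.tail) hc hf
    (PolyFn.tail (PolyFn.var (by simp))) ?_
  · simpa only [hit] using this
  · obtain ⟨q, hq⟩ := hf.length_le
    exact ⟨q, fun a i _ => by rw [hit]; exact (by simp : _ ≤ (f a).length).trans (hq a)⟩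

theorem PolyNat.const (k : ℕ) : PolyNat env fun _ => k := by
  induction k with
  | zero => exact PolyFn.nil
  | succ k ih => exact PolyFn.cons true ih

theorem PolyNat.add {f g : α → ℕ} (hf : PolyNat env f) (hg : PolyNat env g) :
    PolyNat env fun a => f a + g a :=
  (PolyFn.append hf hg).congr fun a => by simp

theorem PolyNat.sub {f g : α → ℕ} (hf : PolyNat env f) (hg : PolyNat env g) :
    PolyNat env fun a => f a - g a :=
  (PolyFn.drop hg hf).congr fun a => by simp

theorem PolyNat.lift {f : α → ℕ} (hf : PolyNat env f) : PolyNat (ext env) fun p => f p.1 :=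
  PolyFn.lift hf

theorem PolyNat.index : PolyNat (ext env) fun p => p.2 := PolyFn.index

theorem PolyFn.range {cnt : α → ℕ} {g : α → ℕ → List Bool} (hcnt : PolyNat env cnt)
    (hg : PolyFn (ext env) fun p => g p.1 p.2) :
    PolyFn env fun a => (List.range (cnt a)).flatMap (g a) :=
  (PolyFn.flatMap hcnt hg).congr fun a => by simp

theorem PolyNat.mul {f g : α → ℕ} (hf : PolyNat env f) (hg : PolyNat env g) :
    PolyNat env fun a => f a * g a := by
  refine (PolyFn.range hf (g := fun a _ => List.replicate (g a) true) hg.lift).congr fun a => ?_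
  beta_reduce
  induction f a with
  | zero => simp
  | succ k ih => rw [List.range_succ, List.flatMap_append, ← ih]; simp [Nat.succ_mul]

theorem PolyNat.eval {f : α → ℕ} (hf : PolyNat env f) (p : Polynomial ℕ) :
    PolyNat env fun a => p.eval (f a) := by
  induction p using Polynomial.induction_on' with
  | add p q hp hq => simpa only [Polynomial.eval_add] using hp.add hq
  | monomial k c =>
    simp only [Polynomial.eval_monomial]
    refine PolyNat.mul (.const c) ?_
    induction k with
    | zero => simpa using PolyNat.const 1
    | succ k ih => simpa only [pow_succ] using ih.mul hf

theorem PolyNat.length {f : α → List Bool} (hf : PolyFn env f) :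
    PolyNat env fun a => (f a).length := by
  refine (PolyFn.flatMap hf (g := fun _ _ => [true]) (PolyFn.nil.cons true)).congr fun a => ?_
  beta_reduce
  induction (f a).length with
  | zero => rfl
  | succ k ih => rw [List.range_succ, List.flatMap_append, ← ih, List.replicate_succ']; rfl

/-- Truncated subtraction decides the order: `g - f` in unary is a nonempty stack exactly if `f <
g`. -/
theorem PolyFn.ite_lt {f g : α → ℕ} {x y : α → List Bool} (hf : PolyNat env f)
    (hg : PolyNat env g) (hx : PolyFn env x) (hy : PolyFn env y) :
    PolyFn env fun a => if f a < g a then x a else y a := by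
  refine (PolyFn.caseTop (hg.sub hf) hy hx hx).congr fun a => ?_
  beta_reduce
  split_ifs with h
  · obtain ⟨k, hk⟩ : ∃ k, g a - f a = k + 1 := ⟨g a - f a - 1, by omega⟩
    simp [hk, List.replicate_succ, HiddenSubspace.caseTop]
  · rw [Nat.sub_eq_zero_of_le (by omega)]; rfl

theorem PolyFn.ite_bit {f x y : α → List Bool} {i : α → ℕ} (hf : PolyFn env f)
    (hi : PolyNat env i) (hx : PolyFn env x) (hy : PolyFn env y) :
    PolyFn env fun a => if (f a)[i a]? = some true then x a else y a := by
  refine (PolyFn.caseTop (PolyFn.drop hi hf) hy hy hx).congr fun a => ?_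
  have h : ((f a).drop (i a)).head? = (f a)[i a]? := by simp
  simp only [List.length_replicate]
  rw [← h]
  rcases (f a).drop (i a) with _ | ⟨_ | _, l⟩ <;> simp [HiddenSubspace.caseTop]

theorem PolyFn.iterate_le {c f : α → List Bool} {g : List Bool → List Bool} (hc : PolyFn env c)
    (hf : PolyFn env f) (hg : PolyFn [id] g) (hle : ∀ x, (g x).length ≤ x.length) :
    PolyFn env fun a => g^[(c a).length] (f a) := by
  have hit : ∀ a i, iterate (f a) (fun _ x => g x) i = g^[i] (f a) := by
    intro a i
    induction i with
    | zero => rfl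
    | succ i ih => rw [Function.iterate_succ_apply', ← ih]; rfl
  have := PolyFn.loop (env := env) (cnt := c) (init := f) (step := fun _ _ x => g x) hc hf ?_ ?_
  · simpa only [hit] using this
  · exact hg.call (fun p : α × ℕ × List Bool => p.2.2) fun e he => PolyFn.var (by
      simp at he; subst he; simp)
  · obtain ⟨q, hq⟩ := hf.length_le
    refine ⟨q, fun a i _ => ?_⟩
    refine le_trans ?_ (hq a)
    induction i with
    | zero => rfl
    | succ i ih => exact (hle _).trans (ih (by omega))

theorem PolyFn.comp {g : List Bool → List Bool} {f : α → List Bool} (hg : PolyFn [id] g)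
    (hf : PolyFn env f) : PolyFn env fun a => g (f a) :=
  hg.call f fun e he => by simp at he; subst he; exact hf

theorem PolyNat.comp {g : List Bool → ℕ} {f : α → List Bool} (hg : PolyNat [id] g)
    (hf : PolyFn env f) : PolyNat env fun a => g (f a) :=
  PolyFn.comp hg hf

/-! ### The unary numbers at the start of a list -/

/-- The number of leading `true`s. -/
def lead (x : List Bool) : ℕ := (x.takeWhile id).length

/-- The list after a leading unary number. -/
def skipUnary (x : List Bool) : List Bool := x.drop (lead x + 1)

@[simp] theorem lead_true_cons (x : List Bool) : lead (true :: x) = lead x + 1 := by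
  simp [lead]

@[simp] theorem lead_false_cons (x : List Bool) : lead (false :: x) = 0 := by simp [lead]

theorem unary_succ (k : ℕ) : unary (k + 1) = true :: unary k := rfl

theorem unary_zero : unary 0 = [false] := rfl

@[simp] theorem lead_unary_append (k : ℕ) (x : List Bool) : lead (unary k ++ x) = k := by
  induction k with
  | zero => simp [unary_zero]
  | succ k ih => simp [unary_succ, ih]

@[simp] theorem skipUnary_unary_append (k : ℕ) (x : List Bool) :
    skipUnary (unary k ++ x) = x := by
  rw [skipUnary, lead_unary_append]
  induction k with
  | zero => simp [unary_zero]
  | succ k ih => simpa [unary_succ] using ih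

theorem lead_le_length (x : List Bool) : lead x ≤ x.length := by
  induction x with
  | nil => simp [lead]
  | cons b x ih => cases b <;> simp [ih]

theorem drop_of_lt_lead {x : List Bool} {i : ℕ} (h : i < lead x) : ∃ l, x.drop i = true :: l := by
  induction x generalizing i with
  | nil => simp [lead] at h
  | cons b x ih =>
    cases b with
    | false => simp at h
    | true =>
      cases i with
      | zero => exact ⟨x, rfl⟩
      | succ i => exact ih (by simpa using h)

theorem caseTop_drop_lead {γ : Type} (x : List Bool) (y z : γ) :
    caseTop (x.drop (lead x)) y y z = y := by
  induction x with
  | nil => rfl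
  | cons b x ih =>
    cases b with
    | false => simp [HiddenSubspace.caseTop]
    | true => simpa using ih

@[simp] theorem lead_nil : lead [] = 0 := rfl

@[simp] theorem skipUnary_nil : skipUnary [] = [] := rfl

theorem length_skipUnary_le (x : List Bool) : (skipUnary x).length ≤ x.length := by
  simp [skipUnary]

theorem PolyFn.id' : PolyFn (α := List Bool) [id] fun x => x := PolyFn.var (f := id) (by simp)

/-- The length of the loop state is the reading position. The state grows as long as the bit at this
position is `true` and is constant from then on. -/
theorem polyNat_lead : PolyNat [id] lead := by
  have hit : ∀ (x : List Bool) i, iterate [] (fun _ y =>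
      caseTop (x.drop y.length) y y (true :: y)) i = List.replicate (min i (lead x)) true := by
    intro x i
    induction i with
    | zero => simp [iterate]
    | succ i ih =>
      simp only [iterate, ih, List.length_replicate]
      rcases Nat.lt_or_ge i (lead x) with h | h
      · obtain ⟨l, hl⟩ := drop_of_lt_lead h
        rw [min_eq_left h.le, min_eq_left (by omega), hl]
        rfl
      · rw [min_eq_right h, min_eq_right (by omega), caseTop_drop_lead]
  have := PolyFn.loop (env := [id]) (cnt := id) (init := fun _ => [])
    (step := fun x _ y => caseTop (x.drop y.length) y y (true :: y)) PolyFn.id' PolyFn.nil ?_ ?_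
  · refine this.congr fun x => ?_
    rw [hit, id, min_eq_right (lead_le_length x)]
  · have hy : PolyFn (α := List Bool × ℕ × List Bool)
      ([id].map (fun e p => e p.1) ++ [fun p => List.replicate p.2.1 true, fun p => p.2.2])
      fun p => p.2.2 := PolyFn.var (by simp)
    refine PolyFn.caseTop (PolyFn.drop hy (PolyFn.var ?_)) hy hy (hy.cons true)
    simp
  · refine ⟨Polynomial.X, fun a i hi => ?_⟩
    rw [hit]
    simp at hi ⊢
    omega

theorem polyFn_skipUnary : PolyFn [id] skipUnary :=
  (PolyFn.drop (polyNat_lead.add (.const 1)) PolyFn.id').congr fun x => by simp [skipUnary]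

theorem PolyNat.unary {f : α → ℕ} (hf : PolyNat env f) : PolyFn env fun a => HiddenSubspace.unary (f a) :=
  PolyFn.append hf (PolyFn.nil.cons false)

end

/-! ### Input and output conventions -/

/-- Empty the stacks `b, …, b + d - 1`. -/
def Prog.clear (b : ℕ) : ℕ → Prog
  | 0 => .skip
  | d + 1 => .seq (clear b d) (.pour (b + d) [])

theorem Prog.clear_runs (b B d : ℕ) (σ : Store) (hB : ∀ r, (σ r).length ≤ B) : ∃ k,
    (Prog.clear b d).Runs σ k (fun r => if b ≤ r ∧ r < b + d then [] else σ r) ∧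
      k ≤ d * (4 * B + 1) + 1 := by
  induction d with
  | zero => exact ⟨1, (Prog.Runs.skip σ).of_eq rfl (by funext r; simp), by simp⟩
  | succ d ih =>
    obtain ⟨k, hk, hkB⟩ := ih
    refine ⟨_, (hk.seq (Prog.pour_runs (b + d) [] (by simp) (by simp) _)).of_eq rfl ?_, ?_⟩
    · funext r
      by_cases hr : r = b + d
      · subst hr; simp
      · have : (r < b + (d + 1)) ↔ r < b + d := by omega
        simp [hr, this]
    · have := hB (b + d)
      simp
      nlinarith

/-- An arbitrary program may destroy its input and leave garbage. It is run one stack further on a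
copy of the input, and the stacks after the output that it could have touched are cleared. -/
theorem PolyFn.of_runs {α : Type} {e f : α → List Bool} (P : Prog) (t : Polynomial ℕ)
    (h : ∀ a, ∃ k τ, P.Runs (inputStore (e a)) k τ ∧ k ≤ t.eval (e a).length ∧ τ 0 = f a) :
    PolyFn [e] f := by
  refine ⟨.seq (.copyOnto 0 1 2) (.seq (P.shift 1) (.clear 2 P.width)),
    11 * Polynomial.X + 2 + t + (P.width : Polynomial ℕ) * (4 * (Polynomial.X + t) + 1) + 1, fun a => ?_⟩
  obtain ⟨k, τ, hk, hkt, hτ⟩ := h a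
  have h1 := Prog.copyOnto_runs (r := 0) (t := 1) (u := 2) (by omega) (by omega) (by omega)
    (st [e a]) rfl
  have e1 : Function.update (st [e a]) 1 (st [e a] 0 ++ st [e a] 1)
      = Store.behind 1 (st [e a]) (inputStore (e a)) := by
    have := update_st [e a] (e a)
    have h3 := st_append [e a] [e a]
    rw [inputStore_eq]
    simp at this h3
    rw [← h3, ← this]
    simp [st]
  rw [e1] at h1
  have h2 := hk.shift 1 (st [e a])
  have hB : ∀ r, (Store.behind 1 (st [e a]) τ r).length ≤ (e a).length + k := by
    intro r
    have := h2.length_le r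
    refine this.trans ?_
    rw [inputStore_eq]
    have h3 := st_append [e a] [e a]
    simp at h3
    rw [← h3]
    rcases r with _ | _ | r <;> simp [st]
  obtain ⟨k', hk', hkB'⟩ := Prog.clear_runs 2 _ P.width _ hB
  refine ⟨_, (h1.seq (h2.seq hk')).of_eq rfl ?_, ?_⟩
  · funext r
    rcases r with _ | _ | r
    · simp [Store.behind, st]
    · simp [Store.behind, st, hτ]
    · by_cases hr : r < P.width
      · rw [if_pos (by omega)]; simp [st]
      · rw [if_neg (by omega)]
        simp only [Store.behind]
        rw [if_neg (by omega), hk.eq_of_width_le _ (by omega), inputStore_eq]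
        simp [st]
  · have : st [e a] 0 = e a := rfl
    rw [this]
    have h4 := Nat.mul_le_mul_left P.width
      (show 4 * ((e a).length + k) + 1 ≤ 4 * ((e a).length + t.eval (e a).length) + 1 by omega)
    simp
    omega

/-- The machine convention expects the result in stack `0`, so the input lying there is dropped. -/
theorem PolyFn.exists_prog {α : Type} {e f : α → List Bool} (h : PolyFn [e] f) :
    ∃ (P : Prog) (t : Polynomial ℕ), ∀ a, ∃ k τ, P.Runs (inputStore (e a)) k τ ∧
      k ≤ t.eval (e a).length ∧ τ 0 = f a := by
  obtain ⟨q, hq⟩ := h.length_le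
  obtain ⟨P, t, hP⟩ := h
  refine ⟨.seq P (.dropSnd 0), t + 4 * Polynomial.X + 10 * q + 3, fun a => ?_⟩
  obtain ⟨k, hk, hkt⟩ := hP a
  rw [inputStore_eq]
  refine ⟨_, st [f a], hk.seq (Prog.dropSnd_runs [] (e a) (f a)), ?_, rfl⟩
  have := hq a
  simp at this hkt ⊢
  omega

/-! ### Circuits on wires of an arbitrary type -/

/-- A gate on wires of type `ι`. -/
inductive WGate (ι : Type) where
  | had (i : ι)
  | ph (i : ι)
  | tof (i j k : ι) (hij : i ≠ j) (hik : i ≠ k) (hjk : j ≠ k)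

namespace WGate

variable {ι κ : Type}

/-- The same gate on other wires. -/
def map (e : ι ↪ κ) : WGate ι → WGate κ
  | had i => had (e i)
  | ph i => ph (e i)
  | tof i j k hij hik hjk => tof (e i) (e j) (e k) (e.injective.ne hij) (e.injective.ne hik)
      (e.injective.ne hjk)

/-- Bit-string code of a gate whose wires have the numbers `ad`. -/
def code (ad : ι → ℕ) : WGate ι → List Bool
  | had i => unary 0 ++ unary (ad i)
  | ph i => unary 1 ++ unary (ad i)
  | tof i j k _ _ _ => unary 2 ++ unary (ad i) ++ unary (ad j) ++ unary (ad k)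

theorem code_map (e : ι ↪ κ) (ad : κ → ℕ) (g : WGate ι) : (g.map e).code ad = g.code (ad ∘ e) := by
  cases g <;> rfl

/-- Gates that undo a gate. -/
def inv : WGate ι → List (WGate ι)
  | had i => [had i]
  | ph i => [ph i, ph i, ph i]
  | tof i j k hij hik hjk => [tof i j k hij hik hjk]

/-- A gate of a circuit. -/
def ofGate {N : ℕ} : Gate N → WGate (Fin N)
  | .hadamard i => had i
  | .phase i => ph i
  | .toffoli i j k hij hik hjk => tof i j k hij hik hjk

/-- The gate of a circuit. -/
def toGate {N : ℕ} : WGate (Fin N) → Gate N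
  | had i => .hadamard i
  | ph i => .phase i
  | tof i j k hij hik hjk => .toffoli i j k hij hik hjk

@[simp] theorem ofGate_toGate {N : ℕ} (g : WGate (Fin N)) : ofGate g.toGate = g := by
  cases g <;> rfl

theorem encode_eq {N : ℕ} (g : Gate N) : g.encode = (ofGate g).code Fin.val := by
  cases g <;> rfl

end WGate

/-- A circuit that undoes a circuit. -/
def invGates {ι : Type} (gs : List (WGate ι)) : List (WGate ι) := gs.reverse.flatMap WGate.inv

/-- Bit-string code of a list of gates. -/
def codes {ι : Type} (ad : ι → ℕ) (gs : List (WGate ι)) : List Bool := gs.flatMap (WGate.code ad)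

@[simp] theorem codes_append {ι : Type} (ad : ι → ℕ) (gs hs : List (WGate ι)) :
    codes ad (gs ++ hs) = codes ad gs ++ codes ad hs := by simp [codes]

@[simp] theorem codes_nil {ι : Type} (ad : ι → ℕ) : codes ad ([] : List (WGate ι)) = [] := rfl

@[simp] theorem codes_cons {ι : Type} (ad : ι → ℕ) (g : WGate ι) (gs : List (WGate ι)) :
    codes ad (g :: gs) = g.code ad ++ codes ad gs := by simp [codes]

theorem codes_flatMap {ι β : Type} (ad : ι → ℕ) (l : List β) (f : β → List (WGate ι)) :
    codes ad (l.flatMap f) = l.flatMap fun b => codes ad (f b) := by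
  simp [codes, List.flatMap_assoc]

/-! ### Parsing codes of circuits -/

/-- Remove the code of the first gate. -/
def dropGate (x : List Bool) : List Bool :=
  if lead x < 2 then skipUnary (skipUnary x) else skipUnary (skipUnary (skipUnary (skipUnary x)))

/-- A function of the type and the wires of the first gate, with value `[]` if there is none. -/
def onGate (x : List Bool) (h p : ℕ → List Bool) (t : ℕ → ℕ → ℕ → List Bool) : List Bool :=
  let y := if lead x < 1 then h (lead (skipUnary x)) else if lead x < 2 then p (lead (skipUnary x))
    else t (lead (skipUnary x)) (lead (skipUnary (skipUnary x)))
      (lead (skipUnary (skipUnary (skipUnary x))))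
  caseTop x [] y y

/-- The values of the functions of `onGate` at a gate. -/
def WGate.elim {ι : Type} (ad : ι → ℕ) (h p : ℕ → List Bool) (t : ℕ → ℕ → ℕ → List Bool) :
    WGate ι → List Bool
  | had i => h (ad i)
  | ph i => p (ad i)
  | tof i j k _ _ _ => t (ad i) (ad j) (ad k)

section

variable {ι : Type} (ad : ι → ℕ)

theorem dropGate_code (g : WGate ι) (x : List Bool) : dropGate (g.code ad ++ x) = x := by
  cases g <;> simp [dropGate, WGate.code]

theorem dropGate_nil : dropGate [] = [] := by simp [dropGate]

theorem length_dropGate_le (x : List Bool) : (dropGate x).length ≤ x.length := by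
  unfold dropGate
  split_ifs
  · exact (length_skipUnary_le _).trans (length_skipUnary_le _)
  · exact (length_skipUnary_le _).trans ((length_skipUnary_le _).trans
      ((length_skipUnary_le _).trans (length_skipUnary_le _)))

theorem caseTop_unary {γ : Type} (k : ℕ) (x : List Bool) (a b : γ) :
    caseTop (unary k ++ x) a b b = b := by
  cases k <;> rfl

theorem onGate_code (g : WGate ι) (x : List Bool) (h p : ℕ → List Bool)
    (t : ℕ → ℕ → ℕ → List Bool) : onGate (g.code ad ++ x) h p t = g.elim ad h p t := by
  cases g <;> simp [onGate, WGate.code, WGate.elim, caseTop_unary]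

theorem iterate_dropGate (gs : List (WGate ι)) (i : ℕ) :
    dropGate^[i] (codes ad gs) = codes ad (gs.drop i) := by
  induction i generalizing gs with
  | zero => rfl
  | succ i ih =>
    cases gs with
    | nil => rw [Function.iterate_succ_apply, codes_nil, dropGate_nil, ← codes_nil ad, ih]; simp
    | cons g gs => rw [Function.iterate_succ_apply, codes_cons, dropGate_code, ih]; rfl

theorem onGate_iterate (gs : List (WGate ι)) (i : ℕ) (h p : ℕ → List Bool)
    (t : ℕ → ℕ → ℕ → List Bool) : onGate (dropGate^[i] (codes ad gs)) h p t
      = (gs[i]?.map (WGate.elim ad h p t)).getD [] := by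
  rw [iterate_dropGate]
  have : (gs.drop i).head? = gs[i]? := by simp
  rw [← this]
  rcases gs.drop i with _ | ⟨g, l⟩
  · rfl
  · rw [codes_cons, onGate_code]; rfl

theorem length_le_codes (gs : List (WGate ι)) : gs.length ≤ (codes ad gs).length := by
  induction gs with
  | nil => simp
  | cons g gs ih =>
    rw [codes_cons, List.length_append, List.length_cons]
    have : 1 ≤ (g.code ad).length := by cases g <;> simp [WGate.code, unary]
    omega

theorem filterMap_getElem? {γ : Type} (l : List γ) (L : ℕ) (h : l.length ≤ L) :
    (List.range L).filterMap (fun i => l[i]?) = l := by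
  induction l generalizing L with
  | nil => simp
  | cons a l ih =>
    obtain ⟨L, rfl⟩ : ∃ k, L = k + 1 := ⟨L - 1, by simp at h; omega⟩
    rw [List.range_succ_eq_map, List.filterMap_cons]
    simp only [List.getElem?_cons_zero, List.filterMap_map]
    congr 1
    exact ih L (by simpa using h)

theorem flatMap_getD {γ : Type} (l : List ℕ) (o : ℕ → Option γ) (f : γ → List Bool) :
    l.flatMap (fun i => ((o i).map f).getD []) = (l.filterMap o).flatMap f := by
  induction l with
  | nil => rfl
  | cons i l ih => cases h : o i <;> simp [h, ih]

/-- The concatenated values of the functions of `onGate` at the gates of a circuit. -/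
def mapCode (x : List Bool) (h p : ℕ → List Bool) (t : ℕ → ℕ → ℕ → List Bool) : List Bool :=
  (List.range x.length).flatMap fun i => onGate (dropGate^[i] x) h p t

/-- The number of gates need not be known: the length of the code bounds it, and positions beyond
the last gate contribute the empty list. -/
theorem mapCode_codes (gs : List (WGate ι)) (h p : ℕ → List Bool) (t : ℕ → ℕ → ℕ → List Bool) :
    mapCode (codes ad gs) h p t = gs.flatMap (WGate.elim ad h p t) := by
  simp only [mapCode, onGate_iterate, flatMap_getD]
  rw [filterMap_getElem? _ _ (length_le_codes ad gs)]

/-- The code of the inverse of a circuit. -/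
def invCode (x : List Bool) : List Bool :=
  (List.range x.length).flatMap fun i => onGate (dropGate^[x.length - (i + 1)] x)
    (fun w => unary 0 ++ unary w)
    (fun w => unary 1 ++ unary w ++ (unary 1 ++ unary w ++ (unary 1 ++ unary w)))
    (fun u v w => unary 2 ++ unary u ++ unary v ++ unary w)

theorem flatMap_reflect {γ : Type} (L : ℕ) (f : ℕ → List γ) :
    (List.range L).flatMap (fun i => f (L - (i + 1))) = (List.range L).reverse.flatMap f := by
  have : (List.range L).reverse = (List.range L).map fun i => L - (i + 1) := by
    apply List.ext_getElem
    · simp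
    · intro i h1 h2; simp; omega
  rw [this, List.flatMap_map]

/-- The positions are visited backwards, so the superfluous ones come first and contribute nothing;
then the gates follow in reverse order. -/
theorem invCode_codes (gs : List (WGate ι)) : invCode (codes ad gs) = codes ad (invGates gs) := by
  rw [invCode]
  simp only [onGate_iterate]
  rw [flatMap_reflect _ fun i => (gs[i]?.map (WGate.elim ad _ _ _)).getD [], flatMap_getD,
    List.filterMap_reverse, filterMap_getElem? _ _ (length_le_codes ad gs), invGates,
    codes_flatMap]
  congr 1
  funext g
  cases g <;> simp [WGate.elim, WGate.inv, WGate.code]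

end

section

variable {α : Type} {env : List (α → List Bool)}

theorem PolyFn.skipUnary {f : α → List Bool} (hf : PolyFn env f) :
    PolyFn env fun a => skipUnary (f a) := polyFn_skipUnary.comp hf

theorem PolyNat.lead {f : α → List Bool} (hf : PolyFn env f) :
    PolyNat env fun a => lead (f a) := polyNat_lead.comp hf

theorem polyFn_dropGate : PolyFn [id] dropGate := by
  have := PolyFn.id'
  exact PolyFn.ite_lt (PolyNat.lead this) (.const 2) this.skipUnary.skipUnary
    this.skipUnary.skipUnary.skipUnary.skipUnary

theorem PolyFn.onGate {x : α → List Bool} {h p : α → ℕ → List Bool}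
    {t : α → ℕ → ℕ → ℕ → List Bool} (hx : PolyFn env x)
    (hh : PolyFn env fun a => h a (HiddenSubspace.lead (HiddenSubspace.skipUnary (x a))))
    (hp : PolyFn env fun a => p a (HiddenSubspace.lead (HiddenSubspace.skipUnary (x a))))
    (ht : PolyFn env fun a => t a (HiddenSubspace.lead (HiddenSubspace.skipUnary (x a)))
      (HiddenSubspace.lead (HiddenSubspace.skipUnary (HiddenSubspace.skipUnary (x a))))
      (HiddenSubspace.lead (HiddenSubspace.skipUnary
        (HiddenSubspace.skipUnary (HiddenSubspace.skipUnary (x a)))))) :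
    PolyFn env fun a => onGate (x a) (h a) (p a) (t a) := by
  have hl := PolyNat.lead hx
  have := PolyFn.ite_lt hl (.const 1) hh (PolyFn.ite_lt hl (.const 2) hp ht)
  exact PolyFn.caseTop hx PolyFn.nil this this

theorem PolyFn.iterate_dropGate {x : α → List Bool} {i : α → ℕ} (hx : PolyFn env x)
    (hi : PolyNat env i) : PolyFn env fun a => dropGate^[i a] (x a) :=
  (PolyFn.iterate_le hi hx polyFn_dropGate length_dropGate_le).congr fun a => by simp

theorem PolyFn.invCode {x : α → List Bool} (hx : PolyFn env x) :
    PolyFn env fun a => invCode (x a) := by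
  refine PolyFn.flatMap hx (g := fun a i => HiddenSubspace.onGate (dropGate^[(x a).length - (i + 1)] (x a)) _ _ _)
    ?_
  have hy := PolyFn.iterate_dropGate hx.lift
    ((PolyNat.length hx).lift.sub (PolyNat.index.add (.const 1)))
  have h1 := (PolyNat.lead hy.skipUnary).unary
  have h2 := (PolyNat.lead hy.skipUnary.skipUnary).unary
  have h3 := (PolyNat.lead hy.skipUnary.skipUnary.skipUnary).unary
  refine PolyFn.onGate hy (((PolyNat.const 0).unary).append h1) ?_
    ((((PolyNat.const 2).unary.append h1).append h2).append h3)
  have := (PolyNat.const 1).unary.append h1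
  exact this.append (this.append this)

end

/-! ### States and operators -/

/-- Unnormalised states of qubits labelled by `ι`. -/
abbrev St (ι : Type) := (ι → ZMod 2) → ℂ

/-- Linear operators on states. -/
abbrev Op (ι : Type) := Module.End ℂ (St ι)

/-- The character of `ZMod 2`. -/
def sgn (b : ZMod 2) : ℂ := if b = 1 then -1 else 1

theorem zmod2_cases (b : ZMod 2) : b = 0 ∨ b = 1 := by
  revert b; decide

@[simp] theorem zmod2_add_self (b : ZMod 2) : b + b = 0 := by
  revert b; decide

@[simp] theorem bits_add_self {ι : Type} (u : ι → ZMod 2) : u + u = 0 := by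
  funext i; simp

@[simp] theorem bits_add_add_self {ι : Type} (z u : ι → ZMod 2) : z + u + u = z := by
  rw [add_assoc, bits_add_self, add_zero]

@[simp] theorem sgn_zero : sgn 0 = 1 := by simp [sgn]

@[simp] theorem sgn_one : sgn 1 = -1 := by simp [sgn]

theorem sgn_add (a b : ZMod 2) : sgn (a + b) = sgn a * sgn b := by
  rcases zmod2_cases a with rfl | rfl <;> rcases zmod2_cases b with rfl | rfl <;>
    simp [show (1 + 1 : ZMod 2) = 0 from rfl]

section

variable {ι κ : Type} [DecidableEq ι] [DecidableEq κ]

/-- The action of a gate. -/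
def WGate.op : WGate ι → Op ι
  | had i =>
    { toFun := fun ψ x => (ψ (Function.update x i 0) + sgn (x i) * ψ (Function.update x i 1))
        / (Real.sqrt 2 : ℂ)
      map_add' := fun ψ χ => by funext x; simp; ring
      map_smul' := fun c ψ => by funext x; simp; ring }
  | ph i =>
    { toFun := fun ψ x => (if x i = 1 then Complex.I else 1) * ψ x
      map_add' := fun ψ χ => by funext x; simp only [Pi.add_apply]; ring
      map_smul' := fun c ψ => by
        funext x; simp only [Pi.smul_apply, smul_eq_mul, RingHom.id_apply]; ring }
  | tof i j k _ _ _ =>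
    { toFun := fun ψ x => ψ (Function.update x k (x k + x i * x j))
      map_add' := fun ψ χ => rfl
      map_smul' := fun c ψ => rfl }

/-- The action of a circuit, the head of the list being applied first. -/
def run : List (WGate ι) → Op ι
  | [] => 1
  | g :: gs => run gs * g.op

@[simp] theorem run_nil : run ([] : List (WGate ι)) = 1 := rfl

theorem run_cons (g : WGate ι) (gs : List (WGate ι)) : run (g :: gs) = run gs * g.op := rfl

theorem run_append (gs hs : List (WGate ι)) : run (gs ++ hs) = run hs * run gs := by
  induction gs with
  | nil => simp
  | cons g gs ih => rw [List.cons_append, run_cons, ih, run_cons, mul_assoc]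

theorem Gate.apply_eq {N : ℕ} (g : Gate N) (ψ : QState N) :
    g.apply ψ = (WGate.ofGate g).op ψ := by
  cases g <;> rfl

theorem QCircuit.run_eq {w n : ℕ} (Q : QCircuit w n) (ψ : QState Q.qubits) :
    Q.run ψ = HiddenSubspace.run (Q.gates.map WGate.ofGate) ψ := by
  unfold QCircuit.run
  generalize Q.gates = gs
  induction gs generalizing ψ with
  | nil => rfl
  | cons g gs ih => rw [List.foldl_cons, ih, Gate.apply_eq]; rfl

open Classical in
/-- The projection on the basis states with a property. -/
def proj (p : (ι → ZMod 2) → Prop) : Op ι where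
  toFun ψ z := if p z then ψ z else 0
  map_add' ψ χ := by funext z; simp; split_ifs <;> simp
  map_smul' c ψ := by funext z; simp

open Classical in
theorem proj_apply (p : (ι → ZMod 2) → Prop) (ψ : St ι) (z : ι → ZMod 2) :
    proj p ψ z = if p z then ψ z else 0 := rfl

/-- The translation of basis states by a vector. -/
def tr (u : ι → ZMod 2) : Op ι where
  toFun ψ z := ψ (z + u)
  map_add' _ _ := rfl
  map_smul' _ _ := rfl

theorem tr_apply (u : ι → ZMod 2) (ψ : St ι) (z : ι → ZMod 2) : tr u ψ z = ψ (z + u) := rfl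

/-- The diagonal operator multiplying by a function. -/
def diag (f : (ι → ZMod 2) → ℂ) : Op ι where
  toFun ψ z := f z * ψ z
  map_add' ψ χ := by funext z; simp; ring
  map_smul' c ψ := by funext z; simp; ring

theorem diag_apply (f : (ι → ZMod 2) → ℂ) (ψ : St ι) (z : ι → ZMod 2) :
    diag f ψ z = f z * ψ z := rfl

/-- The wires of a gate. -/
def WGate.wires : WGate ι → Set ι
  | had i => {i}
  | ph i => {i}
  | tof i j k _ _ _ => {i, j, k}

/-- The wires whose value in a basis state may be changed by a gate. -/
def WGate.mods : WGate ι → Set ι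
  | had i => {i}
  | ph _ => ∅
  | tof _ _ k _ _ _ => {k}

/-- The property `p` of basis states does not depend on wire `i`. -/
def Indep (p : (ι → ZMod 2) → Prop) (i : ι) : Prop :=
  ∀ z b, p (Function.update z i b) ↔ p z

theorem op_ext {A B : Op ι} (h : ∀ ψ z, A ψ z = B ψ z) : A = B :=
  LinearMap.ext fun ψ => funext fun z => h ψ z

theorem commute_proj_proj (p q : (ι → ZMod 2) → Prop) : Commute (proj p) (proj q) := by
  classical
  refine op_ext fun ψ z => ?_
  simp only [Module.End.mul_apply, proj_apply]
  split_ifs <;> rfl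

theorem proj_mul_self (p : (ι → ZMod 2) → Prop) : proj p * proj p = proj p := by
  refine op_ext fun ψ z => ?_
  simp only [Module.End.mul_apply, proj_apply]
  split_ifs <;> rfl

theorem proj_mul_proj (p q : (ι → ZMod 2) → Prop) :
    proj p * proj q = proj fun z => p z ∧ q z := by
  refine op_ext fun ψ z => ?_
  simp only [Module.End.mul_apply, proj_apply]
  by_cases hp : p z <;> by_cases hq : q z <;> simp [hp, hq]

theorem commute_tr_tr (u v : ι → ZMod 2) : Commute (tr u) (tr v) := by
  refine op_ext fun ψ z => ?_
  simp only [Module.End.mul_apply, tr_apply]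
  congr 1
  abel

theorem tr_mul_tr (u v : ι → ZMod 2) : tr u * tr v = tr (u + v) := by
  refine op_ext fun ψ z => ?_
  simp only [Module.End.mul_apply, tr_apply]
  congr 1
  abel

theorem tr_zero : tr (0 : ι → ZMod 2) = 1 := by
  refine op_ext fun ψ z => ?_
  simp [tr_apply]

theorem commute_tr_proj {u : ι → ZMod 2} {p : (ι → ZMod 2) → Prop} (h : ∀ z, p (z + u) ↔ p z) :
    Commute (tr u) (proj p) := by
  refine op_ext fun ψ z => ?_
  classical exact if_congr (h z) rfl rfl

/-- A phase gate is diagonal and a Toffoli gate only reads its controls, so only the wires in `mods`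
can spoil a property of basis states. -/
theorem commute_op_proj {g : WGate ι} {p : (ι → ZMod 2) → Prop} (h : ∀ i ∈ g.mods, Indep p i) :
    Commute g.op (proj p) := by
  refine op_ext fun ψ z => ?_
  cases g with
  | had i =>
    have := h i rfl
    have h0 := this z 0
    have h1 := this z 1
    by_cases hz : p z <;>
      simp [Module.End.mul_apply, WGate.op, proj_apply, hz, h0, h1]
  | ph i =>
    simp only [Module.End.mul_apply, WGate.op, LinearMap.coe_mk, AddHom.coe_mk, proj_apply]
    split_ifs <;> simp
  | tof i j k =>
    have := h k rfl
    classical exact if_congr (this z _) rfl rfl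

theorem update_add_of_eq_zero {u : ι → ZMod 2} {i : ι} (h : u i = 0) (z : ι → ZMod 2)
    (b : ZMod 2) : Function.update (z + u) i b = Function.update z i b + u := by
  funext w
  by_cases hw : w = i
  · subst hw; simp [h]
  · simp [hw]

theorem commute_op_tr {g : WGate ι} {u : ι → ZMod 2} (h : ∀ i ∈ g.wires, u i = 0) :
    Commute g.op (tr u) := by
  refine op_ext fun ψ z => ?_
  cases g with
  | had i =>
    have h0 : u i = 0 := h i rfl
    simp only [Module.End.mul_apply, WGate.op, LinearMap.coe_mk, AddHom.coe_mk, tr_apply,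
      update_add_of_eq_zero h0, Pi.add_apply, h0, add_zero]
  | ph i =>
    have h0 : u i = 0 := h i rfl
    simp only [Module.End.mul_apply, WGate.op, LinearMap.coe_mk, AddHom.coe_mk, tr_apply,
      Pi.add_apply, h0, add_zero]
  | tof i j k =>
    have h0 : u i = 0 := h i (by simp [WGate.wires])
    have h1 : u j = 0 := h j (by simp [WGate.wires])
    have h2 : u k = 0 := h k (by simp [WGate.wires])
    simp only [Module.End.mul_apply, WGate.op, LinearMap.coe_mk, AddHom.coe_mk, tr_apply,
      update_add_of_eq_zero h2, Pi.add_apply, h0, h1, h2, add_zero]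

theorem commute_run {gs : List (WGate ι)} {A : Op ι} (h : ∀ g ∈ gs, Commute g.op A) :
    Commute (run gs) A := by
  induction gs with
  | nil => exact Commute.one_left A
  | cons g gs ih =>
    exact (ih fun g hg => h g (List.mem_cons_of_mem _ hg)).mul_left (h g List.mem_cons_self)

theorem commute_run_proj {gs : List (WGate ι)} {p : (ι → ZMod 2) → Prop}
    (h : ∀ g ∈ gs, ∀ i ∈ g.mods, Indep p i) : Commute (run gs) (proj p) :=
  commute_run fun g hg => commute_op_proj (h g hg)

theorem commute_run_tr {gs : List (WGate ι)} {u : ι → ZMod 2}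
    (h : ∀ g ∈ gs, ∀ i ∈ g.wires, u i = 0) : Commute (run gs) (tr u) :=
  commute_run fun g hg => commute_op_tr (h g hg)

theorem Commute.of_inverse {A A' B : Op ι} (h1 : A' * A = 1) (h2 : A * A' = 1)
    (h : Commute A B) : Commute A' B := by
  have : A' * B = A' * (B * (A * A')) := by rw [h2, mul_one]
  rw [Commute, SemiconjBy, this, ← mul_assoc B, ← h.eq, mul_assoc A, ← mul_assoc, h1, one_mul]

/-! ### Inverse circuits -/

theorem sqrt_two_mul_self : (Real.sqrt 2 : ℂ) * (Real.sqrt 2 : ℂ) = 2 := by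
  rw [← Complex.ofReal_mul, Real.mul_self_sqrt (by norm_num)]; norm_num

theorem sqrt_two_ne_zero : (Real.sqrt 2 : ℂ) ≠ 0 := by
  simp

theorem had_mul_self (i : ι) : (WGate.had i).op * (WGate.had i).op = 1 := by
  refine op_ext fun ψ z => ?_
  simp only [Module.End.mul_apply, WGate.op, LinearMap.coe_mk, AddHom.coe_mk,
    Function.update_self, Function.update_idem, sgn_zero, sgn_one, Module.End.one_apply]
  have h : ∀ a b : ℂ, ∀ s : ℂ, ((a + 1 * b) / (Real.sqrt 2 : ℂ) + s * ((a + -1 * b) /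
      (Real.sqrt 2 : ℂ))) / (Real.sqrt 2 : ℂ) = ((1 + s) * a + (1 - s) * b) / 2 := by
    intro a b s
    rw [← sqrt_two_mul_self]
    field_simp
    ring
  rw [h]
  rcases zmod2_cases (z i) with h0 | h0
  · have : Function.update z i 0 = z := by rw [← h0, Function.update_eq_self]
    rw [h0, this]; simp; ring
  · have : Function.update z i 1 = z := by rw [← h0, Function.update_eq_self]
    rw [h0, this]; norm_num

/-- Hadamard and Toffoli gates are involutions; three phase gates undo one because i⁴ = 1. -/
theorem run_inv_mul (g : WGate ι) : run g.inv * g.op = 1 := by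
  cases g with
  | had i => simp [WGate.inv, run_cons, had_mul_self]
  | ph i =>
    refine op_ext fun ψ z => ?_
    simp only [WGate.inv, run_cons, run_nil, one_mul, Module.End.mul_apply, WGate.op,
      LinearMap.coe_mk, AddHom.coe_mk, Module.End.one_apply]
    split_ifs
    · linear_combination (Complex.I ^ 2 - 1) * ψ z * Complex.I_sq
    · ring
  | tof i j k hij hik hjk =>
    refine op_ext fun ψ z => ?_
    simp [WGate.inv, run_cons, Module.End.mul_apply, WGate.op, hik, hjk, add_assoc]

theorem op_mul_run_inv (g : WGate ι) : g.op * run g.inv = 1 := by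
  have h := run_inv_mul g
  cases g with
  | had i => simpa [WGate.inv, run_cons] using h
  | ph i => simpa [WGate.inv, run_cons, mul_assoc] using h
  | tof i j k hij hik hjk => simpa [WGate.inv, run_cons] using h

theorem invGates_cons (g : WGate ι) (gs : List (WGate ι)) :
    invGates (g :: gs) = invGates gs ++ g.inv := by simp [invGates]

theorem run_invGates_mul (gs : List (WGate ι)) : run (invGates gs) * run gs = 1 := by
  induction gs with
  | nil => rfl
  | cons g gs ih =>
    rw [invGates_cons, run_append, run_cons, mul_assoc, ← mul_assoc (run (invGates gs)), ih,
      one_mul, run_inv_mul]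

theorem run_mul_invGates (gs : List (WGate ι)) : run gs * run (invGates gs) = 1 := by
  induction gs with
  | nil => rfl
  | cons g gs ih =>
    rw [invGates_cons, run_append, run_cons, mul_assoc, ← mul_assoc g.op, op_mul_run_inv,
      one_mul, ih]

theorem Commute.invGates {gs : List (WGate ι)} {B : Op ι} (h : Commute (run gs) B) :
    Commute (run (invGates gs)) B :=
  Commute.of_inverse (run_invGates_mul gs) (run_mul_invGates gs) h

/-! ### Inner product and norm -/

variable [Fintype ι] [Fintype κ]

/-- The inner product of states. -/
def ip (ψ χ : St ι) : ℂ := ∑ z, (starRingEnd ℂ) (ψ z) * χ z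

/-- The square of the norm of a state. -/
def nrm (ψ : St ι) : ℝ := ∑ z, ‖ψ z‖ ^ 2

theorem ip_self (ψ : St ι) : ip ψ ψ = nrm ψ := by
  simp [ip, nrm, Complex.conj_mul']

theorem ip_sub_right (ψ χ φ : St ι) : ip ψ (χ - φ) = ip ψ χ - ip ψ φ := by
  simp [ip, mul_sub, Finset.sum_sub_distrib]

theorem ip_smul_right (c : ℂ) (ψ χ : St ι) : ip ψ (c • χ) = c * ip ψ χ := by
  simp only [ip, Pi.smul_apply, smul_eq_mul, Finset.mul_sum]
  exact Finset.sum_congr rfl fun z _ => by ring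

theorem ip_sub_left (ψ χ φ : St ι) : ip (ψ - χ) φ = ip ψ φ - ip χ φ := by
  simp [ip, sub_mul, Finset.sum_sub_distrib]

theorem nrm_nonneg (ψ : St ι) : 0 ≤ nrm ψ := Finset.sum_nonneg fun _ _ => by positivity

theorem nrm_smul (c : ℂ) (ψ : St ι) : nrm (c • ψ) = ‖c‖ ^ 2 * nrm ψ := by
  simp [nrm, Finset.mul_sum, mul_pow]

/-- A Hadamard gate mixes the amplitudes at `z` and `z + u` for a unit vector `u`, so its unitarity
holds only for such pairs of summands. Summing over all `z` counts each pair twice. -/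
theorem sum_eq_of_pair {f g : (ι → ZMod 2) → ℂ} (u : ι → ZMod 2)
    (h : ∀ z, f z + f (z + u) = g z + g (z + u)) : ∑ z, f z = ∑ z, g z := by
  have hf : ∑ z, f (z + u) = ∑ z, f z := Equiv.sum_comp (Equiv.addRight u) f
  have hg : ∑ z, g (z + u) = ∑ z, g z := Equiv.sum_comp (Equiv.addRight u) g
  have := Finset.sum_congr rfl fun z (_ : z ∈ Finset.univ) => h z
  rw [Finset.sum_add_distrib, Finset.sum_add_distrib, hf, hg, ← two_mul, ← two_mul] at this
  exact mul_left_cancel₀ two_ne_zero this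

theorem ip_op (g : WGate ι) (ψ χ : St ι) : ip (g.op ψ) (g.op χ) = ip ψ χ := by
  cases g with
  | had i =>
    refine sum_eq_of_pair (Pi.single i 1) fun z => ?_
    have key : ∀ a b c d : ℂ, (starRingEnd ℂ) ((a + 1 * b) / (Real.sqrt 2 : ℂ)) *
        ((c + 1 * d) / (Real.sqrt 2 : ℂ)) + (starRingEnd ℂ) ((a + -1 * b) / (Real.sqrt 2 : ℂ)) *
        ((c + -1 * d) / (Real.sqrt 2 : ℂ)) = (starRingEnd ℂ) a * c + (starRingEnd ℂ) b * d := by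
      intro a b c d
      have h2 := sqrt_two_mul_self
      have h3 := sqrt_two_ne_zero
      simp only [map_div₀, map_add, map_mul, map_neg, map_one, Complex.conj_ofReal]
      field_simp
      linear_combination (-(starRingEnd ℂ) a * c - (starRingEnd ℂ) b * d) * h2
    have hu : ∀ b, Function.update (z + Pi.single i 1) i b = Function.update z i b := by
      intro b
      funext w
      by_cases hw : w = i
      · subst hw; simp
      · simp [hw]
    simp only [WGate.op, LinearMap.coe_mk, AddHom.coe_mk, hu, Pi.add_apply, Pi.single_eq_same]
    rcases zmod2_cases (z i) with h0 | h0
    · have e0 : Function.update z i 0 = z := by rw [← h0, Function.update_eq_self]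
      have e1 : Function.update z i 1 = z + Pi.single i 1 := by
        funext w
        by_cases hw : w = i
        · subst hw; simp [h0]
        · simp [hw]
      rw [h0, e0, e1, zero_add, sgn_zero, sgn_one, key]
    · have e1 : Function.update z i 1 = z := by rw [← h0, Function.update_eq_self]
      have e0 : Function.update z i 0 = z + Pi.single i 1 := by
        funext w
        by_cases hw : w = i
        · subst hw; simp [h0]
        · simp [hw]
      rw [h0, e0, e1, zmod2_add_self, sgn_zero, sgn_one, add_comm, key, add_comm]
  | ph i =>
    refine Finset.sum_congr rfl fun z _ => ?_
    simp only [WGate.op, LinearMap.coe_mk, AddHom.coe_mk]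
    split_ifs
    · simp only [map_mul, Complex.conj_I]
      linear_combination (-(starRingEnd ℂ) (ψ z) * χ z) * Complex.I_sq
    · simp
  | tof i j k hij hik hjk =>
    have hinv : Function.Involutive fun z : ι → ZMod 2 =>
        Function.update z k (z k + z i * z j) := by
      intro z
      simp [hik, hjk, add_assoc]
    exact Equiv.sum_comp hinv.toPerm fun z => (starRingEnd ℂ) (ψ z) * χ z

theorem ip_run (gs : List (WGate ι)) (ψ χ : St ι) : ip (run gs ψ) (run gs χ) = ip ψ χ := by
  induction gs generalizing ψ χ with
  | nil => rfl
  | cons g gs ih => rw [run_cons, Module.End.mul_apply, Module.End.mul_apply, ih, ip_op]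

theorem nrm_run (gs : List (WGate ι)) (ψ : St ι) : nrm (run gs ψ) = nrm ψ := by
  have := ip_run gs ψ ψ
  rw [ip_self, ip_self] at this
  exact_mod_cast this

theorem nrm_proj_le (p : (ι → ZMod 2) → Prop) (ψ : St ι) : nrm (proj p ψ) ≤ nrm ψ := by
  refine Finset.sum_le_sum fun z _ => ?_
  rw [proj_apply]
  split_ifs
  · exact le_rfl
  · simp

theorem nrm_proj_add (p : (ι → ZMod 2) → Prop) (ψ : St ι) :
    nrm (proj p ψ) + nrm (proj (fun z => ¬ p z) ψ) = nrm ψ := by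
  rw [nrm, nrm, nrm, ← Finset.sum_add_distrib]
  refine Finset.sum_congr rfl fun z _ => ?_
  simp only [proj_apply]
  by_cases h : p z <;> simp [h]

/-- An operator is self-adjoint. -/
def SelfAdj (A : Op ι) : Prop := ∀ ψ χ, ip (A ψ) χ = ip ψ (A χ)

theorem selfAdj_proj (p : (ι → ZMod 2) → Prop) : SelfAdj (proj p) := by
  intro ψ χ
  refine Finset.sum_congr rfl fun z _ => ?_
  simp only [proj_apply]
  split_ifs <;> simp

theorem selfAdj_tr (u : ι → ZMod 2) : SelfAdj (tr u) := by
  intro ψ χ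
  have := Equiv.sum_comp (Equiv.addRight u) fun z => (starRingEnd ℂ) (ψ z) * χ (z + u)
  simp only [Equiv.coe_addRight, bits_add_add_self] at this
  exact this

theorem SelfAdj.mul {A B : Op ι} (hA : SelfAdj A) (hB : SelfAdj B) (h : Commute A B) :
    SelfAdj (A * B) := by
  intro ψ χ
  rw [Module.End.mul_apply, hA, hB, ← Module.End.mul_apply, h.eq]

theorem SelfAdj.conj {A : Op ι} (hA : SelfAdj A) (gs : List (WGate ι)) :
    SelfAdj (run (invGates gs) * A * run gs) := by
  have key : ∀ ψ χ, ip (run (invGates gs) ψ) χ = ip ψ (run gs χ) := by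
    intro ψ χ
    rw [← ip_run gs, ← Module.End.mul_apply, run_mul_invGates, Module.End.one_apply]
  have key' : ∀ ψ χ, ip (run gs ψ) χ = ip ψ (run (invGates gs) χ) := by
    intro ψ χ
    rw [← ip_run gs ψ, ← Module.End.mul_apply, run_mul_invGates, Module.End.one_apply]
  intro ψ χ
  simp only [Module.End.mul_apply]
  rw [key, hA, key']

theorem SelfAdj.nrm_apply {A : Op ι} (hA : SelfAdj A) (h : A * A = A) (ψ : St ι) :
    (nrm (A ψ) : ℂ) = ip ψ (A ψ) := by
  rw [← ip_self, hA, ← Module.End.mul_apply, h]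

/-- Pythagoras for an orthogonal projection. -/
theorem SelfAdj.nrm_compl {A : Op ι} (hA : SelfAdj A) (h : A * A = A) (ψ : St ι) :
    nrm (ψ - A ψ) = nrm ψ - nrm (A ψ) := by
  have h1 : (nrm (ψ - A ψ) : ℂ) = nrm ψ - nrm (A ψ) := by
    rw [← ip_self, ip_sub_left, ip_sub_right, ip_sub_right, ip_self, hA ψ ψ, hA ψ (A ψ),
      ← Module.End.mul_apply, h, hA.nrm_apply h]
    ring
  exact_mod_cast h1

theorem SelfAdj.nrm_le {A : Op ι} (hA : SelfAdj A) (h : A * A = A) (ψ : St ι) :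
    nrm (A ψ) ≤ nrm ψ := by
  have := hA.nrm_compl h ψ
  have := nrm_nonneg (ψ - A ψ)
  linarith

end

/-! ### The projection on the state of a subspace -/

section

variable {ι κ ν : Type} [DecidableEq ι] [DecidableEq κ] [Fintype ν]

/-- The vector on all wires that agrees with `v` on the wires of a register and is zero elsewhere. -/
def pad (ρ : ν ↪ ι) (v : ν → ZMod 2) : ι → ZMod 2 := Function.extend ρ v 0

@[simp] theorem pad_apply (ρ : ν ↪ ι) (v : ν → ZMod 2) (i : ν) : pad ρ v (ρ i) = v i :=
  ρ.injective.extend_apply _ _ _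

theorem pad_of_notMem {ρ : ν ↪ ι} {i : ι} (h : i ∉ Set.range ρ) (v : ν → ZMod 2) :
    pad ρ v i = 0 :=
  Function.extend_apply' _ _ _ fun ⟨a, ha⟩ => h ⟨a, ha⟩

theorem pad_add (ρ : ν ↪ ι) (u v : ν → ZMod 2) : pad ρ (u + v) = pad ρ u + pad ρ v := by
  funext i
  by_cases h : i ∈ Set.range ρ
  · obtain ⟨j, rfl⟩ := h; simp
  · simp [pad_of_notMem h]

theorem pad_comp (ρ : ν ↪ ι) (v : ν → ZMod 2) : pad ρ v ∘ ρ = v := by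
  funext i; simp

theorem add_pad_comp (ρ : ν ↪ ι) (z : ι → ZMod 2) (v : ν → ZMod 2) :
    (z + pad ρ v) ∘ ρ = z ∘ ρ + v := by
  funext i; simp

/-- The elements of a subspace. -/
def elems (S : Submodule (ZMod 2) (ν → ZMod 2)) : Finset (ν → ZMod 2) :=
  (Set.toFinite (S : Set (ν → ZMod 2))).toFinset

@[simp] theorem mem_elems {S : Submodule (ZMod 2) (ν → ZMod 2)} {v : ν → ZMod 2} :
    v ∈ elems S ↔ v ∈ S := by simp [elems]

theorem card_elems (S : Submodule (ZMod 2) (ν → ZMod 2)) : (elems S).card = Nat.card S := by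
  rw [elems, ← Set.ncard_eq_toFinset_card]; rfl

theorem card_elems_ne_zero (S : Submodule (ZMod 2) (ν → ZMod 2)) : ((elems S).card : ℂ) ≠ 0 := by
  simp only [ne_eq, Nat.cast_eq_zero, Finset.card_eq_zero]
  exact Finset.ne_empty_of_mem (a := 0) (by simp)

theorem sum_elems_add {M : Type*} [AddCommMonoid M] {S : Submodule (ZMod 2) (ν → ZMod 2)}
    {u : ν → ZMod 2} (hu : u ∈ S) (f : (ν → ZMod 2) → M) :
    ∑ v ∈ elems S, f (v + u) = ∑ v ∈ elems S, f v :=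
  Finset.sum_nbij' (· + u) (· + u) (fun v hv => by simpa using S.add_mem (by simpa using hv) hu)
    (fun v hv => by simpa using S.add_mem (by simpa using hv) hu) (fun v _ => by simp)
    (fun v _ => by simp) (fun v _ => rfl)

variable (ρ : ν ↪ ι) (S : Submodule (ZMod 2) (ν → ZMod 2))

/-- The average of the translations of a register by the elements of `S`. -/
def avg : Op ι := ((elems S).card : ℂ)⁻¹ • ∑ v ∈ elems S, tr (pad ρ v)

/-- The register lies in `S`. -/
def InS (z : ι → ZMod 2) : Prop := z ∘ ρ ∈ S

/-- The projection on the state `|S⟩` of a register. -/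
def subProj : Op ι := avg ρ S * proj (InS ρ S)

variable {ρ S}

theorem inS_add {v : ν → ZMod 2} (hv : v ∈ S) (z : ι → ZMod 2) :
    InS ρ S (z + pad ρ v) ↔ InS ρ S z := by
  rw [InS, add_pad_comp, InS]
  exact S.add_mem_iff_left hv

theorem commute_avg {A : Op ι} (h : ∀ v, Commute A (tr (pad ρ v))) : Commute A (avg ρ S) :=
  (Commute.sum_right _ _ _ fun v _ => h v).smul_right _

theorem commute_avg_proj : Commute (avg ρ S) (proj (InS ρ S)) :=
  (Commute.sum_left _ _ _ fun _ hv => commute_tr_proj (inS_add (mem_elems.1 hv))).smul_left _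

theorem commute_subProj {A : Op ι} (h : ∀ v, Commute A (tr (pad ρ v)))
    (h' : Commute A (proj (InS ρ S))) : Commute A (subProj ρ S) :=
  (commute_avg h).mul_right h'

theorem WGate.mods_subset (g : WGate ι) : g.mods ⊆ g.wires := by
  cases g <;> simp [WGate.mods, WGate.wires]

theorem tr_mul_avg {u : ν → ZMod 2} (hu : u ∈ S) : tr (pad ρ u) * avg ρ S = avg ρ S := by
  rw [avg, mul_smul_comm, Finset.mul_sum]
  congr 1
  simp only [tr_mul_tr, ← pad_add]
  rw [← sum_elems_add hu fun v => tr (pad ρ v)]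
  exact Finset.sum_congr rfl fun v _ => by rw [add_comm]

theorem avg_mul_self : avg ρ S * avg ρ S = avg ρ S := by
  nth_rewrite 1 [avg]
  rw [smul_mul_assoc, Finset.sum_mul]
  rw [Finset.sum_congr rfl fun v hv => tr_mul_avg (mem_elems.1 hv), Finset.sum_const,
    ← Nat.cast_smul_eq_nsmul ℂ, smul_smul, inv_mul_cancel₀ (card_elems_ne_zero S), one_smul]

theorem subProj_mul_self : subProj ρ S * subProj ρ S = subProj ρ S := by
  rw [subProj, mul_assoc, ← mul_assoc (proj _), ← commute_avg_proj.eq, mul_assoc (avg ρ S),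
    proj_mul_self, ← mul_assoc, avg_mul_self]

theorem tr_mul_subProj {u : ν → ZMod 2} (hu : u ∈ S) :
    tr (pad ρ u) * subProj ρ S = subProj ρ S := by
  rw [subProj, ← mul_assoc, tr_mul_avg hu]

theorem proj_mul_subProj : proj (InS ρ S) * subProj ρ S = subProj ρ S := by
  rw [subProj, ← mul_assoc, ← commute_avg_proj.eq, mul_assoc, proj_mul_self]

theorem avg_apply (ψ : St ι) (z : ι → ZMod 2) :
    avg ρ S ψ z = ((elems S).card : ℂ)⁻¹ * ∑ v ∈ elems S, ψ (z + pad ρ v) := by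
  simp [avg, tr_apply]

open Classical in
theorem subProj_apply (ψ : St ι) (z : ι → ZMod 2) : subProj ρ S ψ z =
    if InS ρ S z then ((elems S).card : ℂ)⁻¹ * ∑ v ∈ elems S, ψ (z + pad ρ v) else 0 := by
  rw [subProj, commute_avg_proj.eq, Module.End.mul_apply, proj_apply, avg_apply]

theorem selfAdj_avg [Fintype ι] : SelfAdj (avg ρ S) := by
  intro ψ χ
  have h : ∀ v, ip (tr (pad ρ v) ψ) χ = ip ψ (tr (pad ρ v) χ) := fun v => selfAdj_tr _ ψ χ
  simp only [ip, tr_apply, avg_apply, map_mul, map_inv₀, Complex.conj_natCast, map_sum] at h ⊢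
  have e1 : ∑ z, ((elems S).card : ℂ)⁻¹ *
      (∑ v ∈ elems S, (starRingEnd ℂ) (ψ (z + pad ρ v))) * χ z = ((elems S).card : ℂ)⁻¹ *
      ∑ v ∈ elems S, ∑ z, (starRingEnd ℂ) (ψ (z + pad ρ v)) * χ z := by
    rw [Finset.sum_comm, Finset.mul_sum]
    exact Finset.sum_congr rfl fun z _ => by rw [mul_assoc, Finset.sum_mul]
  have e2 : ∑ z, (starRingEnd ℂ) (ψ z) * (((elems S).card : ℂ)⁻¹ *
      ∑ v ∈ elems S, χ (z + pad ρ v)) = ((elems S).card : ℂ)⁻¹ *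
      ∑ v ∈ elems S, ∑ z, (starRingEnd ℂ) (ψ z) * χ (z + pad ρ v) := by
    rw [Finset.sum_comm, Finset.mul_sum]
    refine Finset.sum_congr rfl fun z _ => ?_
    rw [mul_left_comm, Finset.mul_sum]
  rw [e1, e2, Finset.sum_congr rfl fun v _ => h v]

theorem selfAdj_subProj [Fintype ι] : SelfAdj (subProj ρ S) :=
  selfAdj_avg.mul (selfAdj_proj _) commute_avg_proj

theorem pad_eq_zero_of_disjoint {μ : Type} {ρ' : μ ↪ ι} (h : Disjoint (Set.range ρ) (Set.range ρ'))
    (v : ν → ZMod 2) (j : μ) : pad ρ v (ρ' j) = 0 :=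
  pad_of_notMem (fun hj => Set.disjoint_left.1 h hj ⟨j, rfl⟩) v

theorem commute_tr_subProj {u : ι → ZMod 2} (h : ∀ i, u (ρ i) = 0) :
    Commute (tr u) (subProj ρ S) := by
  refine commute_subProj (fun _ => commute_tr_tr _ _) (commute_tr_proj fun z => ?_)
  have : (z + u) ∘ ρ = z ∘ ρ := by funext i; simp [h]
  rw [InS, this, InS]

theorem commute_proj_subProj {p : (ι → ZMod 2) → Prop} (h : ∀ z v, p (z + pad ρ v) ↔ p z) :
    Commute (proj p) (subProj ρ S) :=
  commute_subProj (fun v => (commute_tr_proj fun z => h z v).symm) (commute_proj_proj _ _)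

theorem commute_subProj_subProj {μ : Type} [Fintype μ] {ρ' : μ ↪ ι}
    {S' : Submodule (ZMod 2) (μ → ZMod 2)} (h : Disjoint (Set.range ρ) (Set.range ρ')) :
    Commute (subProj ρ S) (subProj ρ' S') := by
  refine (commute_subProj (fun v => ?_) ?_).symm
  · exact (commute_tr_subProj (pad_eq_zero_of_disjoint h v)).symm
  · refine (commute_proj_subProj fun z v => ?_).symm
    have : (z + pad ρ' v) ∘ ρ = z ∘ ρ := by
      funext i; simp [pad_eq_zero_of_disjoint h.symm]
    rw [InS, this, InS]

/-! ### Conjugation by Hadamard gates -/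

/-- Hadamard gates on the wires of a list. -/
def hads (l : List ι) : List (WGate ι) := l.map .had

theorem had_commute {i j : ι} (hij : i ≠ j) : Commute (WGate.had i).op (WGate.had j).op := by
  refine op_ext fun ψ z => ?_
  simp only [Module.End.mul_apply, WGate.op, LinearMap.coe_mk, AddHom.coe_mk,
    Function.update_of_ne hij, Function.update_of_ne hij.symm,
    Function.update_comm hij]
  ring

theorem commute_hads {i : ι} {l : List ι} (h : i ∉ l) :
    Commute (run (hads l)) (WGate.had i).op := by
  refine commute_run fun g hg => ?_
  obtain ⟨j, hj, rfl⟩ := List.mem_map.1 hg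
  exact had_commute fun hji => h (hji ▸ hj)

theorem hads_mul_self {l : List ι} (h : l.Nodup) : run (hads l) * run (hads l) = 1 := by
  induction l with
  | nil => rfl
  | cons i l ih =>
    have hc := commute_hads (List.nodup_cons.1 h).1
    rw [show hads (i :: l) = .had i :: hads l from rfl, run_cons]
    rw [mul_assoc, ← mul_assoc (WGate.had i).op, ← hc.eq, mul_assoc, had_mul_self, mul_one,
      ih (List.nodup_cons.1 h).2]

variable [Fintype ι]

/-- Multiplication by the character of a vector. -/
def signOp (v : ι → ZMod 2) : Op ι := diag fun z => sgn (v ⬝ᵥ z)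

theorem dotProduct_update (v z : ι → ZMod 2) (i : ι) (b : ZMod 2) :
    v ⬝ᵥ Function.update z i b = v i * b + Function.update v i 0 ⬝ᵥ z := by
  simp only [dotProduct]
  rw [← Finset.add_sum_erase _ _ (Finset.mem_univ i),
    ← Finset.add_sum_erase _ (fun j => Function.update v i 0 j * z j) (Finset.mem_univ i)]
  simp only [Function.update_self, zero_mul, zero_add]
  congr 1
  refine Finset.sum_congr rfl fun j hj => ?_
  rw [Function.update_of_ne (Finset.ne_of_mem_erase hj),
    Function.update_of_ne (Finset.ne_of_mem_erase hj)]

/-- On wire `i` this is HZ = XH; the signs belonging to the other wires pass through unchanged. -/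
theorem had_mul_signOp (i : ι) (v : ι → ZMod 2) : (WGate.had i).op * signOp v =
    tr (Pi.single i (v i)) * signOp (Function.update v i 0) * (WGate.had i).op := by
  refine op_ext fun ψ z => ?_
  have hu : ∀ b, Function.update (z + Pi.single i (v i)) i b = Function.update z i b := by
    intro b
    funext w
    by_cases hw : w = i
    · subst hw; simp
    · simp [hw]
  have hd : Function.update v i 0 ⬝ᵥ (z + Pi.single i (v i)) = Function.update v i 0 ⬝ᵥ z := by
    rw [dotProduct_add]; simp
  simp only [Module.End.mul_apply, WGate.op, LinearMap.coe_mk, AddHom.coe_mk, signOp, tr_apply,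
    diag_apply, hu, hd, dotProduct_update, sgn_add, Pi.add_apply, Pi.single_eq_same, mul_zero,
    mul_one, sgn_zero]
  ring

open Classical in
theorem hads_mul_signOp {l : List ι} (h : l.Nodup) (v : ι → ZMod 2) :
    run (hads l) * signOp v = tr (fun i => if i ∈ l then v i else 0) *
      signOp (fun i => if i ∈ l then 0 else v i) * run (hads l) := by
  induction l generalizing v with
  | nil =>
    have : tr (fun _ : ι => (0 : ZMod 2)) = 1 := tr_zero
    simp [hads, this]
  | cons i l ih =>
    have hi := (List.nodup_cons.1 h).1
    have hc : Commute (run (hads l)) (tr (Pi.single i (v i))) := by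
      refine commute_run_tr fun g hg w hw => ?_
      obtain ⟨j, hj, rfl⟩ := List.mem_map.1 hg
      cases hw
      exact Pi.single_eq_of_ne (by rintro rfl; exact hi hj) _
    rw [show hads (i :: l) = .had i :: hads l from rfl, run_cons, mul_assoc, had_mul_signOp,
      ← mul_assoc, ← mul_assoc, hc.eq, mul_assoc (tr _), ih (List.nodup_cons.1 h).2,
      ← mul_assoc, ← mul_assoc, tr_mul_tr, ← mul_assoc]
    congr 3
    · congr 1
      funext w
      by_cases hw : w = i
      · subst hw; simp [hi]
      · simp [hw]
    · congr 1
      funext w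
      by_cases hw : w = i
      · subst hw; simp
      · simp [hw]

theorem pad_dotProduct (v : ν → ZMod 2) (z : ι → ZMod 2) : pad ρ v ⬝ᵥ z = v ⬝ᵥ (z ∘ ρ) := by
  simp only [dotProduct]
  rw [← Finset.sum_subset (Finset.subset_univ (Finset.univ.map ρ)), Finset.sum_map]
  · simp
  · intro i _ hi
    rw [pad_of_notMem, zero_mul]
    simpa using hi

/-- The register lies in the orthogonal complement of `S`. -/
def InPerp (ρ : ν ↪ ι) (S : Submodule (ZMod 2) (ν → ZMod 2)) (z : ι → ZMod 2) : Prop :=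
  ∀ x ∈ S, x ⬝ᵥ (z ∘ ρ) = 0

/-- Orthogonality of characters: the sum over S of (-1)^{v·z} is |S| for z in S^⊥ and vanishes
otherwise. -/
theorem proj_inPerp : proj (InPerp ρ S) =
    ((elems S).card : ℂ)⁻¹ • ∑ v ∈ elems S, signOp (pad ρ v) := by
  refine op_ext fun ψ z => ?_
  have e : (((elems S).card : ℂ)⁻¹ • ∑ v ∈ elems S, signOp (pad ρ v)) ψ z =
      (((elems S).card : ℂ)⁻¹ * ∑ v ∈ elems S, sgn (v ⬝ᵥ (z ∘ ρ))) * ψ z := by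
    simp [signOp, diag_apply, pad_dotProduct, Finset.sum_mul, mul_assoc]
  rw [e, proj_apply]
  split_ifs with h
  · rw [Finset.sum_congr rfl fun v hv => by rw [h v (mem_elems.1 hv), sgn_zero], Finset.sum_const,
      nsmul_eq_mul, mul_one, inv_mul_cancel₀ (card_elems_ne_zero S), one_mul]
  · simp only [InPerp, not_forall] at h
    obtain ⟨x, hx, hx0⟩ := h
    have h1 := (zmod2_cases (x ⬝ᵥ (z ∘ ρ))).resolve_left hx0
    -- Translating the summation by an `x` that is not orthogonal to `z` changes the sign of the
    -- sum, which is therefore zero.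
    have h2 := sum_elems_add hx fun v => sgn (v ⬝ᵥ (z ∘ ρ))
    simp only [add_dotProduct, sgn_add, h1, sgn_one, mul_neg, mul_one,
      Finset.sum_neg_distrib] at h2
    have h3 : ∑ v ∈ elems S, sgn (v ⬝ᵥ (z ∘ ρ)) = 0 := by linear_combination (-1 / 2) * h2
    rw [h3]; simp

/-- Conjugation by Hadamard gates turns characters into translations, hence their average over S
into `avg`. This identifies the two checks of the verification with `subProj`, the projection on
|S⟩. -/
theorem hads_mul_proj_mul_hads {l : List ι} (hl : l.Nodup) (hr : ∀ i, i ∈ l ↔ i ∈ Set.range ρ) :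
    run (hads l) * proj (InPerp ρ S) * run (hads l) = avg ρ S := by
  classical
  rw [proj_inPerp, avg, mul_smul_comm, smul_mul_assoc, Finset.mul_sum, Finset.sum_mul]
  congr 1
  refine Finset.sum_congr rfl fun v _ => ?_
  have e1 : (fun i => if i ∈ l then pad ρ v i else 0) = pad ρ v := by
    funext i
    split_ifs with h
    · rfl
    · rw [pad_of_notMem (by rwa [← hr])]
  have e2 : (fun i => if i ∈ l then 0 else pad ρ v i) = 0 := by
    funext i
    split_ifs with h
    · rfl
    · rw [pad_of_notMem (by rwa [← hr])]; rfl
  have e3 : signOp (0 : ι → ZMod 2) = 1 := by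
    refine op_ext fun ψ z => ?_
    simp [signOp, diag_apply]
  rw [hads_mul_signOp hl, e1, e2, e3, mul_one, mul_assoc, hads_mul_self hl, mul_one]

end

/-! ### Slices -/

section

variable {ι κ ν : Type} [DecidableEq ι] [DecidableEq κ]

/-- The state of the wires `e` if the other wires have the values `y`. -/
def slice (e : κ ↪ ι) (y : ι → ZMod 2) (ψ : St ι) : St κ := fun x => ψ (Function.extend e x y)

theorem slice_ext {e : κ ↪ ι} {ψ χ : St ι} (h : ∀ y, slice e y ψ = slice e y χ) : ψ = χ := by
  funext z
  have := congrFun (h z) (z ∘ e)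
  have hz : Function.extend e (z ∘ e) z = z := by
    funext i
    by_cases hi : ∃ a, e a = i
    · obtain ⟨a, rfl⟩ := hi
      exact e.injective.extend_apply _ _ _
    · exact Function.extend_apply' _ _ _ hi
  simpa [slice, hz] using this

theorem extend_update (e : κ ↪ ι) (x : κ → ZMod 2) (y : ι → ZMod 2) (i : κ) (b : ZMod 2) :
    Function.update (Function.extend e x y) (e i) b
      = Function.extend e (Function.update x i b) y := by
  funext w
  by_cases hw : ∃ a, e a = w
  · obtain ⟨a, rfl⟩ := hw
    rw [e.injective.extend_apply]
    by_cases ha : a = i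
    · subst ha; simp
    · rw [Function.update_of_ne (e.injective.ne ha), e.injective.extend_apply,
        Function.update_of_ne ha]
  · rw [Function.update_of_ne (fun h => hw ⟨i, h.symm⟩), Function.extend_apply' _ _ _ hw,
      Function.extend_apply' _ _ _ hw]

/-- Slices take the place of tensor products: a gate on embedded wires acts on each slice
separately, so facts about the counterfeiter on its own wires carry over to each copy. -/
theorem slice_op (e : κ ↪ ι) (y : ι → ZMod 2) (g : WGate κ) (ψ : St ι) :
    slice e y ((g.map e).op ψ) = g.op (slice e y ψ) := by
  funext x
  cases g <;> simp [slice, WGate.map, WGate.op, extend_update, e.injective.extend_apply]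

theorem slice_run (e : κ ↪ ι) (y : ι → ZMod 2) (gs : List (WGate κ)) (ψ : St ι) :
    slice e y (run (gs.map (WGate.map e)) ψ) = run gs (slice e y ψ) := by
  induction gs generalizing ψ with
  | nil => rfl
  | cons g gs ih =>
    rw [List.map_cons, run_cons, run_cons, Module.End.mul_apply, Module.End.mul_apply, ih,
      slice_op]

theorem slice_proj {e : κ ↪ ι} {y : ι → ZMod 2} {p : (ι → ZMod 2) → Prop}
    {p' : (κ → ZMod 2) → Prop} (h : ∀ x, p (Function.extend e x y) ↔ p' x) (ψ : St ι) :
    slice e y (proj p ψ) = proj p' (slice e y ψ) := by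
  funext x
  classical exact if_congr (h x) rfl rfl

theorem slice_subProj [Fintype ν] (e : κ ↪ ι) (y : ι → ZMod 2) (ρ : ν ↪ κ)
    (S : Submodule (ZMod 2) (ν → ZMod 2)) (ψ : St ι) :
    slice e y (subProj (ρ.trans e) S ψ) = subProj ρ S (slice e y ψ) := by
  have h1 : ∀ x : κ → ZMod 2, Function.extend e x y ∘ (ρ.trans e) = x ∘ ρ := by
    intro x
    funext i
    simp [e.injective.extend_apply]
  have h2 : ∀ (x : κ → ZMod 2) (v : ν → ZMod 2), Function.extend e x y + pad (ρ.trans e) v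
      = Function.extend e (x + pad ρ v) y := by
    intro x v
    funext w
    by_cases hw : ∃ a, e a = w
    · obtain ⟨a, rfl⟩ := hw
      rw [Pi.add_apply, e.injective.extend_apply, e.injective.extend_apply, Pi.add_apply]
      congr 1
      by_cases ha : a ∈ Set.range ρ
      · obtain ⟨i, rfl⟩ := ha
        rw [pad_apply]
        exact pad_apply (ρ.trans e) v i
      · rw [pad_of_notMem ha, pad_of_notMem]
        rintro ⟨i, hi⟩
        exact ha ⟨i, e.injective hi⟩
    · rw [Pi.add_apply, Function.extend_apply' _ _ _ hw, Function.extend_apply' _ _ _ hw,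
        pad_of_notMem, add_zero]
      rintro ⟨i, hi⟩
      exact hw ⟨_, hi⟩
  funext x
  simp only [slice, subProj_apply, InS, h2]
  classical exact if_congr (by rw [h1]) rfl rfl

end

/-! ### The wires of the basis finder -/

/-- The wires: registers, ancillas of the copies of the counterfeiter, flags, two constant wires, a
wire for phase kick-back, scratch wires, and wires for conditions and their conjunctions. -/
inductive Wire (n a F T : ℕ) where
  | data (k : Fin (n + 1)) (i : Fin n)
  | anc (k : Fin n) (j : Fin a)
  | flag (k : Fin (n + 1)) (j : Fin (F + 1))
  | o1 | o2 | mi | s | A | B | C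
  | v (j : Fin T)
  | c (j : Fin (T + 1))
  deriving DecidableEq, Fintype

section

variable {n a F T : ℕ}

/-- The wires of registers, ancillas and flags. -/
def Wire.IsData : Wire n a F T → Prop
  | data _ _ => True
  | anc _ _ => True
  | flag _ _ => True
  | _ => False

/-- The wires that may occur in conditions. -/
def Wire.IsSrc : Wire n a F T → Prop
  | o2 => True
  | w => w.IsData

/-- The type of wires that may occur in conditions. -/
abbrev Src (n a F T : ℕ) := {w : Wire n a F T // w.IsSrc}

/-- States of the wires. -/
abbrev WSt (n a F T : ℕ) := St (Wire n a F T)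

/-- `addf w f` adds the value of `f` to wire `w`, if `f` does not depend on `w`. -/
def addf {ι : Type} [DecidableEq ι] (w : ι) (f : (ι → ZMod 2) → ZMod 2) : Op ι where
  toFun ψ z := ψ (Function.update z w (z w + f z))
  map_add' _ _ := rfl
  map_smul' _ _ := rfl

theorem addf_apply {ι : Type} [DecidableEq ι] (w : ι) (f : (ι → ZMod 2) → ZMod 2) (ψ : St ι)
    (z : ι → ZMod 2) : addf w f ψ z = ψ (Function.update z w (z w + f z)) := rfl

theorem addf_mul_addf {ι : Type} [DecidableEq ι] (w : ι) {f g : (ι → ZMod 2) → ZMod 2}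
    (hf : ∀ z b, f (Function.update z w b) = f z) :
    addf w g * addf w f = addf w fun z => f z + g z := by
  refine op_ext fun ψ z => ?_
  simp only [Module.End.mul_apply, addf_apply, hf, Function.update_self, Function.update_idem]
  congr 2
  ring

theorem commute_addf_proj {ι : Type} [DecidableEq ι] {w : ι} {f : (ι → ZMod 2) → ZMod 2}
    {p : (ι → ZMod 2) → Prop} (h : Indep p w) : Commute (addf w f) (proj p) := by
  refine op_ext fun ψ z => ?_
  classical exact if_congr (h z _) rfl rfl

theorem Wire.IsSrc.ne {w w' : Wire n a F T} (h : w.IsSrc) (h' : ¬ w'.IsSrc) : w ≠ w' := by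
  rintro rfl; exact h' h

theorem src_ne_o1 (x : Src n a F T) : x.1 ≠ .o1 := x.2.ne (by simp [Wire.IsSrc, Wire.IsData])
theorem src_ne_s (x : Src n a F T) : x.1 ≠ .s := x.2.ne (by simp [Wire.IsSrc, Wire.IsData])
theorem src_ne_A (x : Src n a F T) : x.1 ≠ .A := x.2.ne (by simp [Wire.IsSrc, Wire.IsData])
theorem src_ne_B (x : Src n a F T) : x.1 ≠ .B := x.2.ne (by simp [Wire.IsSrc, Wire.IsData])
theorem src_ne_C (x : Src n a F T) : x.1 ≠ .C := x.2.ne (by simp [Wire.IsSrc, Wire.IsData])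
theorem src_ne_v (x : Src n a F T) (j : Fin T) : x.1 ≠ .v j :=
  x.2.ne (by simp [Wire.IsSrc, Wire.IsData])

/-- Add the product of three wires to `v j`. -/
def mono (j : Fin T) (t : Src n a F T × Src n a F T × Src n a F T) : List (WGate (Wire n a F T)) :=
  [.tof t.1.1 .o1 .A (src_ne_o1 _) (src_ne_A _) (by simp),
   .tof t.2.1.1 .o1 .B (src_ne_o1 _) (src_ne_B _) (by simp),
   .tof t.2.2.1 .o1 .C (src_ne_o1 _) (src_ne_C _) (by simp),
   .tof .A .B .s (by simp) (by simp) (by simp),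
   .tof .s .C (.v j) (by simp) (by simp) (by simp),
   .tof .A .B .s (by simp) (by simp) (by simp),
   .tof t.2.2.1 .o1 .C (src_ne_o1 _) (src_ne_C _) (by simp),
   .tof t.2.1.1 .o1 .B (src_ne_o1 _) (src_ne_B _) (by simp),
   .tof t.1.1 .o1 .A (src_ne_o1 _) (src_ne_A _) (by simp)]

/-- The value added by `mono`. -/
def monoVal (t : Src n a F T × Src n a F T × Src n a F T) (z : Wire n a F T → ZMod 2) : ZMod 2 :=
  (z .s + (z .A + z t.1.1 * z .o1) * (z .B + z t.2.1.1 * z .o1)) * (z .C + z t.2.2.1 * z .o1)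

theorem op_tof {ι : Type} [DecidableEq ι] (i j k : ι) (hij : i ≠ j) (hik : i ≠ k) (hjk : j ≠ k) :
    (WGate.tof i j k hij hik hjk).op = addf k fun z => z i * z j := rfl

/-- The three factors may be the same wire, whereas a Toffoli gate needs distinct wires; they are
therefore first added to `A`, `B`, `C`. The last four gates restore the scratch wires. The identity
holds for arbitrary contents of the scratch wires, which is why these appear in `monoVal`. -/
theorem run_mono (j : Fin T) (t : Src n a F T × Src n a F T × Src n a F T) :
    run (mono j t) = addf (.v j) (monoVal t) := by
  refine op_ext fun ψ z => ?_
  obtain ⟨⟨x, hx⟩, ⟨y, hy⟩, ⟨w, hw⟩⟩ := t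
  simp only [mono, run_cons, run_nil, one_mul, Module.End.mul_apply, op_tof, addf_apply]
  congr 1
  have hxA := src_ne_A ⟨x, hx⟩
  have hxB := src_ne_B ⟨x, hx⟩
  have hxC := src_ne_C ⟨x, hx⟩
  have hxs := src_ne_s ⟨x, hx⟩
  have hxv := src_ne_v ⟨x, hx⟩ j
  have hyA := src_ne_A ⟨y, hy⟩
  have hyB := src_ne_B ⟨y, hy⟩
  have hyC := src_ne_C ⟨y, hy⟩
  have hys := src_ne_s ⟨y, hy⟩
  have hyv := src_ne_v ⟨y, hy⟩ j
  have hwA := src_ne_A ⟨w, hw⟩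
  have hwB := src_ne_B ⟨w, hw⟩
  have hwC := src_ne_C ⟨w, hw⟩
  have hws := src_ne_s ⟨w, hw⟩
  have hwv := src_ne_v ⟨w, hw⟩ j
  simp only at hxA hxB hxC hxs hxv hyA hyB hyC hys hyv hwA hwB hwC hws hwv
  funext r
  by_cases h1 : r = .A
  · subst h1; simp [*, add_assoc]
  by_cases h2 : r = .B
  · subst h2; simp [*, add_assoc]
  by_cases h3 : r = .C
  · subst h3; simp [*, add_assoc]
  by_cases h4 : r = .s
  · subst h4; simp [*, add_assoc]
  by_cases h5 : r = .v j
  · subst h5; simp [*, monoVal]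
  simp [*]

/-- Add the sum of a list of products of wires to `v j`. -/
def polyCirc (j : Fin T) (l : List (Src n a F T × Src n a F T × Src n a F T)) :
    List (WGate (Wire n a F T)) := l.flatMap (mono j)

/-- The value added by `polyCirc`. -/
def polyVal (l : List (Src n a F T × Src n a F T × Src n a F T)) (z : Wire n a F T → ZMod 2) :
    ZMod 2 := (l.map fun t => monoVal t z).sum

theorem monoVal_update (t : Src n a F T × Src n a F T × Src n a F T) (z : Wire n a F T → ZMod 2)
    (j : Fin T) (b : ZMod 2) : monoVal t (Function.update z (.v j) b) = monoVal t z := by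
  simp [monoVal, Function.update_of_ne (src_ne_v _ j)]

theorem run_polyCirc (j : Fin T) (l : List (Src n a F T × Src n a F T × Src n a F T)) :
    run (polyCirc j l) = addf (.v j) (polyVal l) := by
  induction l with
  | nil =>
    refine op_ext fun ψ z => ?_
    simp [polyCirc, polyVal, addf_apply]
  | cons t l ih =>
    rw [show polyCirc j (t :: l) = mono j t ++ polyCirc j l by simp [polyCirc], run_append, ih,
      run_mono, addf_mul_addf _ fun z b => monoVal_update t z j b]
    congr 1

/-- The sum of a list of products of wires. -/
def polySum (l : List (Src n a F T × Src n a F T × Src n a F T)) (z : Wire n a F T → ZMod 2) :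
    ZMod 2 := (l.map fun t => z t.1.1 * (z t.2.1.1 * z t.2.2.1)).sum

theorem polySum_update (l : List (Src n a F T × Src n a F T × Src n a F T))
    (z : Wire n a F T → ZMod 2) (j : Fin T) (b : ZMod 2) :
    polySum l (Function.update z (.v j) b) = polySum l z := by
  simp [polySum, Function.update_of_ne (src_ne_v _ j)]

/-- The constant and scratch wires have their initial values. -/
def Clean (z : Wire n a F T → ZMod 2) : Prop :=
  z .o1 = 1 ∧ z .o2 = 1 ∧ z .s = 0 ∧ z .A = 0 ∧ z .B = 0 ∧ z .C = 0 ∧ z (.c 0) = 1 ∧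
    ∀ j : Fin T, z (.c j.succ) = 0

theorem Clean.polyVal {z : Wire n a F T → ZMod 2} (h : Clean z)
    (l : List (Src n a F T × Src n a F T × Src n a F T)) : polyVal l z = polySum l z := by
  obtain ⟨h1, -, h2, h3, h4, h5, -⟩ := h
  simp [HiddenSubspace.polyVal, polySum, monoVal, h1, h2, h3, h4, h5, mul_assoc]

/-- A property that does not depend on registers, ancillas and flags. -/
def Aux (p : (Wire n a F T → ZMod 2) → Prop) : Prop := ∀ w : Wire n a F T, w.IsData → Indep p w

theorem aux_clean : Aux (Clean (n := n) (a := a) (F := F) (T := T)) := by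
  intro w hw z b
  cases w <;> simp [Clean, Wire.IsData] at hw ⊢

theorem indep_clean_v (j : Fin T) : Indep (Clean (n := n) (a := a) (F := F) (T := T)) (.v j) := by
  intro z b
  simp [Clean]

/-- Wires of conditions are zero. -/
def VZero (V : Set (Fin T)) (z : Wire n a F T → ZMod 2) : Prop := ∀ j ∈ V, z (.v j) = 0

theorem aux_vzero (V : Set (Fin T)) : Aux (VZero (n := n) (a := a) (F := F) V) := by
  intro w hw z b
  cases w <;> simp [VZero, Wire.IsData] at hw ⊢

theorem indep_vzero {V : Set (Fin T)} {j : Fin T} (h : j ∉ V) :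
    Indep (VZero (n := n) (a := a) (F := F) V) (.v j) := by
  intro z b
  refine forall₂_congr fun i hi => ?_
  rw [Function.update_of_ne]
  rintro ⟨⟩
  exact h hi

theorem proj_eq_self_iff {ι : Type} [DecidableEq ι] {p : (ι → ZMod 2) → Prop} {ψ : St ι} :
    proj p ψ = ψ ↔ ∀ z, ¬ p z → ψ z = 0 := by
  constructor
  · intro h z hz
    rw [← h, proj_apply, if_neg hz]
  · intro h
    funext z
    rw [proj_apply]
    split_ifs with hz
    · rfl
    · exact (h z hz).symm

/-- The circuit `gs` measures the projection `P` by means of the condition wires in `V`, which stay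
zero exactly on the range of `P`. -/
structure Tests (gs : List (WGate (Wire n a F T))) (V : Set (Fin T))
    (P : Op (Wire n a F T)) : Prop where
  test : ∀ χ, proj Clean χ = χ → proj (VZero V) χ = χ → proj (VZero V) (run gs χ) = P χ
  fix : ∀ χ, proj Clean χ = χ → proj (VZero V) χ = χ → run gs (P χ) = P χ
  comm : ∀ p, Aux p → (∀ j ∈ V, Indep p (.v j)) → Commute (run gs) (proj p)
  comm_proj : ∀ p, Aux p → Commute P (proj p)
  idem : P * P = P

theorem Tests.congr {gs gs' : List (WGate (Wire n a F T))} {V V' : Set (Fin T)}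
    {P P' : Op (Wire n a F T)} (h : Tests gs V P) (h1 : gs' = gs) (h2 : V' = V) (h3 : P' = P) :
    Tests gs' V' P' := by
  rwa [h1, h2, h3]

theorem Commute.apply_eq {ι : Type} {A B : Op ι} (h : Commute A B) (ψ : St ι) :
    A (B ψ) = B (A ψ) := LinearMap.congr_fun h.eq ψ

theorem Commute.fixed {ι : Type} {A B : Op ι} (h : Commute A B) {ψ : St ι} (hψ : B ψ = ψ) :
    B (A ψ) = A ψ := by
  rw [← Commute.apply_eq h, hψ]

theorem Tests.clean {gs : List (WGate (Wire n a F T))} {V : Set (Fin T)} {P : Op (Wire n a F T)}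
    (h : Tests gs V P) {χ : WSt n a F T} (hχ : proj Clean χ = χ) :
    proj Clean (run gs χ) = run gs χ :=
  Commute.fixed (h.comm _ aux_clean fun j _ => indep_clean_v j) hχ

theorem vzero_union (V W : Set (Fin T)) : (proj (VZero (n := n) (a := a) (F := F) (V ∪ W))) =
    proj (VZero V) * proj (VZero W) := by
  rw [proj_mul_proj]
  congr 1
  funext z
  simp [VZero, or_imp, forall_and]

/-- The condition wires of the two tests are disjoint, so neither test disturbs the other's record.
The projections must commute for their product to be a projection again and for `gs` to act
trivially on its range. -/
theorem Tests.append {gs hs : List (WGate (Wire n a F T))} {V W : Set (Fin T)}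
    {P Q : Op (Wire n a F T)} (h1 : Tests gs V P) (h2 : Tests hs W Q) (hVW : Disjoint V W)
    (hPQ : Commute P Q) : Tests (gs ++ hs) (V ∪ W) (Q * P) := by
  have split : ∀ χ : WSt n a F T, proj (VZero (V ∪ W)) χ = χ →
      proj (VZero V) χ = χ ∧ proj (VZero W) χ = χ := by
    intro χ hχ
    rw [vzero_union] at hχ
    constructor
    · rw [← hχ, ← Module.End.mul_apply, ← mul_assoc, proj_mul_self]
    · rw [← hχ, ← Module.End.mul_apply, (commute_proj_proj (VZero V) (VZero W)).eq, ← mul_assoc,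
        proj_mul_self]
  constructor
  · intro χ hχ hV
    obtain ⟨hV, hW⟩ := split χ hV
    have hc := h1.clean hχ
    have hW' : proj (VZero W) (run gs χ) = run gs χ :=
      Commute.fixed (h1.comm _ (aux_vzero W) fun j hj =>
        indep_vzero (Set.disjoint_left.1 hVW hj)) hW
    -- The second test is evaluated first and leaves `Q` in front; the condition wires of the first
    -- test can then be moved past `Q`.
    rw [vzero_union, run_append, Module.End.mul_apply, Module.End.mul_apply, h2.test _ hc hW',
      ← Commute.apply_eq (h2.comm_proj _ (aux_vzero V)), h1.test χ hχ hV, Module.End.mul_apply]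
  · intro χ hχ hV
    obtain ⟨hV, hW⟩ := split χ hV
    have h0 : P ((Q * P) χ) = (Q * P) χ := by
      rw [← Module.End.mul_apply, ← mul_assoc, hPQ.eq, mul_assoc, h1.idem]
    have comm : ∀ p, Aux p → Commute (Q * P) (proj p) := fun p hp =>
      (h2.comm_proj p hp).mul_left (h1.comm_proj p hp)
    have h3 := h1.fix ((Q * P) χ) (Commute.fixed (comm _ aux_clean) hχ)
      (Commute.fixed (comm _ (aux_vzero V)) hV)
    rw [h0] at h3
    rw [run_append, Module.End.mul_apply, h3, Module.End.mul_apply]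
    exact h2.fix _ (Commute.fixed (h1.comm_proj _ aux_clean) hχ)
      (Commute.fixed (h1.comm_proj _ (aux_vzero W)) hW)
  · intro p hp hj
    rw [run_append]
    exact (h2.comm p hp fun j h => hj j (Or.inr h)).mul_left
      (h1.comm p hp fun j h => hj j (Or.inl h))
  · intro p hp
    exact (h2.comm_proj p hp).mul_left (h1.comm_proj p hp)
  · rw [mul_assoc, ← mul_assoc P, hPQ.eq, mul_assoc, h1.idem, ← mul_assoc, h2.idem]

/-- The wire `v j` starts at zero and receives the value of the sum, so it stays zero exactly where
the sum vanishes; there the circuit changes nothing. -/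
theorem tests_polyCirc (j : Fin T) (l : List (Src n a F T × Src n a F T × Src n a F T)) :
    Tests (polyCirc j l) {j} (proj fun z => polySum l z = 0) := by
  constructor
  · intro χ hχ hV
    rw [proj_eq_self_iff] at hχ hV
    funext z
    rw [proj_apply, run_polyCirc, addf_apply, proj_apply]
    by_cases hz : Clean z
    · rw [hz.polyVal]
      by_cases hv : VZero {j} z
      · rw [if_pos hv]
        rcases zmod2_cases (polySum l z) with h0 | h0
        · rw [if_pos h0, h0, add_zero, Function.update_eq_self]
        · rw [if_neg (by simp [h0])]
          refine hV _ fun h' => ?_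
          have h1 := hv j rfl
          have h2 := h' j rfl
          simp [h1, h0] at h2
      · rw [if_neg hv, hV z hv]; simp
    · rw [hχ _ ((indep_clean_v j z _).not.2 hz), hχ z hz]; simp
  · intro χ hχ hV
    rw [proj_eq_self_iff] at hχ hV
    funext z
    rw [run_polyCirc, addf_apply, proj_apply, proj_apply, polySum_update]
    by_cases hz : Clean z
    · rw [hz.polyVal]
      by_cases h0 : polySum l z = 0
      · rw [h0, add_zero, Function.update_eq_self]
      · rw [if_neg h0, if_neg h0]
    · rw [hχ _ ((indep_clean_v j z _).not.2 hz), hχ z hz]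
  · intro p _ hj
    rw [run_polyCirc]
    exact commute_addf_proj (hj j rfl)
  · exact fun p _ => commute_proj_proj _ _
  · exact proj_mul_self _

theorem Tests.nil : Tests (n := n) (a := a) (F := F) (T := T) [] ∅ 1 where
  test _ _ h := h
  fix _ _ _ := rfl
  comm _ _ _ := Commute.one_left _
  comm_proj _ _ := Commute.one_left _
  idem := one_mul 1

theorem tests_conds {β : Type} (L : List β) (hL : L.Nodup) (j : β → Fin T)
    (hj : Function.Injective j) (l : β → List (Src n a F T × Src n a F T × Src n a F T)) :
    Tests (L.flatMap fun b => polyCirc (j b) (l b)) (j '' {b | b ∈ L})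
      (proj fun z => ∀ b ∈ L, polySum (l b) z = 0) := by
  induction L with
  | nil =>
    refine Tests.nil.congr rfl (by simp) ?_
    exact LinearMap.ext fun ψ => proj_eq_self_iff.2 fun z hz => absurd (by simp) hz
  | cons b L ih =>
    obtain ⟨hb, hL⟩ := List.nodup_cons.1 hL
    have h := (tests_polyCirc (j b) (l b)).append (ih hL) ?_ (commute_proj_proj _ _)
    · rw [proj_mul_proj] at h
      refine h.congr rfl ?_ ?_
      · rw [← Set.image_singleton, ← Set.image_union]
        congr 1
        ext i
        exact List.mem_cons
      · congr 1
        funext z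
        rw [List.forall_mem_cons, and_comm]
    · rw [Set.disjoint_singleton_left]
      rintro ⟨b', hb', h⟩
      exact hb (hj h ▸ hb')

/-- Hadamard gates on data wires commute with all properties of the auxiliary wires, so conjugating
the circuit conjugates the measured projection. -/
theorem Tests.conj_hads {gs : List (WGate (Wire n a F T))} {V : Set (Fin T)}
    {P : Op (Wire n a F T)} (h : Tests gs V P) {l : List (Wire n a F T)} (hl : l.Nodup)
    (hd : ∀ w ∈ l, w.IsData) :
    Tests (hads l ++ gs ++ hads l) V (run (hads l) * P * run (hads l)) := by
  have hc : ∀ p : (Wire n a F T → ZMod 2) → Prop, Aux p → Commute (run (hads l)) (proj p) := by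
    intro p hp
    refine commute_run_proj fun g hg i hi => ?_
    obtain ⟨w, hw, rfl⟩ := List.mem_map.1 hg
    cases hi
    exact hp _ (hd _ hw)
  have hH : ∀ χ, run (hads l) (run (hads l) χ) = χ := fun χ => by
    rw [← Module.End.mul_apply, hads_mul_self hl, Module.End.one_apply]
  constructor
  · intro χ hχ hV
    simp only [run_append, Module.End.mul_apply]
    rw [← Commute.apply_eq (hc _ (aux_vzero V)), h.test _ (Commute.fixed (hc _ aux_clean) hχ)
      (Commute.fixed (hc _ (aux_vzero V)) hV)]
  · intro χ hχ hV
    simp only [run_append, Module.End.mul_apply]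
    rw [hH, h.fix _ (Commute.fixed (hc _ aux_clean) hχ)
      (Commute.fixed (hc _ (aux_vzero V)) hV)]
  · intro p hp hj
    simp only [run_append]
    exact (hc p hp).mul_left ((h.comm p hp hj).mul_left (hc p hp))
  · intro p hp
    exact ((hc p hp).mul_left (h.comm_proj p hp)).mul_left (hc p hp)
  · have e := h.idem
    have e2 := hads_mul_self hl
    calc _ = run (hads l) * P * (run (hads l) * run (hads l)) * P * run (hads l) := by
          simp only [mul_assoc]
      _ = _ := by rw [e2, mul_one, mul_assoc (run (hads l)), e]

/-! ### The conjunction of the conditions -/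

/-- Add to `c (j + 1)` the product of `c j` and the negation of `v j`, negating `v j`. -/
def chainStep (j : Fin T) : List (WGate (Wire n a F T)) :=
  [.tof .o1 .o2 (.v j) (by simp) (by simp) (by simp),
   .tof (.c j.castSucc) (.v j) (.c j.succ) (by simp) (by simp [Fin.ext_iff]) (by simp)]

/-- Compute the conjunction of the negations of the first `t` condition wires. -/
def chain (t : ℕ) : List (WGate (Wire n a F T)) :=
  (List.range t).flatMap fun j => if h : j < T then chainStep ⟨j, h⟩ else []

theorem chainStep_test (j : Fin T) {χ : WSt n a F T}
    (hχ : proj (fun z => z .o1 = 1 ∧ z .o2 = 1 ∧ z (.c j.succ) = 0) χ = χ) :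
    proj (fun z => z (.c j.succ) = 1) (run (chainStep j) χ) =
      run (chainStep j) (proj (fun z => z (.c j.castSucc) = 1 ∧ z (.v j) = 0) χ) := by
  rw [proj_eq_self_iff] at hχ
  funext z
  have hcc : (Wire.c j.castSucc : Wire n a F T) ≠ .c j.succ := by simp [Fin.ext_iff]
  simp only [chainStep, run_cons, run_nil, one_mul, Module.End.mul_apply, op_tof, addf_apply,
    proj_apply]
  -- The basis state `w` is the one whose amplitude the two gates carry to `z`. Where `w` has the
  -- prescribed constants, the claim is a finite check on three bits; elsewhere the amplitude is
  -- zero.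
  set w := Function.update (Function.update z (.c j.succ)
    (z (.c j.succ) + z (.c j.castSucc) * z (.v j))) (.v j) (Function.update z (.c j.succ)
    (z (.c j.succ) + z (.c j.castSucc) * z (.v j)) (.v j) + Function.update z (.c j.succ)
    (z (.c j.succ) + z (.c j.castSucc) * z (.v j)) .o1 * Function.update z (.c j.succ)
    (z (.c j.succ) + z (.c j.castSucc) * z (.v j)) .o2) with hw
  by_cases h : w .o1 = 1 ∧ w .o2 = 1 ∧ w (.c j.succ) = 0
  · obtain ⟨h1, h2, h3⟩ := h
    have e1 : z .o1 = 1 := by rw [← h1, hw]; simp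
    have e2 : z .o2 = 1 := by rw [← h2, hw]; simp
    have e3 : z (.c j.succ) + z (.c j.castSucc) * z (.v j) = 0 := by rw [← h3, hw]; simp
    have e4 : w (.c j.castSucc) = z (.c j.castSucc) := by rw [hw]; simp [hcc]
    have e5 : w (.v j) = z (.v j) + 1 := by rw [hw]; simp [e1, e2]
    rw [e4, e5]
    congr 1
    generalize z (.c j.succ) = x at e3 ⊢
    generalize z (.c j.castSucc) = y at e3 ⊢
    generalize z (.v j) = u at e3 ⊢
    revert e3
    revert x y u
    decide
  · rw [hχ w h]; simp

theorem mem_chain {t : ℕ} {g : WGate (Wire n a F T)} (hg : g ∈ chain t) :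
    ∃ j : Fin T, (j : ℕ) < t ∧ g ∈ chainStep j := by
  simp only [chain, List.mem_flatMap, List.mem_range] at hg
  obtain ⟨j, hj, hg⟩ := hg
  split_ifs at hg with h
  · exact ⟨⟨j, h⟩, hj, hg⟩
  · simp at hg

theorem mods_chain {t : ℕ} {g : WGate (Wire n a F T)} (hg : g ∈ chain t) {w : Wire n a F T}
    (hw : w ∈ g.mods) : ∃ j : Fin T, (j : ℕ) < t ∧ (w = .v j ∨ w = .c j.succ) := by
  obtain ⟨j, hj, hg⟩ := mem_chain hg
  refine ⟨j, hj, ?_⟩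
  simp only [chainStep, List.mem_cons, List.not_mem_nil, or_false] at hg
  rcases hg with rfl | rfl
  · exact Or.inl hw
  · exact Or.inr hw

/-- Each link writes to a fresh wire, and earlier links touch neither its target nor its condition
wire, so induction reduces the claim to a single link. It is formulated with branches: selecting on
the last link afterwards equals selecting on the conditions beforehand. -/
theorem chain_test (t : ℕ) (ht : t ≤ T) {χ : WSt n a F T} (hχ : proj Clean χ = χ) :
    proj (fun z => z (.c ⟨t, by omega⟩) = 1) (run (chain t) χ) =
      run (chain t) (proj (VZero {j : Fin T | (j : ℕ) < t}) χ) := by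
  induction t generalizing χ with
  | zero =>
    have h1 : proj (VZero {j : Fin T | (j : ℕ) < 0}) χ = χ :=
      proj_eq_self_iff.2 fun z hz => absurd (fun j hj => absurd hj (by simp)) hz
    rw [h1]
    refine proj_eq_self_iff.2 fun z hz => proj_eq_self_iff.1 hχ z fun hc => hz ?_
    exact hc.2.2.2.2.2.2.1
  | succ t ih =>
    set j : Fin T := ⟨t, ht⟩ with hj
    have hsucc : (chain (t + 1) : List (WGate (Wire n a F T))) = chain t ++ chainStep j := by
      simp [chain, List.range_succ, Nat.lt_of_succ_le ht, hj]
    rw [hsucc, run_append, Module.End.mul_apply, Module.End.mul_apply]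
    have hc1 : Commute (run (chain t : List (WGate (Wire n a F T))))
        (proj fun z => z .o1 = 1 ∧ z .o2 = 1 ∧ z (.c j.succ) = 0) := by
      refine commute_run_proj fun g hg w hw => ?_
      obtain ⟨i, hi, rfl | rfl⟩ := mods_chain hg hw
      · intro z b; simp
      · intro z b
        have : i ≠ j := by rintro rfl; simp [hj] at hi
        have : (Wire.c j.succ : Wire n a F T) ≠ .c i.succ := by simpa using this.symm
        simp [Function.update_of_ne this]
    have hc2 : Commute (run (chain t : List (WGate (Wire n a F T))))
        (proj fun z => z (.v j) = 0) := by
      refine commute_run_proj fun g hg w hw => ?_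
      obtain ⟨i, hi, rfl | rfl⟩ := mods_chain hg hw
      · intro z b
        have : i ≠ j := by rintro rfl; simp [hj] at hi
        have : (Wire.v j : Wire n a F T) ≠ .v i := by simpa using this.symm
        simp [Function.update_of_ne this]
      · intro z b; simp
    have hχ' : proj (fun z => z (.v j) = 0) χ = proj Clean (proj (fun z => z (.v j) = 0) χ) := by
      conv_lhs => rw [← hχ]
      exact Commute.apply_eq (commute_proj_proj _ _) _
    have h1 := chainStep_test j (χ := run (chain t) χ) (Commute.fixed hc1 ?_)
    · have e : (⟨t + 1, by omega⟩ : Fin (T + 1)) = j.succ := rfl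
      rw [e, h1, ← proj_mul_proj, Module.End.mul_apply, ← Commute.apply_eq hc2]
      have e2 : (j.castSucc : Fin (T + 1)) = ⟨t, by omega⟩ := rfl
      rw [e2, ih (by omega) hχ'.symm, ← Module.End.mul_apply (proj _) (proj _), proj_mul_proj]
      congr 3
      congr 1
      funext z
      simp only [VZero, Set.mem_ofPred_eq, eq_iff_iff]
      constructor
      · rintro ⟨h, h'⟩ i hi
        rcases Nat.lt_succ_iff_lt_or_eq.1 hi with hi | hi
        · exact h i hi
        · rwa [show i = j from Fin.ext hi]
      · exact fun h => ⟨fun i hi => h i (by omega), h j (by simp [hj])⟩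
    · refine proj_eq_self_iff.2 fun z hz => proj_eq_self_iff.1 hχ z fun hc => hz ?_
      exact ⟨hc.1, hc.2.1, hc.2.2.2.2.2.2.2 j⟩

/-- Flip wire `t` on the range of the projection measured by `gs`. -/
def toggle (gs : List (WGate (Wire n a F T))) (t : Wire n a F T) (h1 : .c (Fin.last T) ≠ t)
    (h2 : .o1 ≠ t) : List (WGate (Wire n a F T)) :=
  gs ++ chain T ++ [.tof (.c (Fin.last T)) .o1 t (by simp) h1 h2] ++ invGates (gs ++ chain T)

theorem wires_chain {t : ℕ} {g : WGate (Wire n a F T)} (hg : g ∈ chain t) {w : Wire n a F T}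
    (hw : w ∈ g.wires) : w = .o1 ∨ w = .o2 ∨ (∃ j, w = .v j) ∨ ∃ j, w = .c j := by
  obtain ⟨j, -, hg⟩ := mem_chain hg
  simp only [chainStep, List.mem_cons, List.not_mem_nil, or_false] at hg
  rcases hg with rfl | rfl <;> simp [WGate.wires] at hw <;> rcases hw with rfl | rfl | rfl <;> simp

/-- Compute, flip, uncompute. The flip of `t` commutes with the computation, which does not involve
`t`, so after uncomputing it acts only on the branch `P ψ`. -/
theorem run_toggle {gs : List (WGate (Wire n a F T))} {V : Set (Fin T)} {P : Op (Wire n a F T)}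
    (h : Tests gs V P) (t : Wire n a F T) (h1 : .c (Fin.last T) ≠ t) (h2 : .o1 ≠ t)
    (hgs : ∀ g ∈ gs, t ∉ g.wires) (hch : ∀ g ∈ (chain T : List (WGate (Wire n a F T))), t ∉ g.wires)
    {ψ : WSt n a F T} (hψ : proj Clean ψ = ψ) (hv : proj (VZero Set.univ) ψ = ψ) :
    run (toggle gs t h1 h2) ψ = ψ - P ψ + tr (Pi.single t 1) (P ψ) := by
  set R : List (WGate (Wire n a F T)) := gs ++ chain T with hR
  have hRt : Commute (run R) (tr (Pi.single t 1)) := by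
    refine commute_run_tr fun g hg i hi => Pi.single_eq_of_ne ?_ _
    rintro rfl
    rcases List.mem_append.1 hg with hg | hg
    · exact hgs g hg hi
    · exact hch g hg hi
  have hRo : Commute (run R) (proj fun z => z .o1 = 1) := by
    rw [hR, run_append]
    refine Commute.mul_left (commute_run_proj fun g hg w hw => ?_) (h.comm _ ?_ ?_)
    · obtain ⟨i, hi, rfl | rfl⟩ := mods_chain hg hw <;> intro z b <;> simp
    · intro w hw z b
      cases w <;> simp [Wire.IsData] at hw ⊢
    · intro j _ z b; simp
  have hVV : ∀ W : Set (Fin T), proj (VZero W) ψ = ψ := fun W =>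
    proj_eq_self_iff.2 fun z hz => proj_eq_self_iff.1 hv z fun hc => hz fun j _ => hc j trivial
  -- The last conjunction wire selects the branch in which all conditions are zero after `gs`; this
  -- branch is `P ψ`. Since `gs` fixes `P ψ`, it is also the image of `P ψ` under the complete
  -- computation.
  have hlast : proj (fun z => z (.c (Fin.last T)) = 1) (run R ψ) = run R (P ψ) := by
    have h3 := chain_test T le_rfl (h.clean hψ)
    rw [hR, run_append, Module.End.mul_apply, Module.End.mul_apply]
    refine h3.trans ?_
    congr 1
    rw [h.fix ψ hψ (hVV V), ← h.test ψ hψ (hVV V)]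
    -- The condition wires outside `V` are still zero, so it makes no difference that the chain runs
    -- through all of them.
    have h4 : proj (VZero Vᶜ) (run gs ψ) = run gs ψ :=
      Commute.fixed (h.comm _ (aux_vzero _) fun j hj => indep_vzero (by simpa using hj)) (hVV _)
    conv_rhs => rw [← h4, ← Module.End.mul_apply, ← vzero_union]
    congr 2
    funext z
    simp [VZero]
  have ho : proj (fun z => z .o1 = 1) (run R ψ) = run R ψ := by
    refine Commute.fixed hRo (proj_eq_self_iff.2 fun z hz => proj_eq_self_iff.1 hψ z fun hc => ?_)
    exact hz hc.1
  have hx : (WGate.tof (.c (Fin.last T)) .o1 t (by simp) h1 h2).op (run R ψ) =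
      run R ψ - run R (P ψ) + tr (Pi.single t 1) (run R (P ψ)) := by
    rw [← hlast]
    rw [proj_eq_self_iff] at ho
    funext z
    simp only [op_tof, addf_apply, Pi.add_apply, Pi.sub_apply, proj_apply, tr_apply]
    have hu : Function.update z t (z t + 1) = z + Pi.single t 1 := by
      funext w
      by_cases hw : w = t
      · subst hw; simp
      · simp [hw]
    have ht1 : (z + Pi.single t 1 : Wire n a F T → ZMod 2) (.c (Fin.last T))
        = z (.c (Fin.last T)) := by simp [h1]
    have ht2 : (z + Pi.single t 1 : Wire n a F T → ZMod 2) .o1 = z .o1 := by simp [h2]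
    by_cases hz : z .o1 = 1
    · rcases zmod2_cases (z (.c (Fin.last T))) with hc | hc
      · simp [hz, hc, h1]
      · simp [hz, hc, hu, h1]
    · rw [ho _ (by rwa [Function.update_of_ne h2]), ho z hz, ho _ (by rwa [ht2])]
      simp
  rw [toggle, ← hR, run_append, run_append, Module.End.mul_apply, Module.End.mul_apply, run_cons,
    run_nil, one_mul, hx, Commute.apply_eq hRt.symm, map_add, map_sub]
  simp only [← Module.End.mul_apply (run (invGates R)) (run R), run_invGates_mul,
    Module.End.one_apply]

end

/-! ### Evaluation of polynomials of degree at most three -/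

section

variable {n : ℕ}

theorem factor_apply (x : Fin (n + 1)) (i : Fin n) : factor x i = if x = i.succ then 1 else 0 := by
  refine Fin.cases ?_ (fun j => ?_) x
  · simp [factor, (Fin.succ_ne_zero i).symm]
  · simp [factor, Finsupp.single_apply]

theorem factor_sum_apply (x y w : Fin (n + 1)) (i : Fin n) :
    (factor x + factor y + factor w) i = List.count i.succ [x, y, w] := by
  simp only [Finsupp.add_apply, factor_apply, List.count_cons, List.count_nil, beq_iff_eq]
  ring

/-- A monomial of degree at most 3 is a multiset of three elements of 1, X₁, …, Xₙ. The exponents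
give the multiplicities of the variables, the total 3 gives that of the constant, and sorting makes
the triple unique. -/
theorem factor_sum_injOn {x y w x' y' w' : Fin (n + 1)} (h1 : x ≤ y) (h2 : y ≤ w) (h1' : x' ≤ y')
    (h2' : y' ≤ w') (h : factor x + factor y + factor w = factor x' + factor y' + factor w') :
    [x, y, w] = [x', y', w'] := by
  have hsum : ∀ l : List (Fin (n + 1)), List.count 0 l + ∑ i : Fin n, List.count i.succ l
      = l.length := by
    intro l
    rw [← Fin.sum_univ_succ fun i => List.count i l]
    simpa using Multiset.sum_count_eq_card (s := Finset.univ) (m := (l : Multiset (Fin (n + 1))))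
      (by simp)
  have hc : ∀ i : Fin n, List.count i.succ [x, y, w] = List.count i.succ [x', y', w'] := by
    intro i
    rw [← factor_sum_apply, h, factor_sum_apply]
  have hp : [x, y, w].Perm [x', y', w'] := by
    rw [List.perm_iff_count]
    intro i
    refine Fin.cases ?_ hc i
    have e1 := hsum [x, y, w]
    have e2 := hsum [x', y', w']
    rw [Finset.sum_congr rfl fun i _ => hc i] at e1
    simp only [List.length_cons, List.length_nil] at e1 e2
    omega
  refine hp.eq_of_pairwise (le := (· ≤ ·)) (fun a b _ _ h h' => le_antisymm h h') ?_ ?_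
  · simp [h1, h2, h1.trans h2]
  · simp [h1', h2', h1'.trans h2']

/-- The variables of the monomial are padded by the constant 1 to a multiset of size three, which is
then sorted. -/
theorem exists_factor_sum (d : Fin n →₀ ℕ) (hd : (d.sum fun _ e => e) ≤ 3) :
    ∃ x y w : Fin (n + 1), x ≤ y ∧ y ≤ w ∧ factor x + factor y + factor w = d := by
  classical
  set M : Multiset (Fin (n + 1)) := (Finsupp.toMultiset d).map Fin.succ +
    Multiset.replicate (3 - (d.sum fun _ e => e)) 0 with hM
  have hcard : (M.sort (· ≤ ·)).length = 3 := by
    rw [Multiset.length_sort, hM, Multiset.card_add, Multiset.card_map,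
      Finsupp.card_toMultiset, Multiset.card_replicate]
    exact Nat.add_sub_cancel' hd
  obtain ⟨x, y, w, hl⟩ := List.length_eq_three.1 hcard
  have hs := Multiset.pairwise_sort M (· ≤ ·)
  rw [hl] at hs
  simp at hs
  refine ⟨x, y, w, hs.1.1, hs.2, Finsupp.ext fun i => ?_⟩
  rw [factor_sum_apply, ← hl, ← Multiset.coe_count, Multiset.sort_eq, hM, Multiset.count_add,
    Multiset.count_map_eq_count' _ _ (Fin.succ_injective _), Finsupp.count_toMultiset,
    Multiset.count_eq_zero_of_notMem, add_zero]
  intro h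
  exact Fin.succ_ne_zero i (Multiset.eq_of_mem_replicate h)

/-- The code of a polynomial lists a coefficient once for every ordering of its three factors.
Restricting to sorted triples counts each monomial exactly once. Powers need no treatment of their
own, since factors may repeat. -/
theorem eval_eq_sum_factor (p : MvPolynomial (Fin n) (ZMod 2)) (hp : p.totalDegree ≤ 3)
    (x : Fin n → ZMod 2) (xh : Fin (n + 1) → ZMod 2) (h0 : xh 0 = 1) (hx : ∀ i, xh (Fin.succ i) = x i) :
    MvPolynomial.eval x p = ∑ u : Fin (n + 1), ∑ v : Fin (n + 1), ∑ w : Fin (n + 1),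
      if u ≤ v ∧ v ≤ w ∧ p.coeff (factor u + factor v + factor w) = 1 then xh u * (xh v * xh w)
      else 0 := by
  classical
  set G : (Fin n →₀ ℕ) → ZMod 2 := fun d => p.coeff d * ∏ i, x i ^ d i with hG
  set s : Finset (Fin (n + 1) × Fin (n + 1) × Fin (n + 1)) :=
    Finset.univ.filter fun t => t.1 ≤ t.2.1 ∧ t.2.1 ≤ t.2.2 with hs
  set Φ : Fin (n + 1) × Fin (n + 1) × Fin (n + 1) → (Fin n →₀ ℕ) :=
    fun t => factor t.1 + factor t.2.1 + factor t.2.2 with hΦ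
  have hfac : ∀ u : Fin (n + 1), ∏ i, x i ^ factor u i = xh u := by
    intro u
    refine Fin.cases ?_ (fun j => ?_) u
    · simp [factor, h0]
    · rw [hx, Finset.prod_eq_single j]
      · simp [factor]
      · intro i _ hij
        simp [factor, hij.symm]
      · simp
  have hterm : ∀ t, G (Φ t) = if p.coeff (Φ t) = 1 then xh t.1 * (xh t.2.1 * xh t.2.2) else 0 := by
    intro t
    have : ∏ i, x i ^ (Φ t) i = xh t.1 * (xh t.2.1 * xh t.2.2) := by
      simp only [hΦ, Finsupp.add_apply, pow_add, Finset.prod_mul_distrib, hfac, mul_assoc]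
    rw [hG]
    simp only [this]
    rcases zmod2_cases (p.coeff (Φ t)) with h | h <;> simp [h]
  have hinj : Set.InjOn Φ s := by
    rintro ⟨a, b, c⟩ ht ⟨a', b', c'⟩ ht' h
    simp [hs] at ht ht'
    have := factor_sum_injOn ht.1 ht.2 ht'.1 ht'.2 h
    simpa using this
  have h1 : MvPolynomial.eval x p = ∑ t ∈ s, G (Φ t) := by
    rw [← Finset.sum_image (f := G) hinj, MvPolynomial.eval_eq']
    refine Finset.sum_subset ?_ ?_
    · intro d hd
      obtain ⟨a, b, c, hab, hbc, h⟩ :=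
        exists_factor_sum d ((MvPolynomial.le_totalDegree hd).trans hp)
      exact Finset.mem_image.2 ⟨(a, b, c), by simp [hs, hab, hbc], h⟩
    · intro d _ hd
      simp [MvPolynomial.notMem_support_iff.1 hd]
  rw [h1, hs, Finset.sum_filter, Fintype.sum_prod_type]
  refine Finset.sum_congr rfl fun u _ => ?_
  rw [Fintype.sum_prod_type]
  refine Finset.sum_congr rfl fun v _ => Finset.sum_congr rfl fun w _ => ?_
  rw [hterm]
  simp only [hΦ, ← and_assoc, ite_and]

end

/-! ### Circuits for the verification -/

section

variable {n a F T : ℕ}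

/-- The wires of register `k`. -/
def wreg (a F T : ℕ) (k : Fin (n + 1)) : Fin n ↪ Wire n a F T := ⟨.data k, fun _ _ h => by simpa using h⟩

/-- The wire of the `x`-th element of the list `1, X₁, …, Xₙ` for register `k`. -/
def srcOf (k : Fin (n + 1)) (x : Fin (n + 1)) : Src n a F T :=
  Fin.cases ⟨.o2, trivial⟩ (fun i => ⟨.data k i, trivial⟩) x

/-- The products of wires in register `k` whose sum is a polynomial. -/
def terms (k : Fin (n + 1)) (p : MvPolynomial (Fin n) (ZMod 2)) :
    List (Src n a F T × Src n a F T × Src n a F T) :=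
  (List.finRange (n + 1)).flatMap fun u => (List.finRange (n + 1)).flatMap fun v =>
    (List.finRange (n + 1)).flatMap fun w =>
      if u ≤ v ∧ v ≤ w ∧ p.coeff (factor u + factor v + factor w) = 1
      then [(srcOf k u, srcOf k v, srcOf k w)] else []

theorem polySum_flatMap {β : Type} (L : List β)
    (f : β → List (Src n a F T × Src n a F T × Src n a F T)) (z : Wire n a F T → ZMod 2) :
    polySum (L.flatMap f) z = (L.map fun b => polySum (f b) z).sum := by
  induction L with
  | nil => rfl
  | cons b L ih =>
    rw [List.flatMap_cons, List.map_cons, List.sum_cons, ← ih]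
    simp [polySum]

theorem polySum_terms (k : Fin (n + 1)) {p : MvPolynomial (Fin n) (ZMod 2)}
    (hp : p.totalDegree ≤ 3) {z : Wire n a F T → ZMod 2} (hz : z .o2 = 1) :
    polySum (terms k p) z = MvPolynomial.eval (z ∘ wreg a F T k) p := by
  rw [eval_eq_sum_factor p hp (z ∘ wreg a F T k)
    (fun x => z (srcOf (a := a) (F := F) (T := T) k x).1) hz fun i => rfl]
  have hl : ∀ f : Fin (n + 1) → ZMod 2, ((List.finRange (n + 1)).map f).sum = ∑ i, f i :=
    fun f => (Fin.sum_univ_def f).symm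
  simp only [terms, polySum_flatMap, hl]
  refine Finset.sum_congr rfl fun u _ => Finset.sum_congr rfl fun v _ =>
    Finset.sum_congr rfl fun w _ => ?_
  split_ifs <;> simp [polySum]

/-- `test` and `fix` speak only of clean states, so the projections need to agree only there; in
particular `o2` may be taken to be 1. -/
theorem Tests.congr_proj {gs : List (WGate (Wire n a F T))} {V : Set (Fin T)}
    {p q : (Wire n a F T → ZMod 2) → Prop} (h : Tests gs V (proj p))
    (hpq : ∀ z, Clean z → (q z ↔ p z)) : Tests gs V (proj q) := by
  have key : ∀ χ : WSt n a F T, proj Clean χ = χ → proj q χ = proj p χ := by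
    intro χ hχ
    funext z
    rw [proj_apply, proj_apply]
    by_cases hz : Clean z
    · classical exact if_congr (hpq z hz) rfl rfl
    · rw [proj_eq_self_iff.1 hχ z hz]; simp
  exact ⟨fun χ hχ hV => by rw [key χ hχ, h.test χ hχ hV],
    fun χ hχ hV => by rw [key χ hχ, h.fix χ hχ hV], h.comm, fun p _ => commute_proj_proj _ _,
    proj_mul_self _⟩

/-- The wires of register `k`, as a list. -/
def regList (k : Fin (n + 1)) : List (Wire n a F T) := (List.finRange n).map (.data k)

/-- Add the values of polynomials at register `k` to condition wires. -/
def polysCirc (k : Fin (n + 1)) {m : ℕ} (p : Fin m → MvPolynomial (Fin n) (ZMod 2))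
    (j : Fin m → Fin T) : List (WGate (Wire n a F T)) :=
  (List.finRange m).flatMap fun i => polyCirc (j i) (terms k (p i))

/-- Measure whether register `k` passes the verification. -/
def verifyCirc (s : SerialNumber n) (k : Fin (n + 1)) (j j' : Fin s.m → Fin T) :
    List (WGate (Wire n a F T)) :=
  polysCirc k s.p j ++ (hads (regList k) ++ polysCirc k s.q j' ++ hads (regList k))

theorem tests_polysCirc (k : Fin (n + 1)) {m : ℕ} {p : Fin m → MvPolynomial (Fin n) (ZMod 2)}
    (hp : ∀ i, (p i).totalDegree ≤ 3) {j : Fin m → Fin T} (hj : Function.Injective j)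
    {q : (Wire n a F T → ZMod 2) → Prop}
    (hq : ∀ z, (∀ i, MvPolynomial.eval (z ∘ wreg a F T k) (p i) = 0) ↔ q z) :
    Tests (polysCirc k p j) (Set.range j) (proj q) := by
  have h := (tests_conds (List.finRange m) (List.nodup_finRange m) j hj
    fun i => terms (a := a) (F := F) k (p i)).congr_proj (q := q) (fun z hz => by
      rw [← hq]
      simp only [List.mem_finRange, true_imp_iff]
      exact forall_congr' fun i => by rw [polySum_terms k (hp i) hz.2.1])
  refine h.congr rfl ?_ rfl
  ext i
  simp

theorem regList_nodup (k : Fin (n + 1)) : (regList k : List (Wire n a F T)).Nodup :=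
  (List.nodup_finRange n).map (wreg a F T k).injective

theorem mem_regList {k : Fin (n + 1)} {w : Wire n a F T} :
    w ∈ regList k ↔ w ∈ Set.range (wreg a F T k) := by
  simp only [regList, List.mem_map, List.mem_finRange, true_and]
  rfl

/-- The verification as a coherent test. Membership in S and the Hadamard conjugate of membership in
S^⊥ commute, and their product is the projection on |S⟩. -/
theorem tests_verifyCirc {s : SerialNumber n} {S : Submodule (ZMod 2) (Fin n → ZMod 2)}
    (hp : ∀ x, (∀ i, MvPolynomial.eval x (s.p i) = 0) ↔ x ∈ S)
    (hq : ∀ y, (∀ i, MvPolynomial.eval y (s.q i) = 0) ↔ ∀ x ∈ S, x ⬝ᵥ y = 0)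
    (k : Fin (n + 1)) {j j' : Fin s.m → Fin T} (hj : Function.Injective j)
    (hj' : Function.Injective j') (hjj : Disjoint (Set.range j) (Set.range j')) :
    Tests (verifyCirc s k j j') (Set.range j ∪ Set.range j') (subProj (wreg a F T k) S) := by
  have h1 := tests_polysCirc (a := a) (F := F) k s.p_deg hj (q := InS (wreg a F T k) S)
    fun z => hp _
  have h2 := (tests_polysCirc (a := a) (F := F) k s.q_deg hj' (q := InPerp (wreg a F T k) S)
    fun z => hq _).conj_hads (regList_nodup k) (by
      intro w hw
      obtain ⟨i, -, rfl⟩ := List.mem_map.1 hw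
      trivial)
  rw [hads_mul_proj_mul_hads (regList_nodup k) fun i => mem_regList] at h2
  exact h1.append h2 hjj commute_avg_proj.symm

/-- Add the values of wires to condition wires. -/
def zeroCirc {β : Type} (L : List β) (w : β → Wire n a F T) (hw : ∀ b, (w b).IsData)
    (j : β → Fin T) : List (WGate (Wire n a F T)) :=
  L.flatMap fun b => polyCirc (j b) [(⟨w b, by have := hw b; cases h : w b <;> simp_all [Wire.IsSrc, Wire.IsData]⟩,
    ⟨.o2, trivial⟩, ⟨.o2, trivial⟩)]

theorem tests_zeroCirc {β : Type} (L : List β) (hL : L.Nodup) (w : β → Wire n a F T)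
    (hw : ∀ b, (w b).IsData) {j : β → Fin T} (hj : Function.Injective j) :
    Tests (zeroCirc L w hw j) (j '' {b | b ∈ L}) (proj fun z => ∀ b ∈ L, z (w b) = 0) := by
  refine (tests_conds L hL j hj _).congr_proj fun z hz => ?_
  refine forall₂_congr fun b _ => ?_
  simp [polySum, hz.2.1]

end

/-! ### Operators on a set of wires -/

section

variable {ι κ ν : Type} [DecidableEq ι] [Fintype ν]

/-- A property of basis states that does not depend on the wires in `W`. -/
def Off (W : Set ι) (p : (ι → ZMod 2) → Prop) : Prop :=
  ∀ z u : ι → ZMod 2, (∀ w ∉ W, u w = 0) → (p (z + u) ↔ p z)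

/-- An operator that acts on the wires in `W`. -/
structure Acts (W : Set ι) (B : Op ι) : Prop where
  proj : ∀ p, Off W p → Commute B (proj p)
  tr : ∀ u : ι → ZMod 2, (∀ w ∈ W, u w = 0) → Commute B (tr u)

variable {W : Set ι}

theorem off_eq {w : ι} (h : w ∉ W) (b : ZMod 2) : Off W fun z => z w = b := by
  intro z u hu
  simp [hu w h]

theorem Off.forall {β : Type} {p : β → (ι → ZMod 2) → Prop} (h : ∀ b, Off W (p b)) :
    Off W fun z => ∀ b, p b z :=
  fun z u hu => forall_congr' fun b => h b z u hu

theorem Off.imp {q : Prop} {p : (ι → ZMod 2) → Prop} (h : q → Off W p) :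
    Off W fun z => q → p z :=
  fun z u hu => imp_congr_right fun hq => h hq z u hu

theorem Off.and {p q : (ι → ZMod 2) → Prop} (h : Off W p) (h' : Off W q) :
    Off W fun z => p z ∧ q z :=
  fun z u hu => and_congr (h z u hu) (h' z u hu)

theorem Off.indep {p : (ι → ZMod 2) → Prop} (h : Off W p) {w : ι} (hw : w ∈ W) : Indep p w := by
  intro z b
  have : Function.update z w b = z + Pi.single w (z w + b) := by
    funext i
    by_cases hi : i = w
    · subst hi; simp [← add_assoc]
    · simp [hi]
  rw [this]
  refine h z _ fun i hi => Pi.single_eq_of_ne ?_ _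
  rintro rfl
  exact hi hw

theorem Acts.mul {A B : Op ι} (hA : Acts W A) (hB : Acts W B) : Acts W (A * B) :=
  ⟨fun p hp => (hA.proj p hp).mul_left (hB.proj p hp),
    fun u hu => (hA.tr u hu).mul_left (hB.tr u hu)⟩

theorem acts_run {gs : List (WGate ι)} (h : ∀ g ∈ gs, g.wires ⊆ W) : Acts W (run gs) :=
  ⟨fun _ hp => commute_run_proj fun g hg _ hi => hp.indep (h g hg (g.mods_subset hi)),
    fun _ hu => commute_run_tr fun g hg i hi => hu i (h g hg hi)⟩

theorem Acts.invGates {gs : List (WGate ι)} (h : Acts W (run gs)) : Acts W (run (invGates gs)) :=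
  ⟨fun p hp => Commute.invGates (h.proj p hp), fun u hu => Commute.invGates (h.tr u hu)⟩

theorem acts_tr {w : ι} (h : w ∈ W) : Acts W (tr (Pi.single w (1 : ZMod 2))) :=
  ⟨fun p hp => commute_tr_proj fun z => hp z _ fun i hi => Pi.single_eq_of_ne
    (by rintro rfl; exact hi h) _, fun u _ => commute_tr_tr _ _⟩

theorem acts_proj {p : (ι → ZMod 2) → Prop} (h : Off Wᶜ p) : Acts W (proj p) :=
  ⟨fun q _ => commute_proj_proj _ _, fun u hu => (commute_tr_proj fun z => h z u fun w hw =>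
    hu w (by simpa using hw)).symm⟩

theorem acts_proj_eq {w : ι} (h : w ∈ W) (b : ZMod 2) : Acts W (proj fun z => z w = b) :=
  acts_proj (off_eq (by simpa using h) b)

theorem acts_proj_forall {β : Type} {w : β → ι} (h : ∀ b, w b ∈ W) :
    Acts W (proj fun z => ∀ b, z (w b) = 0) :=
  acts_proj (Off.forall fun b => off_eq (by simpa using h b) 0)

theorem indep_eq_of_ne {w w' : ι} (h : w ≠ w') (b : ZMod 2) : Indep (fun z => z w' = b) w := by
  intro z c
  simp [Function.update_of_ne h.symm]

theorem acts_subProj {ρ : ν ↪ ι} (S : Submodule (ZMod 2) (ν → ZMod 2)) (h : ∀ i, ρ i ∈ W) :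
    Acts W (subProj ρ S) :=
  ⟨fun p hp => (commute_proj_subProj fun z v => hp z _ fun w hw =>
    pad_of_notMem (by rintro ⟨i, rfl⟩; exact hw (h i)) v).symm,
    fun u hu => (commute_tr_subProj fun i => hu _ (h i)).symm⟩

theorem Acts.commute_subProj {B : Op ι} (hB : Acts W B) {ρ : ν ↪ ι}
    (S : Submodule (ZMod 2) (ν → ZMod 2)) (h : ∀ i, ρ i ∉ W) : Commute B (subProj ρ S) := by
  refine HiddenSubspace.commute_subProj (fun v => hB.tr _ fun w hw => pad_of_notMem ?_ v)
    (hB.proj _ fun z u hu => ?_)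
  · rintro ⟨i, rfl⟩
    exact h i hw
  · have : (z + u) ∘ ρ = z ∘ ρ := by
      funext i; simp [hu _ (h i)]
    rw [InS, this, InS]

end

/-! ### Amplitude amplification with flags -/

section

variable {ι : Type} [DecidableEq ι] [Fintype ι]

/-- Invariant after `t` rounds: the state is (2ε-1)^t g + φ with g = Ψ - BΨ, where φ lies in the
range of B, has flag `t` set and all later flags zero. The reflection is controlled by flag `t`
being zero, so it spares φ. The next marking sets flag `t + 1` on all of the range of B, including
the older successes, so the newest flag alone records success. -/
theorem amplify_aux {F : ℕ} {f : Fin (F + 1) → ι} (hf : Function.Injective f)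
    {M : Fin (F + 1) → List (WGate ι)} {R : Fin F → List (WGate ι)} {A B : Op ι}
    {G : Submodule ℂ (St ι)}
    (hM : ∀ j, ∀ ψ ∈ G, run (M j) ψ = ψ - B ψ + tr (Pi.single (f j) 1) (B ψ))
    (hR : ∀ j, ∀ ψ ∈ G, run (R j) ψ
      = ψ - (2 : ℂ) • A (proj (fun z => z (f j.castSucc) = 0) ψ))
    (hB : ∀ ψ ∈ G, B ψ ∈ G) (ht : ∀ j, ∀ ψ ∈ G, tr (Pi.single (f j) 1) ψ ∈ G)
    (cB : ∀ j, Commute B (tr (Pi.single (f j) 1)))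
    (cB' : ∀ j, Commute B (proj fun z => z (f j) = 0)) (iB : B * B = B)
    {Ψ : St ι} (hΨ : Ψ ∈ G) (hA : A Ψ = Ψ) {ε : ℝ} (hε : A (B Ψ) = (ε : ℂ) • Ψ)
    (hz : ∀ j, proj (fun z => z (f j) = 0) Ψ = Ψ) (t : ℕ) (h : t ≤ F) :
    ∃ φ ∈ G, B φ = φ ∧ (∀ j : Fin (F + 1), t < (j : ℕ) → proj (fun z => z (f j) = 0) φ = φ) ∧
      proj (fun z => z (f ⟨t, by omega⟩) = 0) φ = 0 ∧
      run (M 0 ++ (List.finRange t).flatMap fun j => R (j.castLE h) ++ M (j.castLE h).succ) Ψ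
        = ((2 * ε - 1 : ℝ) : ℂ) ^ t • (Ψ - B Ψ) + φ := by
  have hBB : ∀ χ, B (B χ) = B χ := fun χ => by rw [← Module.End.mul_apply, iB]
  have flip : ∀ j, ∀ χ : St ι, proj (fun z => z (f j) = 0) χ = χ →
      proj (fun z => z (f j) = 0) (tr (Pi.single (f j) 1) χ) = 0 := by
    intro j χ hχ
    rw [proj_eq_self_iff] at hχ
    funext z
    rw [proj_apply, tr_apply]
    split_ifs with h0
    · exact hχ _ (by simp [h0])
    · rfl
  have keep : ∀ i j, i ≠ j → ∀ χ : St ι, proj (fun z => z (f j) = 0) χ = χ →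
      proj (fun z => z (f j) = 0) (tr (Pi.single (f i) 1) χ) = tr (Pi.single (f i) 1) χ := by
    intro i j hij χ hχ
    refine Commute.fixed (commute_tr_proj fun z => ?_) hχ
    simp [Pi.single_eq_of_ne (hf.ne hij.symm)]
  have hBz : ∀ j, proj (fun z => z (f j) = 0) (B Ψ) = B Ψ := fun j => Commute.fixed (cB' j) (hz j)
  induction t with
  | zero =>
    refine ⟨tr (Pi.single (f 0) 1) (B Ψ), ht 0 _ (hB _ hΨ), ?_, ?_, flip _ _ (hBz _), ?_⟩
    · rw [Commute.apply_eq (cB 0), hBB]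
    · intro j hj
      exact keep 0 j (by rintro rfl; simp at hj) _ (hBz j)
    · simp [hM 0 Ψ hΨ]
  | succ t ih =>
    obtain ⟨φ, hφ, h1, h2, h3, h4⟩ := ih (by omega)
    set g := Ψ - B Ψ with hg
    set i : Fin F := ⟨t, h⟩ with hi
    have hgG : g ∈ G := G.sub_mem hΨ (hB _ hΨ)
    have hBg : B g = 0 := by rw [hg, map_sub, hBB, sub_self]
    have hAg : A g = ((1 - ε : ℝ) : ℂ) • Ψ := by
      rw [hg, map_sub, hA, hε]; push_cast; module
    -- Since Ag = (1-ε)Ψ and Ψ = g + BΨ, reflecting g gives (2ε-1)g - 2(1-ε)BΨ. The second term,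
    -- scaled by (2ε-1)^t, joins the successful part.
    set ζ := φ - (2 * (1 - ε) * (2 * ε - 1) ^ t : ℂ) • B Ψ with hζ
    have hζG : ζ ∈ G := G.sub_mem hφ (G.smul_mem _ (hB _ hΨ))
    have hBζ : B ζ = ζ := by rw [hζ, map_sub, map_smul, hBB, h1]
    have hζz : ∀ j : Fin (F + 1), t < (j : ℕ) → proj (fun z => z (f j) = 0) ζ = ζ := by
      intro j hj
      rw [hζ, map_sub, map_smul, hBz, h2 j hj]
    refine ⟨tr (Pi.single (f i.succ) 1) ζ, ht _ _ hζG, ?_, ?_,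
      flip i.succ _ (hζz _ (by simp [hi])), ?_⟩
    · rw [Commute.apply_eq (cB _), hBζ]
    · intro j hj
      exact keep _ j (by rintro rfl; simp [hi] at hj) _ (hζz j (by omega))
    · rw [List.finRange_succ_last, List.flatMap_append, List.flatMap_map, List.flatMap_singleton,
        ← List.append_assoc, run_append, Module.End.mul_apply]
      have e : (List.finRange t).flatMap (fun j => R (Fin.castLE h j.castSucc) ++
          M (Fin.castLE h j.castSucc).succ) = (List.finRange t).flatMap fun j =>
          R (j.castLE (by omega)) ++ M (j.castLE (by omega)).succ := rfl
      have e' : Fin.castLE h (Fin.last t) = i := rfl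
      rw [e, h4, e', run_append, Module.End.mul_apply]
      set c : ℂ := ((2 * ε - 1 : ℝ) : ℂ) ^ t with hc
      have hψ : c • g + φ ∈ G := G.add_mem (G.smul_mem _ hgG) hφ
      have hgz : ∀ j, proj (fun z => z (f j) = 0) g = g := fun j => by
        rw [hg, map_sub, hBz, hz]
      have e2 : (f i.castSucc) = f ⟨t, by omega⟩ := rfl
      have hc' : c = (2 * ε - 1 : ℂ) ^ t := by rw [hc]; push_cast; rfl
      have e3 : run (R i) (c • g + φ) = ((2 * ε - 1 : ℝ) : ℂ) ^ (t + 1) • g + ζ := by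
        rw [hR i _ hψ, map_add, e2, h3, add_zero, map_smul, hgz, map_smul, hAg, hζ, hg, pow_succ,
          ← hc', ← hc]
        push_cast
        module
      rw [e3, hM _ _ (G.add_mem (G.smul_mem _ hgG) hζG), map_add, map_smul, hBg, hBζ, smul_zero,
        zero_add]
      abel

/-- The circuit preserves the norm and the last flag separates the two parts, so the norm of the
successful part is what the explicit failing part leaves over. -/
theorem amplify {F : ℕ} {f : Fin (F + 1) → ι} (hf : Function.Injective f)
    {M : Fin (F + 1) → List (WGate ι)} {R : Fin F → List (WGate ι)} {A B : Op ι}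
    {G : Submodule ℂ (St ι)}
    (hM : ∀ j, ∀ ψ ∈ G, run (M j) ψ = ψ - B ψ + tr (Pi.single (f j) 1) (B ψ))
    (hR : ∀ j, ∀ ψ ∈ G, run (R j) ψ
      = ψ - (2 : ℂ) • A (proj (fun z => z (f j.castSucc) = 0) ψ))
    (hB : ∀ ψ ∈ G, B ψ ∈ G) (ht : ∀ j, ∀ ψ ∈ G, tr (Pi.single (f j) 1) ψ ∈ G)
    (cB : ∀ j, Commute B (tr (Pi.single (f j) 1)))
    (cB' : ∀ j, Commute B (proj fun z => z (f j) = 0)) (iB : B * B = B)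
    (sA : SelfAdj A) (sB : SelfAdj B)
    {Ψ : St ι} (hΨ : Ψ ∈ G) (hA : A Ψ = Ψ) {ε : ℝ} (hε : A (B Ψ) = (ε : ℂ) • Ψ)
    (hz : ∀ j, proj (fun z => z (f j) = 0) Ψ = Ψ) :
    ∃ φ ∈ G, B φ = φ ∧ nrm φ = (1 - (1 - ε) * (2 * ε - 1) ^ (2 * F)) * nrm Ψ ∧
      proj (fun z => z (f (Fin.last F)) = 1)
        (run (M 0 ++ (List.finRange F).flatMap fun j => R j ++ M j.succ) Ψ) = φ := by
  obtain ⟨φ, hφ, h1, -, h3, h4⟩ := amplify_aux hf hM hR hB ht cB cB' iB hΨ hA hε hz F le_rfl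
  simp only [Fin.castLE_rfl, id_eq] at h4
  set g := Ψ - B Ψ with hg
  have hgz : proj (fun z => z (f (Fin.last F)) = 0) g = g := by
    rw [hg, map_sub, Commute.fixed (cB' _) (hz _), hz]
  have h3' : ∀ z, z (f (Fin.last F)) = 0 → φ z = 0 := by
    intro z h0
    have := congrFun h3 z
    rw [proj_apply] at this
    exact (if_pos h0).symm.trans this
  have e1 : proj (fun z => z (f (Fin.last F)) = 1) (run (M 0 ++ (List.finRange F).flatMap
      fun j => R j ++ M j.succ) Ψ) = φ := by
    rw [h4]
    rw [proj_eq_self_iff] at hgz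
    funext z
    rw [proj_apply, Pi.add_apply, Pi.smul_apply]
    rcases zmod2_cases (z (f (Fin.last F))) with h0 | h0
    · simp [h0, h3' z h0]
    · simp [h0, hgz z (by simp [h0])]
  have e2 : proj (fun z => ¬ z (f (Fin.last F)) = 1) (run (M 0 ++ (List.finRange F).flatMap
      fun j => R j ++ M j.succ) Ψ) = ((2 * ε - 1 : ℝ) : ℂ) ^ F • g := by
    rw [h4]
    rw [proj_eq_self_iff] at hgz
    funext z
    rw [proj_apply, Pi.add_apply, Pi.smul_apply]
    rcases zmod2_cases (z (f (Fin.last F))) with h0 | h0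
    · simp [h0, h3' z h0]
    · simp [h0, hgz z (by simp [h0])]
  refine ⟨φ, hφ, h1, ?_, e1⟩
  have h5 := nrm_proj_add (fun z => z (f (Fin.last F)) = 1) (run (M 0 ++
    (List.finRange F).flatMap fun j => R j ++ M j.succ) Ψ)
  -- By self-adjointness ‖BΨ‖² = ⟨Ψ, BΨ⟩ = ⟨AΨ, BΨ⟩ = ⟨Ψ, ABΨ⟩ = ε‖Ψ‖².
  have h6 : (nrm (B Ψ) : ℂ) = ε * nrm Ψ := by
    rw [sB.nrm_apply iB, ← ip_self, ← ip_smul_right, ← hε, ← sA, hA]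
  have h6' : nrm (B Ψ) = ε * nrm Ψ := by exact_mod_cast h6
  rw [e1, e2, nrm_smul, nrm_run, hg, sB.nrm_compl iB, h6', norm_pow, Complex.norm_real,
    Real.norm_eq_abs, ← pow_mul, mul_comm F 2, pow_mul |2 * ε - 1|, sq_abs, ← pow_mul] at h5
  linear_combination h5

end

/-! ### The counterfeiter on its own wires -/

section

variable {w n a : ℕ}

theorem wire_injective (a : ℕ) (b : Fin w) : Function.Injective (wire (n := n) a b) := by
  intro i j h
  have := finProdFinEquiv.injective (Fin.castAdd_injective _ _ h)
  simpa using this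

/-- The wires of register `b`. -/
def wireEmb (n a : ℕ) (b : Fin w) : Fin n ↪ Fin (w * n + a) := ⟨wire a b, wire_injective a b⟩

theorem wire_ne {b b' : Fin w} (h : b ≠ b') (i j : Fin n) : wire a b i ≠ wire a b' j := by
  intro h'
  have := finProdFinEquiv.injective (Fin.castAdd_injective _ _ h')
  simp at this
  exact h this.1

/-- Verification uses only the zero sets of the polynomials, and these are S and S^⊥. -/
theorem verify_eq {s : SerialNumber n} {S : Submodule (ZMod 2) (Fin n → ZMod 2)}
    (hp : ∀ x, (∀ i, MvPolynomial.eval x (s.p i) = 0) ↔ x ∈ S)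
    (hq : ∀ y, (∀ i, MvPolynomial.eval y (s.q i) = 0) ↔ ∀ x ∈ S, x ⬝ᵥ y = 0)
    (b : Fin w) (ψ : QState (w * n + a)) : verify s b ψ = subProj (wireEmb n a b) S ψ := by
  set l : List (Fin (w * n + a)) := (List.finRange n).map (wire a b) with hl
  have hH : ∀ χ : QState (w * n + a), hadamardReg b χ = run (hads l) χ := by
    intro χ
    rw [hl, hadamardReg]
    generalize List.finRange n = l'
    induction l' generalizing χ with
    | nil => rfl
    | cons i l' ih => rw [List.foldl_cons, ih]; rfl
  have h1 : ∀ χ : QState (w * n + a), checkZero s.p b χ = proj (InS (wireEmb n a b) S) χ := by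
    intro χ
    funext z
    classical exact if_congr (hp _) rfl rfl
  have h2 : ∀ χ : QState (w * n + a), checkZero s.q b χ = proj (InPerp (wireEmb n a b) S) χ := by
    intro χ
    funext z
    classical exact if_congr (hq _) rfl rfl
  rw [verify, hH, hH, h1, h2, subProj, ← hads_mul_proj_mul_hads (l := l)]
  · rfl
  · exact (List.nodup_finRange n).map (wire_injective a b)
  · intro i
    simp only [hl, List.mem_map, List.mem_finRange, true_and]
    rfl

/-- All qubits after the first `n` are zero. -/
def RestZero (n : ℕ) {N : ℕ} (x : Fin N → ZMod 2) : Prop := ∀ k : Fin N, n ≤ (k : ℕ) → x k = 0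

variable (S : Submodule (ZMod 2) (Fin n → ZMod 2))

theorem wire_zero_val (i : Fin n) : (wire (w := 2) a 0 i : ℕ) = i := by
  simp [wire]

theorem eq_pad_of_restZero {x : Fin (2 * n + a) → ZMod 2} (h : RestZero n x) :
    x = pad (wireEmb n a 0) (reg x 0) := by
  funext k
  by_cases hk : k ∈ Set.range (wireEmb n a (0 : Fin 2))
  · obtain ⟨i, rfl⟩ := hk
    rw [pad_apply]
    rfl
  · rw [pad_of_notMem hk]
    refine h k ?_
    by_contra hlt
    exact hk ⟨⟨k, by omega⟩, Fin.ext (wire_zero_val _)⟩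

theorem restZero_pad (v : Fin n → ZMod 2) : RestZero n (pad (wireEmb n a (0 : Fin 2)) v) := by
  intro k hk
  refine pad_of_notMem ?_ v
  rintro ⟨i, rfl⟩
  have := wire_zero_val (a := a) i
  simp only [wireEmb, Function.Embedding.coeFn_mk] at hk
  omega

theorem reg_pad (v : Fin n → ZMod 2) : reg (pad (wireEmb n a (0 : Fin 2)) v) 0 = v := by
  funext i
  exact pad_apply (wireEmb n a 0) v i

theorem restZero_add_pad (z : Fin (2 * n + a) → ZMod 2) (v : Fin n → ZMod 2) :
    RestZero n (z + pad (wireEmb n a (0 : Fin 2)) v) ↔ RestZero n z := by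
  refine forall₂_congr fun k hk => ?_
  rw [Pi.add_apply, restZero_pad v k hk, add_zero]

open Classical in
theorem counterfeitInput_apply (x : Fin (2 * n + a) → ZMod 2) :
    counterfeitInput S x = if RestZero n x ∧ InS (wireEmb n a 0) S x then
      ((1 / Real.sqrt (Nat.card S) : ℝ) : ℂ) else 0 := by
  rw [counterfeitInput, subspaceState, ite_and]
  exact if_congr Iff.rfl rfl rfl

/-- The projection on the input state of a counterfeiter. -/
def inputProj (a : ℕ) : Op (Fin (2 * n + a)) := proj (RestZero n) * subProj (wireEmb n a 0) S

theorem commute_restZero_subProj : Commute (proj (RestZero n))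
    (subProj (wireEmb n a (0 : Fin 2)) S) := commute_proj_subProj restZero_add_pad

theorem inputProj_input : inputProj S a (counterfeitInput S) = counterfeitInput S := by
  classical
  funext z
  rw [inputProj, Module.End.mul_apply, proj_apply, subProj_apply]
  have h : ∀ v ∈ elems S, counterfeitInput S (z + pad (wireEmb n a 0) v)
      = counterfeitInput S z := by
    intro v hv
    rw [counterfeitInput_apply, counterfeitInput_apply]
    exact if_congr (and_congr (restZero_add_pad z v) (inS_add (mem_elems.1 hv) z)) rfl rfl
  rw [Finset.sum_congr rfl h, Finset.sum_const, nsmul_eq_mul, ← mul_assoc,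
    inv_mul_cancel₀ (card_elems_ne_zero S), one_mul]
  by_cases h1 : RestZero n z
  · by_cases h2 : InS (wireEmb n a 0) S z
    · rw [if_pos h1, if_pos h2]
    · rw [if_pos h1, if_neg h2, counterfeitInput_apply, if_neg fun h => h2 h.2]
  · rw [if_neg h1, counterfeitInput_apply, if_neg fun h => h1 h.1]

/-- The range of `inputProj` is a line: its states are supported on S in register 0 with zeros
elsewhere and are invariant under translation by S, so the amplitude at 0 determines them. -/
theorem eq_smul_input {χ : St (Fin (2 * n + a))} (h : inputProj S a χ = χ) :
    ∃ c : ℂ, χ = c • counterfeitInput S := by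
  classical
  have hs : ((1 / Real.sqrt (Nat.card S) : ℝ) : ℂ) ≠ 0 := by
    have : (0 : ℝ) < Nat.card S := by exact_mod_cast Nat.card_pos
    have := Real.sqrt_pos.2 this
    exact_mod_cast (one_div_pos.2 this).ne'
  refine ⟨χ 0 / ((1 / Real.sqrt (Nat.card S) : ℝ) : ℂ), ?_⟩
  have h1 : proj (RestZero n) χ = χ := by
    rw [← h, inputProj, ← Module.End.mul_apply, ← mul_assoc, proj_mul_self]
  have h2 : subProj (wireEmb n a 0) S χ = χ := by
    rw [← h, inputProj, (commute_restZero_subProj S).eq, ← Module.End.mul_apply, ← mul_assoc,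
      subProj_mul_self]
  have h3 : proj (InS (wireEmb n a 0) S) χ = χ := by
    rw [← h2, ← Module.End.mul_apply, proj_mul_subProj]
  have h4 : ∀ v ∈ S, ∀ z, χ (z + pad (wireEmb n a 0) v) = χ z := by
    intro v hv z
    conv_rhs => rw [← h2, ← tr_mul_subProj hv, Module.End.mul_apply, h2]
    rfl
  funext z
  rw [Pi.smul_apply, counterfeitInput_apply, smul_eq_mul]
  split_ifs with hz
  · rw [div_mul_cancel₀ _ hs, ← h4 _ hz.2 0, zero_add]
    conv_lhs => rw [eq_pad_of_restZero hz.1]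
    rfl
  · rw [mul_zero]
    by_cases h5 : RestZero n z
    · exact proj_eq_self_iff.1 h3 z fun h6 => hz ⟨h5, h6⟩
    · exact proj_eq_self_iff.1 h1 z h5

theorem nrm_input : nrm (counterfeitInput (a := a) S) = 1 := by
  classical
  have hc : (0 : ℝ) < (elems S).card := by
    exact_mod_cast Finset.card_pos.2 ⟨0, by simp⟩
  have h : ∀ x : Fin (2 * n + a) → ZMod 2, ‖counterfeitInput S x‖ ^ 2
      = if RestZero n x ∧ InS (wireEmb n a 0) S x then ((elems S).card : ℝ)⁻¹ else 0 := by
    intro x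
    rw [counterfeitInput_apply]
    split_ifs
    · rw [Complex.norm_real, Real.norm_eq_abs, sq_abs, div_pow, one_pow, Real.sq_sqrt (by positivity),
        card_elems, one_div]
    · simp
  rw [nrm, Finset.sum_congr rfl fun x _ => h x, ← Finset.sum_filter]
  have h2 : (Finset.univ.filter fun x : Fin (2 * n + a) → ZMod 2 =>
      RestZero n x ∧ InS (wireEmb n a 0) S x) = (elems S).image (pad (wireEmb n a 0)) := by
    ext x
    simp only [Finset.mem_filter, Finset.mem_univ, true_and, Finset.mem_image, mem_elems]
    constructor
    · rintro ⟨h1, h2⟩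
      exact ⟨_, h2, (eq_pad_of_restZero h1).symm⟩
    · rintro ⟨v, hv, rfl⟩
      refine ⟨restZero_pad v, ?_⟩
      rwa [InS, pad_comp]
  rw [Finset.sum_const, h2, Finset.card_image_of_injective, nsmul_eq_mul, mul_inv_cancel₀ hc.ne']
  intro u v huv
  rw [← reg_pad (a := a) u, huv, reg_pad]

/-- The projection measured by the verification after the circuit `gs`. -/
def afterProj {ι ν : Type} [DecidableEq ι] [Fintype ν] (gs : List (WGate ι)) (ρ ρ' : ν ↪ ι)
    (S : Submodule (ZMod 2) (ν → ZMod 2)) : Op ι :=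
  run (invGates gs) * (subProj ρ' S * subProj ρ S) * run gs

theorem afterProj_mul_self {ι ν : Type} [DecidableEq ι] [Fintype ν] (gs : List (WGate ι))
    {ρ ρ' : ν ↪ ι} (S : Submodule (ZMod 2) (ν → ZMod 2))
    (h : Disjoint (Set.range ρ) (Set.range ρ')) :
    afterProj gs ρ ρ' S * afterProj gs ρ ρ' S = afterProj gs ρ ρ' S := by
  have e : subProj ρ' S * subProj ρ S * (subProj ρ' S * subProj ρ S)
      = subProj ρ' S * subProj ρ S := by
    rw [mul_assoc, ← mul_assoc (subProj ρ S), (commute_subProj_subProj h).eq,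
      mul_assoc (subProj ρ' S), subProj_mul_self, ← mul_assoc, subProj_mul_self]
  calc _ = run (invGates gs) * (subProj ρ' S * subProj ρ S) * (run gs * run (invGates gs)) *
        (subProj ρ' S * subProj ρ S) * run gs := by simp only [afterProj, mul_assoc]
    _ = _ := by rw [run_mul_invGates, mul_one, mul_assoc (run (invGates gs)), e, afterProj]

theorem selfAdj_afterProj {ι ν : Type} [DecidableEq ι] [Fintype ι] [Fintype ν]
    (gs : List (WGate ι)) {ρ ρ' : ν ↪ ι} (S : Submodule (ZMod 2) (ν → ZMod 2))
    (h : Disjoint (Set.range ρ) (Set.range ρ')) : SelfAdj (afterProj gs ρ ρ' S) :=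
  (selfAdj_subProj.mul selfAdj_subProj (commute_subProj_subProj h.symm)).conj gs

theorem selfAdj_inputProj : SelfAdj (inputProj S a) :=
  (selfAdj_proj _).mul selfAdj_subProj (commute_restZero_subProj S)

theorem disjoint_wireEmb : Disjoint (Set.range (wireEmb n a (0 : Fin 2)))
    (Set.range (wireEmb n a (1 : Fin 2))) := by
  rw [Set.disjoint_left]
  rintro _ ⟨i, rfl⟩ ⟨j, hj⟩
  exact wire_ne (by simp) j i hj

/-- For a projection A of rank one on a unit vector v, ABA = ⟨v, Bv⟩A, and here ⟨v, Bv⟩ is the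
probability that both registers are accepted. This provides the hypothesis ABΨ = εΨ of `amplify`. -/
theorem inputProj_afterProj (gs : List (WGate (Fin (2 * n + a)))) {χ : St (Fin (2 * n + a))}
    (h : inputProj S a χ = χ) :
    inputProj S a (afterProj gs (wireEmb n a 0) (wireEmb n a 1) S χ) =
      (nrm (subProj (wireEmb n a 1) S (subProj (wireEmb n a 0) S
        (run gs (counterfeitInput S)))) : ℂ) • χ := by
  set B := afterProj gs (wireEmb n a 0) (wireEmb n a 1) S with hB
  have hI := inputProj_input S (a := a)
  have iI : inputProj S a * inputProj S a = inputProj S a := by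
    have e1 := commute_restZero_subProj S (a := a)
    calc _ = proj (RestZero n) * (subProj (wireEmb n a 0) S * proj (RestZero n)) *
          subProj (wireEmb n a 0) S := by simp only [inputProj, mul_assoc]
      _ = (proj (RestZero n) * proj (RestZero n)) * (subProj (wireEmb n a 0) S *
          subProj (wireEmb n a 0) S) := by rw [← e1.eq]; simp only [mul_assoc]
      _ = _ := by rw [proj_mul_self, subProj_mul_self]; rfl
  obtain ⟨c', hc'⟩ := eq_smul_input S (χ := inputProj S a (B (counterfeitInput S)))
    (by rw [← Module.End.mul_apply, iI])
  -- Pairing with the unit input vector recovers the coefficient; for a projection B the resulting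
  -- expectation is ‖Bv‖².
  have h1 : c' = nrm (B (counterfeitInput (a := a) S)) := by
    rw [(selfAdj_afterProj gs S disjoint_wireEmb).nrm_apply
      (afterProj_mul_self gs S disjoint_wireEmb)]
    nth_rewrite 1 [← hI]
    rw [selfAdj_inputProj S, ← hB, hc', ip_smul_right, ip_self, nrm_input]
    simp
  have h2 : nrm (B (counterfeitInput (a := a) S)) = nrm (subProj (wireEmb n a 1) S
      (subProj (wireEmb n a 0) S (run gs (counterfeitInput S)))) := by
    rw [hB, afterProj, Module.End.mul_apply, Module.End.mul_apply, nrm_run]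
    rfl
  obtain ⟨c, rfl⟩ := eq_smul_input S h
  rw [map_smul, map_smul, hc', h1, h2, smul_comm]

end

/-! ### The stages of the basis finder -/

theorem invGates_map {ι κ : Type} (e : ι ↪ κ) (gs : List (WGate ι)) :
    invGates (gs.map (WGate.map e)) = (invGates gs).map (WGate.map e) := by
  simp only [invGates, ← List.map_reverse, List.flatMap_map, List.map_flatMap]
  congr 1
  funext g
  cases g <;> rfl

theorem wires_invGates {ι : Type} {gs : List (WGate ι)} {W : Set ι}
    (h : ∀ g ∈ gs, g.wires ⊆ W) : ∀ g ∈ invGates gs, g.wires ⊆ W := by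
  intro g hg
  simp only [invGates, List.mem_flatMap, List.mem_reverse] at hg
  obtain ⟨g', hg', hg⟩ := hg
  refine (Eq.subset ?_).trans (h g' hg')
  cases g' <;> simp [WGate.inv] at hg <;> rw [hg]

theorem wires_append {ι : Type} {gs hs : List (WGate ι)} {W : Set ι}
    (h : ∀ g ∈ gs, g.wires ⊆ W) (h' : ∀ g ∈ hs, g.wires ⊆ W) :
    ∀ g ∈ gs ++ hs, g.wires ⊆ W := fun g hg => (List.mem_append.1 hg).elim (h g) (h' g)

theorem wires_flatMap {ι β : Type} {l : List β} {f : β → List (WGate ι)} {W : Set ι}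
    (h : ∀ b ∈ l, ∀ g ∈ f b, g.wires ⊆ W) : ∀ g ∈ l.flatMap f, g.wires ⊆ W := by
  intro g hg
  obtain ⟨b, hb, hg⟩ := List.mem_flatMap.1 hg
  exact h b hb g hg

section

variable {n a F T : ℕ}

/-- The wires for constants, scratch, conditions and conjunctions. -/
def Wire.IsAux : Wire n a F T → Prop
  | data _ _ => False
  | anc _ _ => False
  | flag _ _ => False
  | mi => False
  | _ => True

theorem wires_polyCirc {j : Fin T} {l : List (Src n a F T × Src n a F T × Src n a F T)}
    {W : Set (Wire n a F T)} (hW : ∀ w, w.IsAux → w ∈ W)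
    (h : ∀ t ∈ l, t.1.1 ∈ W ∧ t.2.1.1 ∈ W ∧ t.2.2.1 ∈ W) :
    ∀ g ∈ polyCirc j l, g.wires ⊆ W := by
  refine wires_flatMap fun t ht g hg => ?_
  obtain ⟨h1, h2, h3⟩ := h t ht
  have o1 := hW .o1 trivial
  have hs := hW .s trivial
  have hA := hW .A trivial
  have hB := hW .B trivial
  have hC := hW .C trivial
  have hv := hW (.v j) trivial
  simp only [mono, List.mem_cons, List.not_mem_nil, or_false] at hg
  rcases hg with rfl | rfl | rfl | rfl | rfl | rfl | rfl | rfl | rfl <;>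
    simp [WGate.wires, Set.insert_subset_iff, *]

theorem wires_chain' {W : Set (Wire n a F T)} (hW : ∀ w, w.IsAux → w ∈ W) :
    ∀ g ∈ (chain T : List (WGate (Wire n a F T))), g.wires ⊆ W := by
  intro g hg w hw
  rcases wires_chain hg hw with rfl | rfl | ⟨j, rfl⟩ | ⟨j, rfl⟩ <;> exact hW _ trivial

theorem wires_toggle {gs : List (WGate (Wire n a F T))} {t : Wire n a F T}
    {h1 : .c (Fin.last T) ≠ t} {h2 : .o1 ≠ t} {W : Set (Wire n a F T)}
    (hW : ∀ w, w.IsAux → w ∈ W) (h : ∀ g ∈ gs, g.wires ⊆ W) (ht : t ∈ W) :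
    ∀ g ∈ toggle gs t h1 h2, g.wires ⊆ W := by
  have h3 := wires_append h (wires_chain' hW)
  refine wires_append (wires_append h3 ?_) (wires_invGates h3)
  intro g hg
  rw [List.mem_singleton] at hg
  subst hg
  have o1 := hW .o1 trivial
  have hc := hW (.c (Fin.last T)) trivial
  simp [WGate.wires, Set.insert_subset_iff, *]

theorem wires_polysCirc {k : Fin (n + 1)} {m : ℕ} {p : Fin m → MvPolynomial (Fin n) (ZMod 2)}
    {j : Fin m → Fin T} {W : Set (Wire n a F T)} (hW : ∀ w, w.IsAux → w ∈ W)
    (h : ∀ i, .data k i ∈ W) : ∀ g ∈ polysCirc k p j, g.wires ⊆ W := by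
  refine wires_flatMap fun i _ => wires_polyCirc hW fun t ht => ?_
  have hs : ∀ x, (srcOf (a := a) (F := F) (T := T) k x).1 ∈ W := by
    intro x
    refine Fin.cases ?_ (fun i => ?_) x
    · exact hW .o2 trivial
    · exact h i
  simp only [terms, List.mem_flatMap] at ht
  obtain ⟨u, -, v, -, w, -, ht⟩ := ht
  split_ifs at ht
  · rw [List.mem_singleton] at ht
    subst ht
    exact ⟨hs u, hs v, hs w⟩
  · simp at ht

theorem wires_verifyCirc {s : SerialNumber n} {k : Fin (n + 1)} {j j' : Fin s.m → Fin T}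
    {W : Set (Wire n a F T)} (hW : ∀ w, w.IsAux → w ∈ W) (h : ∀ i, .data k i ∈ W) :
    ∀ g ∈ verifyCirc s k j j', g.wires ⊆ W := by
  have h1 : ∀ g ∈ hads (regList k : List (Wire n a F T)), g.wires ⊆ W := by
    intro g hg
    simp only [hads, regList, List.mem_map] at hg
    obtain ⟨_, ⟨i, -, rfl⟩, rfl⟩ := hg
    simpa [WGate.wires] using h i
  exact wires_append (wires_polysCirc hW h)
    (wires_append (wires_append h1 (wires_polysCirc hW h)) h1)

theorem wires_zeroCirc {β : Type} {L : List β} {w : β → Wire n a F T} {hw : ∀ b, (w b).IsData}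
    {j : β → Fin T} {W : Set (Wire n a F T)} (hW : ∀ w, w.IsAux → w ∈ W) (h : ∀ b, w b ∈ W) :
    ∀ g ∈ zeroCirc L w hw j, g.wires ⊆ W := by
  refine wires_flatMap fun i _ => wires_polyCirc hW fun t ht => ?_
  rw [List.mem_singleton] at ht
  subst ht
  exact ⟨h i, hW .o2 trivial, hW .o2 trivial⟩

/-- The wires that may be changed before stage `D`, with `r` registers being completed. -/
def Wire.Free (D r : ℕ) : Wire n a F T → Prop
  | data b _ => r ≤ b ∧ b ≤ D
  | anc b _ => b < D
  | flag b _ => b ≤ D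
  | _ => False

/-- The operators that fix the states before stage `D` if `r` registers are completed. -/
inductive InvOp (S : Submodule (ZMod 2) (Fin n → ZMod 2)) (D r : ℕ) : Op (Wire n a F T) → Prop
  | clean : InvOp S D r (proj Clean)
  | vzero : InvOp S D r (proj (VZero Set.univ))
  | mi : InvOp S D r (-tr (Pi.single .mi 1))
  | data (b : Fin (n + 1)) (i : Fin n) (h : D < b) : InvOp S D r (proj fun z => z (.data b i) = 0)
  | anc (b : Fin n) (j : Fin a) (h : D ≤ b) : InvOp S D r (proj fun z => z (.anc b j) = 0)
  | flag (b : Fin (n + 1)) (j : Fin (F + 1)) (h : D < b) :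
      InvOp S D r (proj fun z => z (.flag b j) = 0)
  | sub (b : Fin (n + 1)) (h : b < r) : InvOp S D r (subProj (wreg a F T b) S)

variable (a F T) in
/-- The states before stage `D` if `r` registers are completed. -/
def Inv (S : Submodule (ZMod 2) (Fin n → ZMod 2)) (D r : ℕ) : Submodule ℂ (WSt n a F T) where
  carrier := {ψ | ∀ A, InvOp S D r A → A ψ = ψ}
  add_mem' h h' A hA := by rw [map_add, h A hA, h' A hA]
  zero_mem' A _ := map_zero A
  smul_mem' c ψ h A hA := by rw [map_smul, h A hA]

variable {S : Submodule (ZMod 2) (Fin n → ZMod 2)} {D r : ℕ}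

theorem Inv.mono {D' r' : ℕ} (hD : D ≤ D') (hr : r' ≤ r) : Inv a F T S D r ≤ Inv a F T S D' r' := by
  intro ψ h A hA
  refine h A ?_
  cases hA with
  | clean => exact .clean
  | vzero => exact .vzero
  | mi => exact .mi
  | data b i hb => exact .data b i (hD.trans_lt hb)
  | anc b i hb => exact .anc b i (hD.trans hb)
  | flag b i hb => exact .flag b i (hD.trans_lt hb)
  | sub b hb => exact .sub b (hb.trans_le hr)

/-- The wires that may be changed before stage `D`, with `r` registers being completed. -/
abbrev freeSet (n a F T D r : ℕ) : Set (Wire n a F T) := {w | w.Free D r}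

theorem off_clean : Off (freeSet n a F T D r) Clean := by
  refine Off.and (off_eq ?_ _) (Off.and (off_eq ?_ _) (Off.and (off_eq ?_ _)
    (Off.and (off_eq ?_ _) (Off.and (off_eq ?_ _) (Off.and (off_eq ?_ _)
    (Off.and (off_eq ?_ _) (Off.forall fun j => off_eq ?_ _)))))))
  all_goals exact id

theorem off_vzero (V : Set (Fin T)) : Off (freeSet n a F T D r) (VZero V) :=
  Off.forall fun _ => Off.imp fun _ => off_eq id _

/-- Every operator defining `Inv` leaves the free wires alone, or is the flip of `mi`, which is not
free either. Operators on the free wires therefore preserve `Inv`. -/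
theorem acts_commute_invOp {A B : Op (Wire n a F T)} (hB : Acts (freeSet n a F T D r) B)
    (hA : InvOp S D r A) : Commute B A := by
  cases hA with
  | clean => exact hB.proj _ off_clean
  | vzero => exact hB.proj _ (off_vzero _)
  | mi =>
    have h : Commute B (tr (Pi.single (Wire.mi : Wire n a F T) 1)) := hB.tr _ fun w hw =>
      Pi.single_eq_of_ne (by rintro rfl; exact hw) 1
    exact Commute.neg_right h
  | data b i hb => exact hB.proj _ (off_eq (fun h => absurd h.2 (by omega)) _)
  | anc b i hb => exact hB.proj _ (off_eq (W := freeSet n a F T D r)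
      (fun h : Wire.Free (F := F) (T := T) D r (.anc b i) => not_lt.2 hb h) _)
  | flag b i hb => exact hB.proj _ (off_eq (W := freeSet n a F T D r)
      (fun h : Wire.Free (a := a) (T := T) D r (.flag b i) => not_le.2 hb h) _)
  | sub b hb => exact hB.commute_subProj S fun i (h : _ ∧ _) => absurd h.1 (by omega)

theorem Inv.map {B : Op (Wire n a F T)} (hB : Acts (freeSet n a F T D r) B) {ψ : WSt n a F T}
    (h : ψ ∈ Inv a F T S D r) : B ψ ∈ Inv a F T S D r :=
  fun A hA => Commute.fixed (acts_commute_invOp hB hA) (h A hA)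

theorem Inv.tr_mi {ψ : WSt n a F T} (h : ψ ∈ Inv a F T S D r) :
    tr (Pi.single .mi 1) ψ = -ψ := by
  have := h _ .mi
  rw [LinearMap.neg_apply, neg_eq_iff_eq_neg] at this
  exact this

/-- Toggle the flag `f` on the range of a projection. -/
theorem run_toggle_flag {gs : List (WGate (Wire n a F T))} {V : Set (Fin T)}
    {P : Op (Wire n a F T)} (h : Tests gs V P) (k : Fin (n + 1)) (j : Fin (F + 1)) {h1 h2}
    (hgs : ∀ g ∈ gs, g.wires ⊆ {.flag k j}ᶜ) {ψ : WSt n a F T} (hψ : ψ ∈ Inv a F T S D r) :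
    run (toggle gs (.flag k j) h1 h2) ψ = ψ - P ψ + tr (Pi.single (.flag k j) 1) (P ψ) :=
  run_toggle h _ h1 h2 (fun g hg hw => hgs g hg hw rfl) (fun g hg hw => by
    rcases wires_chain hg hw with h | h | ⟨_, h⟩ | ⟨_, h⟩ <;> cases h) (hψ _ .clean) (hψ _ .vzero)

/-- Reflect the range of a projection. -/
theorem run_toggle_mi {gs : List (WGate (Wire n a F T))} {V : Set (Fin T)}
    {P : Op (Wire n a F T)} (h : Tests gs V P) {h1 h2}
    (hgs : ∀ g ∈ gs, g.wires ⊆ {.mi}ᶜ) (hP : Acts (freeSet n a F T D r) P)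
    {ψ : WSt n a F T} (hψ : ψ ∈ Inv a F T S D r) :
    run (toggle gs .mi h1 h2) ψ = ψ - (2 : ℂ) • P ψ := by
  rw [run_toggle h _ h1 h2 (fun g hg hw => hgs g hg hw rfl) (fun g hg hw => by
    rcases wires_chain hg hw with h | h | ⟨_, h⟩ | ⟨_, h⟩ <;> cases h) (hψ _ .clean)
    (hψ _ .vzero), Inv.tr_mi (Inv.map hP hψ)]
  module

end

/-! ### The circuits -/

section

variable {n : ℕ}

/-- The number of condition wires. -/
abbrev nCond (n a m : ℕ) : ℕ := 4 * m + n + a + 1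

/-- The condition wires for polynomials. -/
def condPoly (n a m : ℕ) (c : Fin 4) (i : Fin m) : Fin (nCond n a m) :=
  ⟨c * m + i, by have := (finProdFinEquiv (c, i)).isLt; simp [finProdFinEquiv] at this; grind⟩

/-- The condition wires for registers. -/
def condReg (n a m : ℕ) (i : Fin n) : Fin (nCond n a m) := ⟨4 * m + i, by grind⟩

/-- The condition wires for ancillas. -/
def condAnc (n a m : ℕ) (j : Fin a) : Fin (nCond n a m) := ⟨4 * m + n + j, by grind⟩

/-- The condition wire for flags. -/
def condFlag (n a m : ℕ) (_ : Unit) : Fin (nCond n a m) := ⟨4 * m + n + a, by grind⟩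

variable (a F : ℕ) (s : SerialNumber n)

/-- The type of the wires for a serial number. -/
abbrev SWire : Type := Wire n a F (nCond n a s.m)

/-- Test whether register `k` is correct. -/
def testOne (k : Fin (n + 1)) (c c' : Fin 4) : List (WGate (SWire a F s)) :=
  verifyCirc s k (condPoly n a s.m c) (condPoly n a s.m c')

/-- Test whether register `k` is zero. -/
def testReg (k : Fin (n + 1)) : List (WGate (SWire a F s)) :=
  zeroCirc (List.finRange n) (.data k) (fun _ => trivial) (condReg n a s.m)

/-- Test whether the ancillas of copy `k` are zero. -/
def testAnc (k : Fin n) : List (WGate (SWire a F s)) :=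
  zeroCirc (List.finRange a) (.anc k) (fun _ => trivial) (condAnc n a s.m)

/-- Test whether a flag is zero. -/
def testFlag (k : Fin (n + 1)) (j : Fin (F + 1)) : List (WGate (SWire a F s)) :=
  zeroCirc [()] (fun _ => .flag k j) (fun _ => trivial) (condFlag n a s.m)

/-- The wires of the copy `k` of the counterfeiter. -/
def copyWire {T : ℕ} (k : Fin n) : Fin (2 * n + a) → Wire n a F T :=
  Fin.addCases (fun p => if (finProdFinEquiv.symm p).1 = 0
    then .data k.castSucc (finProdFinEquiv.symm p).2 else .data k.succ (finProdFinEquiv.symm p).2)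
    (.anc k)

theorem copyWire_anc {T : ℕ} (k : Fin n) (j : Fin a) :
    copyWire a F (T := T) k (Fin.natAdd (2 * n) j) = .anc k j := by
  simp [copyWire]

theorem copyWire_zero {T : ℕ} (k : Fin n) (i : Fin n) :
    copyWire a F (T := T) k (wire a 0 i) = .data k.castSucc i := by
  rw [wire, copyWire, Fin.addCases_left, Equiv.symm_apply_apply, if_pos rfl]

theorem copyWire_one {T : ℕ} (k : Fin n) (i : Fin n) :
    copyWire a F (T := T) k (wire a 1 i) = .data k.succ i := by
  rw [wire, copyWire, Fin.addCases_left, Equiv.symm_apply_apply, if_neg (by simp)]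

theorem copy_cases {P : Fin (2 * n + a) → Prop} (h0 : ∀ i, P (wire a 0 i))
    (h1 : ∀ i, P (wire a 1 i)) (h2 : ∀ j, P (Fin.natAdd (2 * n) j)) (x : Fin (2 * n + a)) : P x := by
  refine Fin.addCases (fun p => ?_) h2 x
  obtain ⟨⟨b, i⟩, rfl⟩ := finProdFinEquiv.surjective p
  match b with
  | 0 => exact h0 i
  | 1 => exact h1 i

theorem copyWire_injective {T : ℕ} (k : Fin n) :
    Function.Injective (copyWire a F (T := T) k) := by
  have hk : k.castSucc ≠ k.succ := Fin.castSucc_lt_succ.ne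
  intro x y
  refine copy_cases (P := fun x => copyWire a F (T := T) k x = copyWire a F k y → x = y) a ?_ ?_ ?_ x
    <;> intro i <;>
    refine copy_cases (P := fun y => copyWire a F (T := T) k _ = copyWire a F k y → _ = y) a
      ?_ ?_ ?_ y <;> intro j h <;> simp only [copyWire_anc, copyWire_zero, copyWire_one,
      Wire.data.injEq, Wire.anc.injEq, reduceCtorEq] at h
  · rw [h.2]
  · exact absurd h.1 hk
  · exact absurd h.1.symm hk
  · rw [h.2]
  · rw [h.2]

/-- The wires of the copy `k` of the counterfeiter. -/
def copyEmb {T : ℕ} (k : Fin n) : Fin (2 * n + a) ↪ Wire n a F T :=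
  ⟨copyWire a F k, copyWire_injective a F k⟩

variable {a} in
/-- The copy `k` of a counterfeiter. -/
def copyGates (gs : List (WGate (Fin (2 * n + a)))) (k : Fin n) : List (WGate (SWire a F s)) :=
  gs.map (WGate.map (copyEmb a F k))

/-- Record in a flag whether registers `k` and `k + 1` are correct. -/
def markPair (k : Fin n) (j : Fin (F + 1)) : List (WGate (SWire a F s)) :=
  toggle (testOne a F s k.castSucc 0 1 ++ testOne a F s k.succ 2 3) (.flag k.succ j)
    (by simp) (by simp)

/-- The reflection in the input state of copy `k` of the counterfeiter. -/
def reflect (k : Fin n) (j : Fin F) : List (WGate (SWire a F s)) :=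
  toggle (testFlag a F s k.succ j.castSucc ++ (testOne a F s k.castSucc 0 1 ++
    (testReg a F s k.succ ++ testAnc a F s k))) .mi (by simp) (by simp)

variable {a} in
/-- The measurement of registers `k` and `k + 1` after the counterfeiter. -/
def mark (gs : List (WGate (Fin (2 * n + a)))) (k : Fin n) (j : Fin (F + 1)) :
    List (WGate (SWire a F s)) :=
  copyGates F s gs k ++ (markPair a F s k j ++ invGates (copyGates F s gs k))

variable {a} in
/-- The stage producing register `k + 1` from register `k`. -/
def stage (gs : List (WGate (Fin (2 * n + a)))) (k : Fin n) : List (WGate (SWire a F s)) :=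
  mark F s gs k 0 ++ (List.finRange F).flatMap (fun j => reflect a F s k j ++ mark F s gs k j.succ)
    ++ copyGates F s gs k

/-- Record in a flag whether register `0` is correct. -/
def markFirst (j : Fin (F + 1)) : List (WGate (SWire a F s)) :=
  toggle (testOne a F s 0 0 1) (.flag 0 j) (by simp) (by simp)

/-- The reflection in the initial state of register `0`. -/
def reflectFirst (j : Fin F) : List (WGate (SWire a F s)) :=
  toggle (testFlag a F s 0 j.castSucc ++ testReg a F s 0) .mi (by simp) (by simp)

/-- The stage producing register `0`. -/
def firstStage : List (WGate (SWire a F s)) :=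
  markFirst a F s 0 ++ (List.finRange F).flatMap fun j => reflectFirst a F s j ++
    markFirst a F s j.succ

/-- Apply a bit flip. -/
def flipGates {ι : Type} (w : ι) : List (WGate ι) := [.had w, .ph w, .ph w, .had w]

/-- Prepare the constant wires. -/
def prepGates : List (WGate (SWire a F s)) :=
  flipGates .o1 ++ flipGates .o2 ++ flipGates (.c 0) ++ flipGates .mi ++ [.had .mi]

variable {a} in
/-- The circuit of the basis finder. -/
def allGates (gs : List (WGate (Fin (2 * n + a)))) : List (WGate (SWire a F s)) :=
  prepGates a F s ++ firstStage a F s ++ (List.finRange n).flatMap (stage F s gs)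

end

/-! ### Analysis of the stages -/

section

variable {n a m : ℕ}

theorem condPoly_lt (c : Fin 4) (i : Fin m) : (condPoly n a m c i : ℕ) < 4 * m := by
  have := (finProdFinEquiv (c, i)).isLt
  simp [finProdFinEquiv] at this
  simp only [condPoly]
  linarith

theorem condPoly_inj {c c' : Fin 4} {i i' : Fin m}
    (h : condPoly n a m c i = condPoly n a m c' i') : c = c' ∧ i = i' := by
  have : finProdFinEquiv (c, i) = finProdFinEquiv (c', i') := by
    simp only [condPoly, Fin.mk.injEq] at h
    apply Fin.ext
    simp only [finProdFinEquiv, Equiv.coe_fn_mk]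
    linarith
  simpa using finProdFinEquiv.injective this

theorem condPoly_injective (c : Fin 4) : Function.Injective (condPoly n a m c) :=
  fun _ _ h => (condPoly_inj h).2

theorem disjoint_condPoly {c c' : Fin 4} (h : c ≠ c') :
    Disjoint (Set.range (condPoly n a m c)) (Set.range (condPoly n a m c')) := by
  rw [Set.disjoint_left]
  rintro _ ⟨i, rfl⟩ ⟨j, hj⟩
  exact h (condPoly_inj hj).1.symm

theorem condReg_injective : Function.Injective (condReg n a m) := fun i j h => by
  simpa [condReg, Fin.ext_iff] using h

theorem condAnc_injective : Function.Injective (condAnc n a m) := fun i j h => by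
  simpa [condAnc, Fin.ext_iff] using h

theorem condFlag_injective : Function.Injective (condFlag n a m) := fun _ _ _ => rfl

end

/-! ### One copying stage -/

section

variable {n a F : ℕ} {s : SerialNumber n} {S : Submodule (ZMod 2) (Fin n → ZMod 2)}

theorem wreg_apply {T : ℕ} (k : Fin (n + 1)) (i : Fin n) : wreg a F T k i = .data k i := rfl

theorem tests_testOne (hp : ∀ x, (∀ i, MvPolynomial.eval x (s.p i) = 0) ↔ x ∈ S)
    (hq : ∀ y, (∀ i, MvPolynomial.eval y (s.q i) = 0) ↔ ∀ x ∈ S, x ⬝ᵥ y = 0)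
    (k : Fin (n + 1)) {c c' : Fin 4} (h : c ≠ c') :
    Tests (testOne a F s k c c') (Set.range (condPoly n a s.m c) ∪ Set.range (condPoly n a s.m c'))
      (subProj (wreg a F (nCond n a s.m) k) S) :=
  tests_verifyCirc hp hq k (condPoly_injective c) (condPoly_injective c') (disjoint_condPoly h)

variable (a F s) in
/-- The projection on the states in which register `k` is zero. -/
def projReg (k : Fin (n + 1)) : Op (SWire a F s) := proj fun z => ∀ i, z (.data k i) = 0

variable (a F s) in
/-- The projection on the states in which the ancillas of copy `k` are zero. -/
def projAnc (k : Fin n) : Op (SWire a F s) := proj fun z => ∀ i, z (.anc k i) = 0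

theorem tests_testReg (k : Fin (n + 1)) :
    Tests (testReg a F s k) (Set.range (condReg n a s.m)) (projReg a F s k) := by
  refine (tests_zeroCirc (List.finRange n) (List.nodup_finRange n) (.data k) (fun _ => trivial)
    condReg_injective).congr rfl ?_ ?_
  · ext; simp
  · simp [projReg]

theorem tests_testAnc (k : Fin n) :
    Tests (testAnc a F s k) (Set.range (condAnc n a s.m)) (projAnc a F s k) := by
  refine (tests_zeroCirc (List.finRange a) (List.nodup_finRange a) (.anc k) (fun _ => trivial)
    condAnc_injective).congr rfl ?_ ?_
  · ext; simp
  · simp [projAnc]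

theorem tests_testFlag (k : Fin (n + 1)) (j : Fin (F + 1)) :
    Tests (testFlag a F s k j) (Set.range (condFlag n a s.m))
      (proj fun z => z (.flag k j) = 0) := by
  refine (tests_zeroCirc [()] (by simp) (fun _ => .flag k j) (fun _ => trivial)
    condFlag_injective).congr rfl ?_ ?_
  · ext; simp
  · simp

theorem tests_pair (hp : ∀ x, (∀ i, MvPolynomial.eval x (s.p i) = 0) ↔ x ∈ S)
    (hq : ∀ y, (∀ i, MvPolynomial.eval y (s.q i) = 0) ↔ ∀ x ∈ S, x ⬝ᵥ y = 0) (k : Fin n) :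
    ∃ V, Tests (testOne a F s k.castSucc 0 1 ++ testOne a F s k.succ 2 3) V
      (subProj (wreg a F (nCond n a s.m) k.succ) S *
        subProj (wreg a F (nCond n a s.m) k.castSucc) S) := by
  refine ⟨_, (tests_testOne hp hq k.castSucc (by decide)).append
    (tests_testOne hp hq k.succ (by decide)) ?_ (commute_subProj_subProj ?_)⟩
  · simp only [Set.disjoint_union_left, Set.disjoint_union_right]
    refine ⟨⟨?_, ?_⟩, ?_, ?_⟩ <;> exact disjoint_condPoly (by decide)
  · rw [Set.disjoint_left]
    rintro _ ⟨i, rfl⟩ ⟨j, hj⟩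
    simp only [wreg_apply, Wire.data.injEq] at hj
    exact (Fin.castSucc_lt_succ (i := k)).ne hj.1.symm

theorem commute_projReg_subProj {k k' : Fin (n + 1)} (h : k ≠ k') :
    Commute (projReg a F s k) (subProj (wreg a F (nCond n a s.m) k') S) := by
  refine (acts_proj_forall (W := {w : SWire a F s | ∃ i, w = .data k i})
    fun i => ⟨i, rfl⟩).commute_subProj S ?_
  rintro i ⟨j, hj⟩
  simp only [wreg_apply, Wire.data.injEq] at hj
  exact h hj.1.symm

theorem commute_projAnc_subProj {k : Fin n} {k' : Fin (n + 1)} :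
    Commute (projAnc a F s k) (subProj (wreg a F (nCond n a s.m) k') S) := by
  refine (acts_proj_forall (W := {w : SWire a F s | ∃ i, w = .anc k i})
    fun i => ⟨i, rfl⟩).commute_subProj S ?_
  rintro i ⟨j, hj⟩
  simp [wreg_apply] at hj

theorem commute_flag_subProj {k k' : Fin (n + 1)} {j : Fin (F + 1)} :
    Commute (proj fun z : SWire a F s → ZMod 2 => z (.flag k j) = 0)
      (subProj (wreg a F (nCond n a s.m) k') S) := by
  refine (acts_proj_eq (W := {w : SWire a F s | w = .flag k j}) rfl 0).commute_subProj S ?_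
  intro i hi
  simp [wreg_apply] at hi

theorem castSucc_ne_succ (k : Fin n) : k.castSucc ≠ k.succ := Fin.castSucc_lt_succ.ne

variable (a F s S) in
/-- The projection on the input states of copy `k` of the counterfeiter. -/
def stageInput (k : Fin n) : Op (SWire a F s) :=
  projAnc a F s k * projReg a F s k.succ * subProj (wreg a F (nCond n a s.m) k.castSucc) S

/-- The flag is part of the tested projection, so branches that have already succeeded are not
reflected. The four groups of condition wires are kept apart by their numbering. -/
theorem tests_reflect (hp : ∀ x, (∀ i, MvPolynomial.eval x (s.p i) = 0) ↔ x ∈ S)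
    (hq : ∀ y, (∀ i, MvPolynomial.eval y (s.q i) = 0) ↔ ∀ x ∈ S, x ⬝ᵥ y = 0) (k : Fin n)
    (j : Fin (F + 1)) : ∃ V, Tests (testFlag a F s k.succ j ++ (testOne a F s k.castSucc 0 1 ++
      (testReg a F s k.succ ++ testAnc a F s k))) V
      (stageInput a F s S k * proj fun z => z (.flag k.succ j) = 0) := by
  have h1 := (tests_testReg (a := a) (F := F) (s := s) k.succ).append (tests_testAnc k) (by
    rw [Set.disjoint_left]
    rintro _ ⟨i, rfl⟩ ⟨j, hj⟩
    simp only [condReg, condAnc, Fin.mk.injEq] at hj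
    omega) (commute_proj_proj _ _)
  have hlt : ∀ c (i : Fin s.m) {j}, j = condPoly n a s.m c i → ¬ 4 * s.m ≤ (j : ℕ) := fun c i j h =>
    h ▸
    not_le.2 (condPoly_lt c i)
  have h5 : Disjoint (Set.range (condPoly n a s.m 0) ∪ Set.range (condPoly n a s.m 1))
      (Set.range (condReg n a s.m) ∪ Set.range (condAnc n a s.m)) := by
    rw [Set.disjoint_left]
    rintro _ (⟨i, rfl⟩ | ⟨i, rfl⟩) (⟨j, hj⟩ | ⟨j, hj⟩) <;> refine hlt _ i hj ?_ <;>
      simp [condReg, condAnc, add_assoc]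
  have h6 : Commute (projAnc a F s k * projReg a F s k.succ)
      (subProj (wreg a F (nCond n a s.m) k.castSucc) S) :=
    commute_projAnc_subProj.mul_left (commute_projReg_subProj (castSucc_ne_succ k).symm)
  have h7 := tests_testOne (a := a) (F := F) hp hq k.castSucc (c := 0) (c' := 1) (by decide)
  have h2 := h7.append h1 h5 h6.symm
  have h3 : Disjoint (Set.range (condFlag n a s.m)) ((Set.range (condPoly n a s.m 0) ∪
      Set.range (condPoly n a s.m 1)) ∪
      (Set.range (condReg n a s.m) ∪ Set.range (condAnc n a s.m))) := by
    rw [Set.disjoint_left]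
    rintro _ ⟨_, rfl⟩ ((⟨j, hj⟩ | ⟨j, hj⟩) | (⟨j, hj⟩ | ⟨j, hj⟩))
    · refine hlt _ j hj.symm ?_
      simp [condFlag, add_assoc]
    · refine hlt _ j hj.symm ?_
      simp [condFlag, add_assoc]
    · simp only [condReg, condFlag, Fin.mk.injEq] at hj
      omega
    · simp only [condAnc, condFlag, Fin.mk.injEq] at hj
      omega
  have h4 : Commute (proj fun z : SWire a F s → ZMod 2 => z (.flag k.succ j) = 0)
      (stageInput a F s S k) :=
    ((commute_proj_proj _ _).mul_right (commute_proj_proj _ _)).mul_right commute_flag_subProj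
  exact ⟨_, (tests_testFlag k.succ j).append h2 h3 h4⟩

theorem selfAdj_stageInput (k : Fin n) : SelfAdj (stageInput a F s S k) :=
  ((selfAdj_proj _).mul (selfAdj_proj _) (commute_proj_proj _ _)).mul selfAdj_subProj
    (commute_projAnc_subProj.mul_left (commute_projReg_subProj (castSucc_ne_succ k).symm))

theorem wreg_castSucc (T : ℕ) (k : Fin n) :
    wreg a F T k.castSucc = (wireEmb n a 0).trans (copyEmb a F k) := by
  ext i : 1
  exact (copyWire_zero a F k i).symm

theorem wreg_succ (T : ℕ) (k : Fin n) :
    wreg a F T k.succ = (wireEmb n a 1).trans (copyEmb a F k) := by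
  ext i : 1
  exact (copyWire_one a F k i).symm

theorem slice_stageInput (k : Fin n) (y : SWire a F s → ZMod 2) (ψ : St (SWire a F s)) :
    slice (copyEmb a F k) y (stageInput a F s S k ψ)
      = inputProj S a (slice (copyEmb a F k) y ψ) := by
  rw [stageInput, inputProj, Module.End.mul_apply, Module.End.mul_apply (proj _) (subProj _ _), wreg_castSucc,
    ← slice_subProj, projAnc, projReg, proj_mul_proj]
  refine slice_proj (fun x => ?_) _
  have e : ∀ i, Function.extend (copyEmb a F k) x y (copyEmb a F k i) = x i :=
    fun i => (copyEmb a F k).injective.extend_apply _ _ _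
  have e1 : ∀ i, Function.extend (copyEmb a F k) x y (.data k.succ i) = x (wire a 1 i) := by
    intro i
    rw [← e, ← copyWire_one a F k i]
    rfl
  have e2 : ∀ i, Function.extend (copyEmb a F k) x y (.anc k i) = x (Fin.natAdd (2 * n) i) := by
    intro i
    rw [← e, ← copyWire_anc a F k i]
    rfl
  simp only [e1, e2]
  constructor
  · rintro ⟨h2, h1⟩ w
    refine copy_cases (P := fun w => n ≤ (w : ℕ) → x w = 0) a ?_ ?_ ?_ w
    · intro i hi
      have := wire_zero_val (a := a) i
      omega
    · intro i _
      exact h1 i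
    · intro i _
      exact h2 i
  · intro h
    refine ⟨fun i => h _ ?_, fun i => h _ ?_⟩
    · simp; omega
    · simp [wire]

theorem slice_afterProj (gs : List (WGate (Fin (2 * n + a)))) (k : Fin n)
    (y : SWire a F s → ZMod 2) (ψ : St (SWire a F s)) :
    slice (copyEmb a F k) y (afterProj (copyGates F s gs k)
      (wreg a F (nCond n a s.m) k.castSucc) (wreg a F (nCond n a s.m) k.succ) S ψ) =
      afterProj gs (wireEmb n a 0) (wireEmb n a 1) S (slice (copyEmb a F k) y ψ) := by
  simp only [afterProj, Module.End.mul_apply, copyGates, invGates_map, wreg_castSucc, wreg_succ,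
    slice_run, slice_subProj]

/-- On each slice the rank-one computation applies, and the scalar is the same for all slices. Hence
the identity survives arbitrary entanglement of the copy with the remaining wires. -/
theorem stageInput_afterProj (gs : List (WGate (Fin (2 * n + a)))) (k : Fin n)
    {ψ : St (SWire a F s)} (h : stageInput a F s S k ψ = ψ) :
    stageInput a F s S k (afterProj (copyGates F s gs k)
      (wreg a F (nCond n a s.m) k.castSucc) (wreg a F (nCond n a s.m) k.succ) S ψ) =
    (nrm (subProj (wireEmb n a 1) S (subProj (wireEmb n a 0) S
        (run gs (counterfeitInput S)))) : ℂ) • ψ := by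
  refine slice_ext (e := copyEmb a F k) fun y => ?_
  have h' := congrArg (slice (copyEmb a F k) y) h
  rw [slice_stageInput] at h'
  rw [slice_stageInput, slice_afterProj, inputProj_afterProj S gs h']
  rfl

theorem disjoint_wreg {T : ℕ} {k k' : Fin (n + 1)} (h : k ≠ k') :
    Disjoint (Set.range (wreg a F T k)) (Set.range (wreg a F T k')) := by
  rw [Set.disjoint_left]
  rintro _ ⟨i, rfl⟩ ⟨j, hj⟩
  simp only [wreg_apply, Wire.data.injEq] at hj
  exact h hj.1.symm

theorem wires_copyGates (gs : List (WGate (Fin (2 * n + a)))) (k : Fin n) {W : Set (SWire a F s)}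
    (h0 : ∀ i, .data k.castSucc i ∈ W) (h1 : ∀ i, .data k.succ i ∈ W) (h2 : ∀ j, .anc k j ∈ W) :
    ∀ g ∈ copyGates F s gs k, g.wires ⊆ W := by
  have h : ∀ x, copyWire a F k x ∈ W := by
    refine copy_cases a (fun i => ?_) (fun i => ?_) (fun i => ?_)
    · exact (copyWire_zero a F (T := nCond n a s.m) k i).symm ▸ h0 i
    · exact (copyWire_one a F (T := nCond n a s.m) k i).symm ▸ h1 i
    · exact (copyWire_anc a F (T := nCond n a s.m) k i).symm ▸ h2 i
  intro g hg
  obtain ⟨g, -, rfl⟩ := List.mem_map.1 hg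
  cases g <;> simp [WGate.map, WGate.wires, Set.insert_subset_iff, h, copyEmb]

theorem acts_copyGates (gs : List (WGate (Fin (2 * n + a)))) (k : Fin n) :
    Acts (freeSet n a F (nCond n a s.m) (k + 1) k) (run (copyGates F s gs k)) := by
  refine acts_run (wires_copyGates gs k (fun i => ?_) (fun i => ?_) (fun i => ?_))
  · exact ⟨le_rfl, by simp⟩
  · exact ⟨by simp, by simp⟩
  · exact Nat.lt_succ_self _

/-- The probability that the output registers of a circuit are correct. -/
def pairProb (gs : List (WGate (Fin (2 * n + a)))) (S : Submodule (ZMod 2) (Fin n → ZMod 2)) : ℝ :=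
  nrm (subProj (wireEmb n a 1) S (subProj (wireEmb n a 0) S (run gs (counterfeitInput S))))

/-- Amplification yields a state φ in the range of U⁻¹ΠU. The final run of the counterfeiter U moves
it into the range of Π, where both registers hold |S⟩. -/
theorem stage_spec (hp : ∀ x, (∀ i, MvPolynomial.eval x (s.p i) = 0) ↔ x ∈ S)
    (hq : ∀ y, (∀ i, MvPolynomial.eval y (s.q i) = 0) ↔ ∀ x ∈ S, x ⬝ᵥ y = 0)
    (gs : List (WGate (Fin (2 * n + a)))) (k : Fin n) {ψ : St (SWire a F s)}
    (hψ : ψ ∈ Inv a F (nCond n a s.m) S k (k + 1)) :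
    proj (fun z => z (.flag k.succ (Fin.last F)) = 1) (run (stage F s gs k) ψ)
        ∈ Inv a F (nCond n a s.m) S (k + 1) (k + 2) ∧
      nrm (proj (fun z => z (.flag k.succ (Fin.last F)) = 1) (run (stage F s gs k) ψ)) =
        (1 - (1 - pairProb gs S) * (2 * pairProb gs S - 1) ^ (2 * F)) * nrm ψ := by
  set T := nCond n a s.m with hT
  set U := copyGates F s gs k with hU
  set A := stageInput a F s S k with hA
  set B := afterProj U (wreg a F T k.castSucc) (wreg a F T k.succ) S with hB
  -- During the stage both registers and the ancillas of the copy change, so this larger space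
  -- forgets that register `k` holds |S⟩ and register `k + 1` is zero. Both facts hold at the start,
  -- which gives AΨ = Ψ, and the corresponding facts at the end follow from φ being in the range of
  -- B.
  set G := Inv a F T S (k + 1) k with hG
  have hψG : ψ ∈ G := Inv.mono (by omega) (by omega) hψ
  have aU : Acts (freeSet n a F T (k + 1) k) (run U) := acts_copyGates gs k
  have a0 : Acts (freeSet n a F T (k + 1) k) (subProj (wreg a F T k.castSucc) S) :=
    acts_subProj S fun i => ⟨le_rfl, by simp⟩
  have a1 : Acts (freeSet n a F T (k + 1) k) (subProj (wreg a F T k.succ) S) :=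
    acts_subProj S fun i => ⟨by simp, by simp⟩
  have aB : Acts (freeSet n a F T (k + 1) k) B := (aU.invGates.mul (a1.mul a0)).mul aU
  have aF : ∀ j, Acts (freeSet n a F T (k + 1) k)
      (proj fun z : SWire a F s → ZMod 2 => z (.flag k.succ j) = 0) := fun j =>
    acts_proj_eq (w := (.flag k.succ j : SWire a F s))
      (show (k.succ : ℕ) ≤ k + 1 by simp) _
  have aA : Acts (freeSet n a F T (k + 1) k) A := by
    refine ((acts_proj_forall fun i => ?_).mul (acts_proj_forall fun i => ?_)).mul a0
    · exact Nat.lt_succ_self _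
    · exact ⟨by simp, by simp⟩
  obtain ⟨V1, t1⟩ := tests_pair (a := a) (F := F) hp hq k
  have cU : ∀ j, Commute (run U) (tr (Pi.single (.flag k.succ j : SWire a F s) (1 : ZMod 2))) :=
    fun j => commute_run_tr fun g hg w hw => Pi.single_eq_of_ne (by
      rintro rfl
      exact wires_copyGates gs k (W := {.flag k.succ j}ᶜ) (by simp) (by simp) (by simp) g hg hw
        rfl) _
  have cU' : ∀ j, Commute (run U) (proj fun z : SWire a F s → ZMod 2 => z (.flag k.succ j) = 0) :=
    fun j => commute_run_proj fun g hg w hw => by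
      have : w ≠ .flag k.succ j := by
        rintro rfl
        exact wires_copyGates gs k (W := {.flag k.succ j}ᶜ) (by simp) (by simp) (by simp) g hg
          (g.mods_subset hw) rfl
      exact indep_eq_of_ne this _
  have cU1 : Commute (run U) (proj fun z : SWire a F s → ZMod 2 =>
      z (.flag k.succ (Fin.last F)) = 1) :=
    commute_run_proj fun g hg w hw => by
      have : w ≠ .flag k.succ (Fin.last F) := by
        rintro rfl
        exact wires_copyGates gs k (W := {.flag k.succ (Fin.last F)}ᶜ) (by simp) (by simp)
          (by simp) g hg (g.mods_subset hw) rfl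
      exact indep_eq_of_ne this _
  have cs : ∀ k' j, Commute (subProj (wreg a F T k') S)
      (tr (Pi.single (.flag k.succ j : SWire a F s) (1 : ZMod 2))) := fun k' j =>
    (commute_tr_subProj fun i => by simp [wreg_apply]).symm
  have cs' : ∀ k' j, Commute (subProj (wreg a F T k') S)
      (proj fun z : SWire a F s → ZMod 2 => z (.flag k.succ j) = 0) := fun k' j =>
    commute_flag_subProj.symm
  have hM : ∀ j, ∀ χ ∈ G, run (mark F s gs k j) χ
      = χ - B χ + tr (Pi.single (.flag k.succ j) 1) (B χ) := by
    intro j χ hχ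
    have hw : ∀ k' c c', ∀ g ∈ testOne a F s k' c c', g.wires ⊆ {.flag k.succ j}ᶜ :=
      fun k' c c' => wires_verifyCirc (fun w hw => by rintro rfl; exact hw) (by simp)
    have e1 : run (markPair a F s k j) (run U χ) = _ :=
      run_toggle_flag t1 k.succ j (wires_append (hw _ _ _) (hw _ _ _)) (Inv.map aU hχ)
    have e2 : B χ = run (invGates U) ((subProj (wreg a F T k.succ) S *
        subProj (wreg a F T k.castSucc) S) (run U χ)) := rfl
    have e3 : run (invGates U) (run U χ) = χ := by
      rw [← Module.End.mul_apply, run_invGates_mul, Module.End.one_apply]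
    rw [mark, ← hU, run_append, run_append, Module.End.mul_apply, Module.End.mul_apply, e1,
      map_add, map_sub, e3, ← e2, Commute.apply_eq (Commute.invGates (cU j)), ← e2]
  have hR : ∀ j, ∀ χ ∈ G, run (reflect a F s k j) χ
      = χ - (2 : ℂ) • A (proj (fun z => z (.flag k.succ j.castSucc) = 0) χ) := by
    intro j χ hχ
    obtain ⟨V2, t2⟩ := tests_reflect (a := a) (F := F) hp hq k j.castSucc
    refine run_toggle_mi t2 ?_ (aA.mul (aF _)) hχ
    have hx : ∀ w : SWire a F s, w.IsAux → w ∈ ({.mi}ᶜ : Set (SWire a F s)) := by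
      rintro w hw rfl; exact hw
    exact wires_append (wires_zeroCirc hx (by simp)) (wires_append (wires_verifyCirc hx (by simp))
      (wires_append (wires_zeroCirc hx (by simp)) (wires_zeroCirc hx (by simp))))
  have h0 : A ψ = ψ := by
    have e1 : subProj (wreg a F T k.castSucc) S ψ = ψ := hψ _ (.sub _ (by simp))
    have e2 : projReg a F s k.succ ψ = ψ := by
      refine proj_eq_self_iff.2 fun z hz => ?_
      rw [not_forall] at hz
      obtain ⟨i, hi⟩ := hz
      exact proj_eq_self_iff.1 (hψ _ (.data k.succ i (by simp))) z hi
    have e3 : projAnc a F s k ψ = ψ := by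
      refine proj_eq_self_iff.2 fun z hz => ?_
      rw [not_forall] at hz
      obtain ⟨i, hi⟩ := hz
      exact proj_eq_self_iff.1 (hψ _ (.anc k i le_rfl)) z hi
    rw [hA, stageInput, Module.End.mul_apply, Module.End.mul_apply, e1, e2, e3]
  have hdis := disjoint_wreg (a := a) (F := F) (T := T) (castSucc_ne_succ k)
  obtain ⟨φ, hφG, hφB, hφn, hφ⟩ := amplify (f := fun j => (.flag k.succ j : SWire a F s))
    (fun i j h => by simpa using h) hM hR (fun χ hχ => Inv.map aB hχ)
    (fun j χ hχ => Inv.map (acts_tr (show (k.succ : ℕ) ≤ k + 1 by simp)) hχ)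
    (fun j => ((Commute.invGates (cU j)).mul_left ((cs _ _).mul_left (cs _ _))).mul_left (cU j))
    (fun j => ((Commute.invGates (cU' j)).mul_left ((cs' _ _).mul_left (cs' _ _))).mul_left
      (cU' j))
    (afterProj_mul_self U S hdis) (selfAdj_stageInput k) (selfAdj_afterProj U S hdis) hψG h0
    (ε := pairProb gs S) (stageInput_afterProj gs k h0)
    (fun j => hψ _ (.flag k.succ j (by simp)))
  have hout : proj (fun z => z (.flag k.succ (Fin.last F)) = 1) (run (stage F s gs k) ψ)
      = run U φ := by
    rw [stage, ← hU, run_append, Module.End.mul_apply, ← Commute.apply_eq cU1, hφ]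
  rw [hout, nrm_run, hφn]
  refine ⟨?_, rfl⟩
  have hUφ : run U φ ∈ G := Inv.map aU hφG
  -- Writing φ = Bφ = U⁻¹ΠUφ shows that Uφ is fixed by Π.
  have hpair : (subProj (wreg a F T k.succ) S * subProj (wreg a F T k.castSucc) S) (run U φ)
      = run U φ := by
    conv_rhs => rw [← hφB, hB, afterProj, Module.End.mul_apply, Module.End.mul_apply,
      ← Module.End.mul_apply (run U), run_mul_invGates, Module.End.one_apply]
  have hs1 : subProj (wreg a F T k.succ) S (run U φ) = run U φ := by
    rw [← hpair, ← Module.End.mul_apply, ← mul_assoc, subProj_mul_self]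
  have hs0 : subProj (wreg a F T k.castSucc) S (run U φ) = run U φ := by
    rw [← hpair, ← (commute_subProj_subProj hdis).eq, ← Module.End.mul_apply, ← mul_assoc,
      subProj_mul_self]
  intro Q hQ
  cases hQ with
  | clean => exact hUφ _ .clean
  | vzero => exact hUφ _ .vzero
  | mi => exact hUφ _ .mi
  | data b i h => exact hUφ _ (.data b i h)
  | anc b i h => exact hUφ _ (.anc b i h)
  | flag b i h => exact hUφ _ (.flag b i h)
  | sub b h =>
    rcases lt_trichotomy (b : ℕ) k with h' | h' | h'
    · exact hUφ _ (.sub b h')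
    · rwa [show b = k.castSucc from Fin.ext h']
    · rwa [show b = k.succ from Fin.ext (by simp; omega)]

end

/-! ### The first copy of |S⟩ and the complete circuit -/

section

variable {n a F : ℕ} {s : SerialNumber n} {S : Submodule (ZMod 2) (Fin n → ZMod 2)}

/-- The success probability of finding an element of `S` by amplification of a random guess. -/
def guessProb (S : Submodule (ZMod 2) (Fin n → ZMod 2)) : ℝ := ((elems S).card : ℝ)⁻¹

/-- Among the translates of 0 by elements of S only the trivial one is 0 again, so the overlap is
1/|S|. This is the value of ε for the first stage. -/
theorem projReg_subProj (k : Fin (n + 1)) {ψ : St (SWire a F s)} (h : projReg a F s k ψ = ψ) :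
    projReg a F s k (subProj (wreg a F (nCond n a s.m) k) S ψ) = (guessProb S : ℂ) • ψ := by
  classical
  funext z
  rw [projReg, proj_eq_self_iff] at h
  rw [projReg, proj_apply, subProj_apply, Pi.smul_apply, smul_eq_mul]
  split_ifs with hz hS
  · rw [Finset.sum_eq_single 0]
    · have : pad (wreg a F (nCond n a s.m) k) 0 = 0 := by
        funext w
        by_cases hw : w ∈ Set.range (wreg a F (nCond n a s.m) k)
        · obtain ⟨i, rfl⟩ := hw; simp
        · rw [pad_of_notMem hw]; rfl
      rw [this, add_zero, guessProb]
      push_cast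
      rfl
    · intro v _ hv
      refine h _ fun hz' => hv ?_
      funext i
      have h1 := hz' i
      rw [Pi.add_apply, hz i, zero_add] at h1
      rw [← pad_apply (wreg a F (nCond n a s.m) k) v i]
      exact h1
    · intro h0
      exact absurd (by simp) h0
  · refine absurd ?_ hS
    have : z ∘ wreg a F (nCond n a s.m) k = 0 := funext hz
    rw [InS, this]
    exact S.zero_mem
  · rw [h z hz, mul_zero]

/-- The same amplification without a counterfeiter: B is the verification of register 0 itself and A
projects on |0…0⟩. -/
theorem firstStage_spec (hp : ∀ x, (∀ i, MvPolynomial.eval x (s.p i) = 0) ↔ x ∈ S)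
    (hq : ∀ y, (∀ i, MvPolynomial.eval y (s.q i) = 0) ↔ ∀ x ∈ S, x ⬝ᵥ y = 0)
    {ψ : St (SWire a F s)} (hψ : ψ ∈ Inv a F (nCond n a s.m) S 0 0)
    (hz : projReg a F s 0 ψ = ψ) (hf : ∀ j, proj (fun z => z (.flag 0 j) = 0) ψ = ψ) :
    proj (fun z => z (.flag 0 (Fin.last F)) = 1) (run (firstStage a F s) ψ)
        ∈ Inv a F (nCond n a s.m) S 0 1 ∧
      nrm (proj (fun z => z (.flag 0 (Fin.last F)) = 1) (run (firstStage a F s) ψ)) =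
        (1 - (1 - guessProb S) * (2 * guessProb S - 1) ^ (2 * F)) * nrm ψ := by
  set T := nCond n a s.m with hT
  set A := projReg a F s 0 with hA
  set B := subProj (wreg a F T 0) S with hB
  set G := Inv a F T S 0 0 with hG
  have aB : Acts (freeSet n a F T 0 0) B := acts_subProj S fun i => ⟨le_rfl, le_rfl⟩
  have aF : ∀ j, Acts (freeSet n a F T 0 0)
      (proj fun z : SWire a F s → ZMod 2 => z (.flag 0 j) = 0) := fun j =>
    acts_proj_eq (w := (.flag 0 j : SWire a F s)) (show ((0 : Fin (n + 1)) : ℕ) ≤ 0 from le_rfl) _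
  have aA : Acts (freeSet n a F T 0 0) A := acts_proj_forall fun i => ⟨le_rfl, le_rfl⟩
  have hM : ∀ j, ∀ χ ∈ G, run (markFirst a F s j) χ
      = χ - B χ + tr (Pi.single (.flag 0 j) 1) (B χ) := fun j χ hχ =>
    run_toggle_flag (tests_testOne hp hq 0 (by decide)) 0 j
      (wires_verifyCirc (fun w hw => by rintro rfl; exact hw) (by simp)) hχ
  have hR : ∀ j, ∀ χ ∈ G, run (reflectFirst a F s j) χ
      = χ - (2 : ℂ) • A (proj (fun z => z (.flag 0 j.castSucc) = 0) χ) := by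
    intro j χ hχ
    have t2 := (tests_testFlag (a := a) (F := F) (s := s) 0 j.castSucc).append (tests_testReg 0) (by
      rw [Set.disjoint_left]
      rintro _ ⟨_, rfl⟩ ⟨i, hi⟩
      simp only [condReg, condFlag, Fin.mk.injEq] at hi
      omega) (commute_proj_proj _ _)
    refine run_toggle_mi t2 ?_ (aA.mul (aF _)) hχ
    have hx : ∀ w : SWire a F s, w.IsAux → w ∈ ({.mi}ᶜ : Set (SWire a F s)) := by
      rintro w hw rfl; exact hw
    exact wires_append (wires_zeroCirc hx (by simp)) (wires_zeroCirc hx (by simp))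
  obtain ⟨φ, hφG, hφB, hφn, hφ⟩ := amplify (f := fun j => (.flag 0 j : SWire a F s))
    (fun i j h => by simpa using h) hM hR (fun χ hχ => Inv.map aB hχ)
    (fun j χ hχ => Inv.map (acts_tr (show ((0 : Fin (n + 1)) : ℕ) ≤ 0 from le_rfl)) hχ)
    (fun j => (commute_tr_subProj fun i => by simp [wreg_apply]).symm)
    (fun j => commute_flag_subProj.symm) subProj_mul_self (selfAdj_proj _) selfAdj_subProj hψ hz
    (projReg_subProj 0 hz) hf
  have hout : proj (fun z => z (.flag 0 (Fin.last F)) = 1) (run (firstStage a F s) ψ) = φ := hφ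
  rw [hout, hφn]
  refine ⟨?_, rfl⟩
  intro Q hQ
  cases hQ with
  | clean => exact hφG _ .clean
  | vzero => exact hφG _ .vzero
  | mi => exact hφG _ .mi
  | data b i h => exact hφG _ (.data b i h)
  | anc b i h => exact hφG _ (.anc b i h)
  | flag b i h => exact hφG _ (.flag b i h)
  | sub b h => rwa [show b = 0 from Fin.ext (by simpa using h)]

/-- Two phase gates make Z, and HZH = X. -/
theorem run_flipGates {ι : Type} [DecidableEq ι] (w : ι) :
    run (flipGates w) = tr (Pi.single w 1) := by
  have h1 : (WGate.ph w).op * (WGate.ph w).op = (diag fun z => sgn (z w) : Op ι) := by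
    refine op_ext fun ψ z => ?_
    simp only [Module.End.mul_apply, WGate.op, LinearMap.coe_mk, AddHom.coe_mk, diag_apply, sgn]
    split_ifs
    · rw [← mul_assoc, Complex.I_mul_I]
    · simp
  have h2 : run (flipGates w) = (WGate.had w).op * ((WGate.ph w).op * (WGate.ph w).op) *
      (WGate.had w).op := by
    simp only [flipGates, run_cons, run_nil, one_mul, mul_assoc]
  have h3 : (WGate.had w).op * (diag fun z => sgn (z w))
      = tr (Pi.single w 1) * (WGate.had w).op := by
    refine op_ext fun ψ z => ?_
    have hu : ∀ b, Function.update (z + Pi.single w 1) w b = Function.update z w b := by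
      intro b
      funext i
      by_cases hi : i = w
      · subst hi; simp
      · simp [hi]
    simp only [Module.End.mul_apply, WGate.op, LinearMap.coe_mk, AddHom.coe_mk, diag_apply,
      tr_apply, hu, Function.update_self, sgn_zero, sgn_one, Pi.add_apply, Pi.single_eq_same,
      sgn_add]
    ring
  rw [h2, h1, h3, mul_assoc, had_mul_self, mul_one]

theorem tr_single {ι : Type} [DecidableEq ι] [Fintype ι] (u x : ι → ZMod 2) :
    tr u (Pi.single x 1 : St ι) = Pi.single (x + u) 1 := by
  funext z
  rw [tr_apply, Pi.single_apply, Pi.single_apply]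
  refine if_congr ⟨fun h => ?_, fun h => ?_⟩ rfl rfl
  · rw [← h, bits_add_add_self]
  · rw [h, bits_add_add_self]

theorem nrm_single {ι : Type} [DecidableEq ι] [Fintype ι] (x : ι → ZMod 2) :
    nrm (Pi.single x 1 : St ι) = 1 := by
  rw [nrm, Finset.sum_eq_single x]
  · simp
  · intro z _ hz
    simp [hz]
  · simp

/-- The basis state in which the constant wires are set. -/
def prepBits (a F : ℕ) (s : SerialNumber n) : SWire a F s → ZMod 2
  | .o1 => 1
  | .o2 => 1
  | .c j => if j = 0 then 1 else 0
  | .mi => 1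
  | _ => 0

variable (a F s) in
theorem run_prepGates : run (prepGates a F s) (Pi.single 0 1)
    = (WGate.had .mi).op (Pi.single (prepBits a F s) 1) := by
  rw [prepGates, run_append, run_append, run_append, run_append]
  simp only [run_flipGates, Module.End.mul_apply, tr_single, run_cons, run_nil,
    Module.End.one_apply]
  congr 2
  funext w
  cases w with
  | c j => by_cases h : j = 0 <;> simp [prepBits, h]
  | _ => simp [prepBits]

theorem prep_proj {p : (SWire a F s → ZMod 2) → Prop} (hp : p (prepBits a F s)) (h : Indep p .mi) :
    proj p (run (prepGates a F s) (Pi.single 0 1)) = run (prepGates a F s) (Pi.single 0 1) := by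
  rw [run_prepGates]
  refine Commute.fixed (commute_op_proj fun i hi => ?_) (proj_eq_self_iff.2 fun z hz => ?_)
  · rw [Set.mem_singleton_iff.1 hi]
    exact h
  · rw [Pi.single_apply, if_neg]
    rintro rfl
    exact hz hp

theorem prep_mem : run (prepGates a F s) (Pi.single 0 1) ∈ Inv a F (nCond n a s.m) S 0 0 := by
  intro A hA
  cases hA with
  | clean => exact prep_proj (by simp [Clean, prepBits]) (fun z b => by simp [Clean])
  | vzero => exact prep_proj (fun j _ => rfl) (fun z b => by simp [VZero])
  | mi =>
    rw [run_prepGates, LinearMap.neg_apply, neg_eq_iff_eq_neg]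
    funext z
    have hu : ∀ b, Function.update (z + Pi.single .mi 1) .mi b = Function.update z .mi b := by
      intro b
      funext i
      by_cases hi : i = .mi
      · subst hi; simp
      · simp [hi]
    have h0 : (Pi.single (prepBits a F s) 1 : St (SWire a F s)) (Function.update z .mi 0) = 0 := by
      rw [Pi.single_apply, if_neg]
      intro h
      have := congrFun h .mi
      simp [prepBits] at this
    simp only [tr_apply, WGate.op, LinearMap.coe_mk, AddHom.coe_mk, hu, h0, Pi.neg_apply,
      Pi.add_apply, Pi.single_eq_same, sgn_add, sgn_one]
    ring
  | data b i h => exact prep_proj rfl (indep_eq_of_ne (by simp) _)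
  | anc b i h => exact prep_proj rfl (indep_eq_of_ne (by simp) _)
  | flag b i h => exact prep_proj rfl (indep_eq_of_ne (by simp) _)
  | sub b h => exact absurd h (by simp)

/-- The property `p` says that the last flags of all stages so far are set. It depends on these
flags only, so it commutes with later stages and the success probabilities multiply. -/
theorem stages_spec (hp : ∀ x, (∀ i, MvPolynomial.eval x (s.p i) = 0) ↔ x ∈ S)
    (hq : ∀ y, (∀ i, MvPolynomial.eval y (s.q i) = 0) ↔ ∀ x ∈ S, x ⬝ᵥ y = 0)
    (gs : List (WGate (Fin (2 * n + a)))) (t : ℕ) (ht : t ≤ n) :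
    ∃ p : (SWire a F s → ZMod 2) → Prop,
      (∀ w, (∀ k : Fin (n + 1), k ≤ t → w ≠ .flag k (Fin.last F)) → Indep p w) ∧
      proj p (run (prepGates a F s ++ firstStage a F s ++ (List.finRange t).flatMap fun k =>
        stage F s gs (k.castLE ht)) (Pi.single 0 1)) ∈ Inv a F (nCond n a s.m) S t (t + 1) ∧
      nrm (proj p (run (prepGates a F s ++ firstStage a F s ++ (List.finRange t).flatMap fun k =>
        stage F s gs (k.castLE ht)) (Pi.single 0 1))) =
        (1 - (1 - guessProb S) * (2 * guessProb S - 1) ^ (2 * F)) *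
        (1 - (1 - pairProb gs S) * (2 * pairProb gs S - 1) ^ (2 * F)) ^ t := by
  induction t with
  | zero =>
    have h := firstStage_spec (a := a) (F := F) hp hq prep_mem
      (prep_proj (fun i => rfl) (fun z b => by simp))
      (fun j => prep_proj rfl (indep_eq_of_ne (by simp) _))
    rw [nrm_run, nrm_single, mul_one] at h
    refine ⟨fun z => z (.flag 0 (Fin.last F)) = 1, fun w hw => indep_eq_of_ne (hw 0 le_rfl) 1, ?_⟩
    simpa [run_append] using h
  | succ t ih =>
    obtain ⟨p, h1, h2, h3⟩ := ih (by omega)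
    set k : Fin n := ⟨t, ht⟩ with hk
    have h4 := stage_spec hp hq gs k h2
    -- The only flags in stage `k` are those with first index `k + 1`, while `p` depends on last
    -- flags with index at most `t = k`.
    have hc : Commute (run (stage F s gs k)) (proj p) := by
      refine commute_run_proj fun g hg w hw => h1 w fun i hi => ?_
      rintro rfl
      refine (?_ : ∀ g ∈ stage F s gs k, g.wires ⊆ {.flag i (Fin.last F)}ᶜ) g hg
        (g.mods_subset hw) rfl
      have hx : ∀ w : SWire a F s, w.IsAux → w ∈ ({.flag i (Fin.last F)}ᶜ : Set (SWire a F s)) := by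
        rintro w hw rfl; exact hw
      have hne : i ≠ k.succ := by
        rintro rfl
        simp [hk] at hi
      have hU : ∀ g ∈ copyGates F s gs k, g.wires ⊆ {.flag i (Fin.last F)}ᶜ :=
        wires_copyGates gs k (by simp) (by simp) (by simp)
      have hv : ∀ k' c c', ∀ g ∈ testOne a F s k' c c', g.wires ⊆ {.flag i (Fin.last F)}ᶜ :=
        fun k' c c' => wires_verifyCirc hx (by simp)
      have hm : ∀ j, ∀ g ∈ mark F s gs k j, g.wires ⊆ {.flag i (Fin.last F)}ᶜ := fun j =>
        wires_append hU (wires_append (wires_toggle hx (wires_append (hv _ _ _) (hv _ _ _))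
          (by simp [hne.symm])) (wires_invGates hU))
      refine wires_append (wires_append (hm _) (wires_flatMap fun j _ => wires_append ?_ (hm _))) hU
      exact wires_toggle hx (wires_append (wires_zeroCirc hx (by simp [hne.symm]))
        (wires_append (hv _ _ _) (wires_append (wires_zeroCirc hx (by simp))
          (wires_zeroCirc hx (by simp))))) (by simp)
    set χ := run (prepGates a F s ++ firstStage a F s ++ (List.finRange t).flatMap fun k =>
        stage F s gs (k.castLE (by omega))) (Pi.single 0 1) with hχ
    have hrun : run (prepGates a F s ++ firstStage a F s ++ (List.finRange (t + 1)).flatMap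
        fun k => stage F s gs (k.castLE ht)) (Pi.single 0 1) = run (stage F s gs k) χ := by
      rw [List.finRange_succ_last, List.flatMap_append, List.flatMap_map, List.flatMap_singleton,
        ← List.append_assoc, run_append, Module.End.mul_apply]
      rfl
    rw [hrun]
    refine ⟨fun z => z (.flag k.succ (Fin.last F)) = 1 ∧ p z, fun w hw z b => ?_, ?_⟩
    · exact and_congr (indep_eq_of_ne (hw k.succ (by simp [hk])) 1 z b)
        (h1 w (fun i hi => hw i (by omega)) z b)
    · rw [← proj_mul_proj, Module.End.mul_apply, ← Commute.apply_eq hc, h4.2, h3, pow_succ]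
      exact ⟨h4.1, by ring⟩

theorem allGates_spec (hp : ∀ x, (∀ i, MvPolynomial.eval x (s.p i) = 0) ↔ x ∈ S)
    (hq : ∀ y, (∀ i, MvPolynomial.eval y (s.q i) = 0) ↔ ∀ x ∈ S, x ⬝ᵥ y = 0)
    (gs : List (WGate (Fin (2 * n + a)))) :
    ∃ p : (SWire a F s → ZMod 2) → Prop,
      proj p (run (allGates F s gs) (Pi.single 0 1)) ∈ Inv a F (nCond n a s.m) S n (n + 1) ∧
      nrm (proj p (run (allGates F s gs) (Pi.single 0 1))) =
        (1 - (1 - guessProb S) * (2 * guessProb S - 1) ^ (2 * F)) *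
        (1 - (1 - pairProb gs S) * (2 * pairProb gs S - 1) ^ (2 * F)) ^ n := by
  obtain ⟨p, -, h⟩ := stages_spec (a := a) (F := F) hp hq gs n le_rfl
  exact ⟨p, h⟩

end

/-! ### Random elements of a subspace form a basis -/

theorem prod_two_pow_sub_succ (d : ℕ) : ∏ i ∈ Finset.range (d + 1), ((2 : ℝ) ^ (d + 1) - 2 ^ i) =
    (2 ^ (d + 1) - 1) * (2 ^ d * ∏ i ∈ Finset.range d, ((2 : ℝ) ^ d - 2 ^ i)) := by
  rw [Finset.prod_range_succ', pow_zero, mul_comm]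
  congr 1
  rw [Finset.prod_congr rfl fun i _ => show (2 : ℝ) ^ (d + 1) - 2 ^ (i + 1)
    = 2 * (2 ^ d - 2 ^ i) by ring, Finset.prod_mul_distrib]
  simp

theorem le_prod_two_pow_sub (d : ℕ) : ((2 : ℝ) ^ d) ^ d ≤
    4 * ∏ i ∈ Finset.range d, ((2 : ℝ) ^ d - 2 ^ i) := by
  -- The bound 1/4 alone does not pass through the induction. With y = 2^{d+1}, the stronger bound
  -- 1/4 + 1/(2y) for the proportion of bases does.
  have key : ∀ d : ℕ, ((2 : ℝ) ^ (d + 1) + 2) * (2 ^ (d + 1)) ^ (d + 1) ≤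
      4 * 2 ^ (d + 1) * ∏ i ∈ Finset.range (d + 1), ((2 : ℝ) ^ (d + 1) - 2 ^ i) := by
    intro d
    induction d with
    | zero => norm_num
    | succ d ih =>
      rw [prod_two_pow_sub_succ]
      set y : ℝ := 2 ^ (d + 1) with hy
      set P := ∏ i ∈ Finset.range (d + 1), (y - 2 ^ i)
      have hy2 : 2 ≤ y := by
        rw [hy, pow_succ]
        have : (1 : ℝ) ≤ 2 ^ d := one_le_pow₀ (by norm_num)
        linarith
      have e : (2 : ℝ) ^ (d + 1 + 1) = 2 * y := by rw [hy]; ring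
      have e2 : (2 * y) ^ (d + 1 + 1) = 2 * y ^ 2 * y ^ (d + 1) := by
        rw [mul_pow, pow_succ y, e]
        ring
      rw [e, e2]
      have h0 : 0 ≤ y ^ (d + 1) := by positivity
      have h1 : (2 * y - 1) * (y * 2) * ((y + 2) * y ^ (d + 1)) ≤
          (2 * y - 1) * (y * 2) * (4 * y * P) :=
        mul_le_mul_of_nonneg_left ih (by nlinarith)
      have h2 : 0 ≤ (y - 2) * (y * y ^ (d + 1)) := mul_nonneg (by linarith) (by positivity)
      nlinarith
  cases d with
  | zero => norm_num
  | succ d =>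
    have h := key d
    have hpos : (0 : ℝ) < 2 ^ (d + 1) := by positivity
    have h2 : (2 : ℝ) ^ (d + 1) * (2 ^ (d + 1)) ^ (d + 1) ≤ (2 ^ (d + 1)) * (4 *
        ∏ i ∈ Finset.range (d + 1), ((2 : ℝ) ^ (d + 1) - 2 ^ i)) := by
      have : 0 ≤ (2 : ℝ) * (2 ^ (d + 1)) ^ (d + 1) := by positivity
      linarith
    exact le_of_mul_le_mul_left h2 hpos

section

variable {n : ℕ} (S : Submodule (ZMod 2) (Fin n → ZMod 2)) (d : ℕ)

/-- A list of vectors is a basis of `S`. -/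
def IsBasisOf (V : Fin d → Fin n → ZMod 2) : Prop :=
  LinearIndependent (ZMod 2) V ∧ Submodule.span (ZMod 2) (Set.range V) = S

/-- The lists of elements of `S`. -/
def tuples : Finset (Fin d → Fin n → ZMod 2) := Fintype.piFinset fun _ => elems S

variable {S d}

theorem mem_tuples {V : Fin d → Fin n → ZMod 2} : V ∈ tuples S d ↔ ∀ b, V b ∈ S := by
  simp [tuples, Fintype.mem_piFinset]

theorem card_elems_eq (hd : Module.finrank (ZMod 2) S = d) : (elems S).card = 2 ^ d := by
  rw [card_elems, Module.natCard_eq_pow_finrank (K := ZMod 2), hd]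
  simp

open Classical in
theorem card_tuples_le (hd : Module.finrank (ZMod 2) S = d) :
    ((tuples S d).card : ℝ) ≤ 4 * ((tuples S d).filter (IsBasisOf S d)).card := by
  have h1 := card_linearIndependent (K := ZMod 2) (V := S) (k := d) hd.ge
  have h2 : Nat.card {v : Fin d → S // LinearIndependent (ZMod 2) v} ≤
      ((tuples S d).filter (IsBasisOf S d)).card := by
    rw [Nat.card_eq_fintype_card, ← Finset.card_univ]
    refine Finset.card_le_card_of_injOn (fun v b => (v.1 b : Fin n → ZMod 2)) ?_ ?_
    · intro v _
      have hs : Submodule.span (ZMod 2) (Set.range v.1) = ⊤ :=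
        v.2.span_eq_top_of_card_eq_finrank' (by simp [hd])
      rw [Finset.mem_coe, Finset.mem_filter, mem_tuples]
      refine ⟨fun b => (v.1 b).2, v.2.map' S.subtype S.ker_subtype, ?_⟩
      have : Set.range (fun b => (v.1 b : Fin n → ZMod 2)) = S.subtype '' Set.range v.1 := by
        rw [← Set.range_comp]; rfl
      rw [this, Submodule.span_image, hs, Submodule.map_top, Submodule.range_subtype]
    · intro v _ v' _ h
      refine Subtype.ext (funext fun b => Subtype.ext ?_)
      exact congrFun h b
  have h3 : (tuples S d).card = (2 ^ d) ^ d := by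
    simp [tuples, Fintype.card_piFinset, card_elems_eq hd]
  have h4 : ((∏ i : Fin d, (2 ^ d - 2 ^ (i : ℕ)) : ℕ) : ℝ)
      = ∏ i ∈ Finset.range d, ((2 : ℝ) ^ d - 2 ^ i) := by
    rw [← Fin.prod_univ_eq_prod_range (fun i => (2 : ℝ) ^ d - 2 ^ i), Nat.cast_prod]
    refine Finset.prod_congr rfl fun i _ => ?_
    rw [Nat.cast_sub (Nat.pow_le_pow_right (by norm_num) i.2.le)]
    push_cast
    rfl
  rw [h1] at h2
  have h5 : ((∏ i : Fin d, (2 ^ d - 2 ^ (i : ℕ)) : ℕ) : ℝ) ≤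
      ((tuples S d).filter (IsBasisOf S d)).card := by
    have e : Fintype.card (ZMod 2) = 2 := rfl
    rw [e, hd] at h2
    exact_mod_cast h2
  rw [h4] at h5
  rw [h3]
  push_cast
  linarith [le_prod_two_pow_sub d]

end

/-! ### Measuring copies of |S⟩ -/

section

variable {n a F T : ℕ} {S : Submodule (ZMod 2) (Fin n → ZMod 2)} {d : ℕ}

/-- The contents of the first `d` registers. -/
def regs (hd : d ≤ n + 1) (z : Wire n a F T → ZMod 2) : Fin d → Fin n → ZMod 2 :=
  fun b i => z (.data (b.castLE hd) i)

/-- A vector on all wires with given values on the registers. -/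
def padRegs (hd : d ≤ n + 1) (V : Fin d → Fin n → ZMod 2) : Wire n a F T → ZMod 2 :=
  ∑ b, pad (wreg a F T (b.castLE hd)) (V b)

theorem regs_add_padRegs (hd : d ≤ n + 1) (z : Wire n a F T → ZMod 2)
    (V : Fin d → Fin n → ZMod 2) : regs hd (z + padRegs hd V) = regs hd z + V := by
  funext b i
  simp only [regs, Pi.add_apply, padRegs, Finset.sum_apply]
  congr 1
  rw [Finset.sum_eq_single b]
  · exact pad_apply (wreg a F T (b.castLE hd)) (V b) i
  · intro b' _ hb
    refine pad_of_notMem ?_ _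
    rintro ⟨j, hj⟩
    rw [wreg_apply, Wire.data.injEq] at hj
    exact hb (Fin.castLE_injective hd hj.1)
  · simp

/-- A register in the state |S⟩ is unchanged by translations by S, and the registers can be
translated one after the other. -/
theorem apply_add_padRegs (hd : d ≤ n + 1) {φ : WSt n a F T} (hφ : φ ∈ Inv a F T S n (n + 1))
    {V : Fin d → Fin n → ZMod 2} (hV : ∀ b, V b ∈ S) (z : Wire n a F T → ZMod 2) :
    φ (z + padRegs hd V) = φ z := by
  unfold padRegs
  generalize (Finset.univ : Finset (Fin d)) = t
  induction t using Finset.induction_on with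
  | empty => simp
  | insert b t hb ih =>
    have h : subProj (wreg a F T (b.castLE hd)) S φ = φ := hφ _ (.sub _ (by simp; omega))
    rw [Finset.sum_insert hb, add_comm (pad _ _), ← add_assoc]
    conv_rhs => rw [← ih, ← h, ← tr_mul_subProj (hV b), Module.End.mul_apply, h]
    rfl

theorem regs_mem (hd : d ≤ n + 1) {φ : WSt n a F T} (hφ : φ ∈ Inv a F T S n (n + 1))
    {z : Wire n a F T → ZMod 2} (hz : φ z ≠ 0) (b : Fin d) : regs hd z b ∈ S := by
  have h : subProj (wreg a F T (b.castLE hd)) S φ = φ := hφ _ (.sub _ (by simp; omega))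
  by_contra hb
  rw [← h, subProj_apply] at hz
  exact hz (if_neg hb)

/-- The probability is averaged over all translations of the first `d` registers by tuples in S,
which leave the state unchanged. For each basis state in the support the translates run through all
tuples in S once, so the probability is the proportion of bases among the tuples. -/
theorem nrm_proj_basis (hd : d ≤ n + 1) {φ : WSt n a F T} (hφ : φ ∈ Inv a F T S n (n + 1))
    (hS : Module.finrank (ZMod 2) S = d) :
    nrm φ ≤ 4 * nrm (proj (fun z => IsBasisOf S d (regs hd z)) φ) := by
  classical
  have hE : (0 : ℝ) < (tuples S d).card := by
    exact_mod_cast Finset.card_pos.2 ⟨0, by simp [mem_tuples]⟩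
  have hn : nrm (proj (fun z => IsBasisOf S d (regs hd z)) φ)
      = ∑ z, if IsBasisOf S d (regs hd z) then ‖φ z‖ ^ 2 else 0 := by
    refine Finset.sum_congr rfl fun z _ => ?_
    rw [proj_apply]
    split_ifs <;> simp
  have h1 : ∀ V ∈ tuples S d, nrm (proj (fun z => IsBasisOf S d (regs hd z)) φ)
      = ∑ z, if IsBasisOf S d (regs hd z + V) then ‖φ z‖ ^ 2 else 0 := by
    intro V hV
    rw [hn, ← Equiv.sum_comp (Equiv.addRight (padRegs hd V))]
    refine Finset.sum_congr rfl fun z _ => ?_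
    rw [Equiv.coe_addRight, regs_add_padRegs, apply_add_padRegs hd hφ (mem_tuples.1 hV)]
  have h2 : (tuples S d).card * nrm (proj (fun z => IsBasisOf S d (regs hd z)) φ)
      = ((tuples S d).filter (IsBasisOf S d)).card * nrm φ := by
    rw [← nsmul_eq_mul, ← Finset.sum_const, Finset.sum_congr rfl h1, Finset.sum_comm, nrm,
      Finset.mul_sum]
    refine Finset.sum_congr rfl fun z _ => ?_
    by_cases hz : φ z = 0
    · simp [hz]
    · have hm := regs_mem hd hφ hz
      rw [← Finset.sum_filter, Finset.sum_const, nsmul_eq_mul]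
      congr 2
      refine Finset.card_nbij' (regs hd z + ·) (regs hd z + ·) ?_ ?_ ?_ ?_
      · intro V hV
        rw [Finset.mem_coe, Finset.mem_filter, mem_tuples] at hV ⊢
        exact ⟨fun b => S.add_mem (hm b) (hV.1 b), hV.2⟩
      · intro V hV
        rw [Finset.mem_coe, Finset.mem_filter, mem_tuples] at hV ⊢
        refine ⟨fun b => S.add_mem (hm b) (hV.1 b), ?_⟩
        rw [← add_assoc, show regs hd z + regs hd z = 0 by funext b i; simp, zero_add]
        exact hV.2
      all_goals
        intro V _
        simp only [← add_assoc]
        rw [show regs hd z + regs hd z = 0 by funext b i; simp, zero_add]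
  have h3 := mul_le_mul_of_nonneg_right (card_tuples_le hS) (nrm_nonneg φ)
  rw [mul_assoc, ← h2] at h3
  refine le_of_mul_le_mul_left ?_ hE
  linarith

end

/-! ### The circuit of the basis finder on numbered wires -/

section

variable {n a F T : ℕ}

/-- The number of the first constant wire. -/
abbrev constBase (n a F : ℕ) : ℕ := (n + 1) * n + n * a + (n + 1) * (F + 1)

/-- The number of wires. -/
abbrev wireCount (n a F T : ℕ) : ℕ := constBase n a F + 7 + T + (T + 1)

/-- The numbers of the wires. -/
def addr : Wire n a F T → ℕ
  | .data k i => k * n + i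
  | .anc k j => (n + 1) * n + (k * a + j)
  | .flag k j => (n + 1) * n + n * a + (k * (F + 1) + j)
  | .o1 => constBase n a F
  | .o2 => constBase n a F + 1
  | .mi => constBase n a F + 2
  | .s => constBase n a F + 3
  | .A => constBase n a F + 4
  | .B => constBase n a F + 5
  | .C => constBase n a F + 6
  | .v j => constBase n a F + 7 + j
  | .c j => constBase n a F + 7 + T + j

theorem mul_add_lt {K n : ℕ} (k : Fin K) (i : Fin n) : (k : ℕ) * n + i < K * n := by
  have := (finProdFinEquiv (k, i)).isLt
  simp [finProdFinEquiv] at this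
  linarith

theorem mul_add_inj {K n : ℕ} {k k' : Fin K} {i i' : Fin n} (h : (k : ℕ) * n + i = k' * n + i') :
    k = k' ∧ i = i' := by
  have : finProdFinEquiv (k, i) = finProdFinEquiv (k', i') := by
    apply Fin.ext
    simp only [finProdFinEquiv, Equiv.coe_fn_mk]
    linarith
  simpa using finProdFinEquiv.injective this

theorem addr_lt (w : Wire n a F T) : addr w < wireCount n a F T := by
  cases w with
  | data k i => have := mul_add_lt k i; simp only [addr, wireCount, constBase]; omega
  | anc k i => have := mul_add_lt k i; simp only [addr, wireCount, constBase]; omega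
  | flag k i => have := mul_add_lt k i; simp only [addr, wireCount, constBase]; omega
  | _ => simp only [addr, wireCount]; omega

/-- The blocks of numbers are disjoint, and within the two-index blocks division with remainder
recovers the indices. -/
theorem addr_injective : Function.Injective (addr : Wire n a F T → ℕ) := by
  have hb : ∀ w : Wire n a F T, match w with
      | .data _ _ => addr w < (n + 1) * n
      | .anc _ _ => (n + 1) * n ≤ addr w ∧ addr w < (n + 1) * n + n * a
      | .flag _ _ => (n + 1) * n + n * a ≤ addr w ∧ addr w < constBase n a F
      | .v _ => constBase n a F + 7 ≤ addr w ∧ addr w < constBase n a F + 7 + T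
      | _ => True := by
    intro w
    cases w with
    | data k i => exact mul_add_lt k i
    | anc k i => have := mul_add_lt k i; simp only [addr]; omega
    | flag k i => have := mul_add_lt k i; simp only [addr, constBase]; omega
    | v j => simp only [addr]; omega
    | _ => trivial
  intro w w' h
  have h1 := hb w
  have h2 := hb w'
  cases w <;> cases w' <;> simp only [addr, constBase] at h h1 h2 <;>
    first
    | rfl
    | omega
    | (have h3 := mul_add_inj (Nat.add_left_cancel h); rw [h3.1, h3.2])
    | (have h3 := mul_add_inj h; rw [h3.1, h3.2])
    | (congr 1; apply Fin.ext; omega)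

/-- The wires as qubits of a circuit. -/
def addrEmb (w N : ℕ) (h : wireCount n a F T ≤ N) : Wire n a F T ↪ Fin (w * n + N) :=
  ⟨fun x => ⟨addr x, by have := addr_lt x; omega⟩, fun x y h =>
    addr_injective (by simpa using h)⟩

end

/-! ### The basis finder as a circuit on qubits -/

section

variable {n : ℕ}

theorem slice_single {ι κ : Type} [DecidableEq ι] [Fintype ι] [DecidableEq κ] [Fintype κ]
    (e : κ ↪ ι) : slice e 0 (Pi.single 0 1 : St ι) = Pi.single 0 1 := by
  funext x
  rw [slice, Pi.single_apply, Pi.single_apply]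
  refine if_congr ⟨fun h => ?_, fun h => ?_⟩ rfl rfl
  · funext i
    rw [← e.injective.extend_apply x 0 i, h]
    rfl
  · subst h
    funext w
    by_cases hw : ∃ i, e i = w
    · obtain ⟨i, rfl⟩ := hw
      rw [e.injective.extend_apply]
      rfl
    · rw [Function.extend_apply' _ _ _ hw]

/-- A circuit on the wires as a circuit on registers and ancillas. -/
def wireCircuit {a F T : ℕ} (w N : ℕ) (h : wireCount n a F T ≤ N)
    (gs : List (WGate (Wire n a F T))) : QCircuit w n where
  ancillas := N
  gates := gs.map fun g => (g.map (addrEmb w N h)).toGate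

/-- There may be more qubits than wires. The surplus ones are never touched and stay zero, so the
slice where they vanish carries the state of the wires. -/
theorem slice_run_wireCircuit {a F T w N : ℕ} (h : wireCount n a F T ≤ N)
    (gs : List (WGate (Wire n a F T))) :
    slice (addrEmb w N h) 0 ((wireCircuit w N h gs).run (Pi.single 0 1))
      = run gs (Pi.single 0 1) := by
  have h1 : (wireCircuit w N h gs).gates.map WGate.ofGate
      = gs.map (WGate.map (addrEmb w N h)) := by
    refine (List.map_map ..).trans ?_
    exact List.map_congr_left fun g _ => WGate.ofGate_toGate _
  rw [QCircuit.run_eq, h1]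
  exact (slice_run _ _ _ _).trans (congrArg _ (slice_single _))

open Classical in
-- The registers come first in the numbering, so output register `b` is register `b` of the finder.
-- The sum on the right is restricted to the basis states that are zero on the surplus qubits.
theorem sum_basis_ge {a F T w N : ℕ} {h : wireCount n a F T ≤ N}
    {gs : List (WGate (Wire n a F T))} {Q : QCircuit w n} (hQ : Q = wireCircuit w N h gs)
    (hw : w ≤ n + 1)
    (S : Submodule (ZMod 2) (Fin n → ZMod 2)) :
    nrm (proj (fun z => IsBasisOf S w (regs hw z)) (run gs (Pi.single 0 1))) ≤
      ∑ x, if LinearIndependent (ZMod 2) (reg x) ∧ Submodule.span (ZMod 2) (Set.range (reg x)) = S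
        then ‖Q.run (Pi.single 0 1) x‖ ^ 2 else 0 := by
  subst hQ
  set e := addrEmb w N h with he
  set Φ : St (Fin (w * n + N)) := (wireCircuit w N h gs).run (Pi.single 0 1) with hΦ
  have hr : ∀ z : Wire n a F T → ZMod 2,
      reg (n := n) (w := w) (a := N) (Function.extend e z 0) = regs hw z := by
    intro z
    funext b i
    have : wire N b i = e (.data (b.castLE hw) i) := by
      apply Fin.ext
      simp [wire, he, addrEmb, addr]
      ring
    rw [reg, this]
    exact e.injective.extend_apply _ _ _
  have hinj : Function.Injective fun z : Wire n a F T → ZMod 2 =>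
      (Function.extend e z 0 : Fin (w * n + N) → ZMod 2) := fun x y h => by
    funext i
    rw [← e.injective.extend_apply x 0 i, ← e.injective.extend_apply y 0 i]
    exact congrFun h _
  have h2 : nrm (proj (fun z => IsBasisOf S w (regs hw z)) (run gs (Pi.single 0 1))) =
      ∑ z : Wire n a F T → ZMod 2, if LinearIndependent (ZMod 2) (reg (Function.extend e z 0)) ∧
        Submodule.span (ZMod 2) (Set.range (reg (n := n) (w := w) (Function.extend e z 0))) = S
        then ‖Φ (Function.extend e z 0)‖ ^ 2 else 0 := by
    rw [← slice_run_wireCircuit (w := w) h]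
    refine Finset.sum_congr rfl fun z _ => ?_
    rw [proj_apply, hr]
    by_cases hz : IsBasisOf S w (regs hw z)
    · rw [if_pos hz]
      exact (if_pos hz).symm
    · rw [if_neg hz, norm_zero, zero_pow two_ne_zero]
      exact (if_neg hz).symm
  rw [h2]
  refine (Finset.sum_map Finset.univ ⟨_, hinj⟩ fun x : Fin (w * n + N) → ZMod 2 => if
      LinearIndependent (ZMod 2) (reg x) ∧ Submodule.span (ZMod 2) (Set.range (reg x)) = S
      then ‖Φ x‖ ^ 2 else 0).symm.trans_le ?_
  refine Finset.sum_le_sum_of_subset_of_nonneg (Finset.subset_univ _) fun x _ _ => ?_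
  split_ifs <;> positivity

/-- The basis finder for a counterfeiter with a given number of rounds of amplification. -/
def basisFinder (C : QAlgorithm fun _ => 2) (K : Polynomial ℕ) : QAlgorithm fun n => n / 2 :=
  fun n s => wireCircuit (n / 2) _ le_rfl
    (allGates (K.eval n) s ((C n s).gates.map WGate.ofGate))

theorem basisProb_ge (C : QAlgorithm fun _ => 2) (K : Polynomial ℕ) (B : Banknote n) :
    nrm (proj (fun z : SWire (C n B.serial).ancillas (K.eval n) B.serial → ZMod 2 =>
        IsBasisOf B.S (n / 2) (regs (by omega) z))
      (run (allGates (K.eval n) B.serial ((C n B.serial).gates.map WGate.ofGate))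
        (Pi.single 0 1))) ≤ basisProb (basisFinder C K) B := by
  have hQ : basisFinder C K n B.serial = wireCircuit (n / 2) _ le_rfl
      (allGates (K.eval n) B.serial ((C n B.serial).gates.map WGate.ofGate)) := rfl
  rw [basisProb]
  have h := sum_basis_ge (w := n / 2) hQ (by omega) B.S
  refine (le_of_eq ?_).trans (h.trans (le_of_eq ?_))
  · congr 1
  · rfl

theorem counterfeitProb_eq (C : QAlgorithm fun _ => 2) (B : Banknote n) :
    counterfeitProb C B = pairProb ((C n B.serial).gates.map WGate.ofGate) B.S := by
  rw [counterfeitProb, pairProb, nrm]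
  simp only [verify_eq B.p_zeros B.q_zeros]
  rw [QCircuit.run_eq]

end

/-! ### Success probabilities -/

theorem one_sub_pow_mul_le {x : ℝ} (h0 : 0 ≤ x) (h1 : x ≤ 1) (F : ℕ) :
    (1 - x) ^ F * (1 + F * x) ≤ 1 := by
  have h2 : (1 + F * x) ≤ (1 + x) ^ F := one_add_mul_le_pow (by linarith) F
  have h3 : 0 ≤ (1 - x) ^ F := pow_nonneg (by linarith) F
  calc _ ≤ (1 - x) ^ F * (1 + x) ^ F := mul_le_mul_of_nonneg_left h2 h3
    _ = (1 - x ^ 2) ^ F := by rw [← mul_pow]; ring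
    _ ≤ 1 := pow_le_one₀ (by nlinarith) (by nlinarith)

theorem two_mul_sub_one_pow (ε : ℝ) (F : ℕ) :
    (2 * ε - 1) ^ (2 * F) = (1 - 4 * ε * (1 - ε)) ^ F := by
  rw [pow_mul]
  congr 1
  ring

/-- With x = 4ε(1-ε) the left side is (1-x)^F · Fx, which is at most 1 by Bernoulli's inequality:
the failure probability is at most 1/(4Fε). -/
theorem fail_mul_le {ε : ℝ} (h0 : 0 ≤ ε) (h1 : ε ≤ 1) (F : ℕ) :
    (1 - ε) * (2 * ε - 1) ^ (2 * F) * (4 * F * ε) ≤ 1 := by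
  have hx1 : 4 * ε * (1 - ε) ≤ 1 := by nlinarith [sq_nonneg (2 * ε - 1)]
  have hx0 : 0 ≤ 4 * ε * (1 - ε) := mul_nonneg (by linarith) (by linarith)
  have h := one_sub_pow_mul_le hx0 hx1 F
  rw [two_mul_sub_one_pow]
  have h3 : 0 ≤ (1 - 4 * ε * (1 - ε)) ^ F := pow_nonneg (by linarith) F
  nlinarith

/-- A sharper form for small `F q`, where the failure probability is close to 1. For q ≤ 1/2 one has
4q(1-q) ≥ 2q. The case q = 1 (n = 0) is trivial, since then the first factor vanishes. -/
theorem fail_mul_le' {q : ℝ} (h0 : 0 ≤ q) (h1 : q ≤ 1 / 2 ∨ q = 1) (F : ℕ) :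
    (1 - q) * (2 * q - 1) ^ (2 * F) * (1 + 2 * F * q) ≤ 1 := by
  rcases h1 with h1 | rfl
  · have hx1 : 4 * q * (1 - q) ≤ 1 := by nlinarith [sq_nonneg (2 * q - 1)]
    have hx0 : 2 * q ≤ 4 * q * (1 - q) := by nlinarith
    have h := one_sub_pow_mul_le (by linarith) hx1 F
    rw [two_mul_sub_one_pow]
    have h3 : 0 ≤ (1 - 4 * q * (1 - q)) ^ F := pow_nonneg (by linarith) F
    have h4 : (1 - 4 * q * (1 - q)) ^ F * (1 + F * (2 * q)) ≤
        (1 - 4 * q * (1 - q)) ^ F * (1 + F * (4 * q * (1 - q))) := by gcongr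
    have h5 : 0 ≤ (1 - 4 * q * (1 - q)) ^ F * (1 + F * (2 * q)) := by positivity
    have h6 : (1 - 4 * q * (1 - q)) ^ F * (1 + F * (2 * q)) ≤ 1 := h4.trans h
    nlinarith
  · norm_num

theorem exists_polynomial_bound (p : Polynomial ℕ) :
    ∃ κ : ℝ, 0 ≤ κ ∧ ∀ n : ℕ, ((p.eval n : ℕ) : ℝ) * (2 : ℝ) ^ (-(n : ℝ) / 2) ≤ κ := by
  induction p using Polynomial.induction_on' with
  | add p q hp hq =>
    obtain ⟨κ, h0, h⟩ := hp
    obtain ⟨κ', h0', h'⟩ := hq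
    refine ⟨κ + κ', add_nonneg h0 h0', fun n => ?_⟩
    rw [Polynomial.eval_add, Nat.cast_add, add_mul]
    exact add_le_add (h n) (h' n)
  | monomial k c =>
    have h1 : (1 : ℝ) < Real.sqrt 2 := by
      rw [Real.lt_sqrt] <;> norm_num
    obtain ⟨M, hM⟩ := (tendsto_pow_const_div_const_pow_of_one_lt k h1).bddAbove_range
    have hM' : ∀ n : ℕ, (n : ℝ) ^ k / Real.sqrt 2 ^ n ≤ M := fun n => hM ⟨n, rfl⟩
    have hM0 : 0 ≤ M := le_trans (by positivity) (hM' 0)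
    refine ⟨c * M, by positivity, fun n => ?_⟩
    have h2 : (2 : ℝ) ^ (-(n : ℝ) / 2) = (Real.sqrt 2 ^ n)⁻¹ := by
      rw [Real.sqrt_eq_rpow, ← Real.rpow_natCast, ← Real.rpow_mul (by norm_num),
        ← Real.rpow_neg (by norm_num)]
      congr 1
      ring
    rw [Polynomial.eval_monomial, h2]
    push_cast
    rw [mul_assoc, ← div_eq_mul_inv]
    exact mul_le_mul_of_nonneg_left (hM' n) (by positivity)

/-! ### From a single banknote to a bank -/

section

variable {n : ℕ}

theorem finrank_eq (B : Banknote n) : Module.finrank (ZMod 2) B.S = n / 2 := by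
  have := B.dim_S
  omega

theorem guessProb_eq_pow (B : Banknote n) : guessProb B.S = ((1 : ℝ) / 2) ^ (n / 2) := by
  rw [guessProb, card_elems_eq (finrank_eq B)]
  simp

theorem guessProb_eq (B : Banknote n) : guessProb B.S = (2 : ℝ) ^ (-(n : ℝ) / 2) := by
  have h : (n : ℝ) = 2 * (n / 2 : ℕ) := by
    have h1 := B.dim_S
    have h2 := finrank_eq B
    have : n = 2 * (n / 2) := by omega
    exact_mod_cast this
  rw [guessProb_eq_pow, h, show -(2 * ((n / 2 : ℕ) : ℝ)) / 2 = -((n / 2 : ℕ) : ℝ) by ring,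
    Real.rpow_neg (by norm_num), Real.rpow_natCast]
  simp

theorem pairProb_le_one {a : ℕ} (gs : List (WGate (Fin (2 * n + a))))
    (S : Submodule (ZMod 2) (Fin n → ZMod 2)) : pairProb gs S ≤ 1 := by
  rw [← nrm_input (a := a) S, ← nrm_run gs]
  exact (selfAdj_subProj.nrm_le subProj_mul_self _).trans
    (selfAdj_subProj.nrm_le subProj_mul_self _)

/-- The flags need not be measured: the event of success is a property of basis states, so
restricting to it only lowers the probability of reading off a basis. -/
theorem basisProb_ge_mul (C : QAlgorithm fun _ => 2) (K : Polynomial ℕ) (B : Banknote n) :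
    (1 - (1 - guessProb B.S) * (2 * guessProb B.S - 1) ^ (2 * K.eval n)) *
      (1 - (1 - counterfeitProb C B) * (2 * counterfeitProb C B - 1) ^ (2 * K.eval n)) ^ n ≤
    4 * basisProb (basisFinder C K) B := by
  obtain ⟨p, h1, h2⟩ := allGates_spec (a := (C n B.serial).ancillas) (F := K.eval n)
    B.p_zeros B.q_zeros ((C n B.serial).gates.map WGate.ofGate)
  have h3 := nrm_proj_basis (d := n / 2) (by omega) h1 (finrank_eq B)
  rw [counterfeitProb_eq, ← h2]
  refine h3.trans (mul_le_mul_of_nonneg_left ?_ (by norm_num))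
  rw [Commute.apply_eq (commute_proj_proj _ _)]
  exact (nrm_proj_le _ _).trans (basisProb_ge C K B)

theorem basisProb_ge_of_counterfeitProb {C : QAlgorithm fun _ => 2} {K : Polynomial ℕ} {r : ℕ}
    (hr : 0 < r) (hK : K.eval n = r * (n + 1)) {κ : ℝ}
    (hκ : ((K.eval n : ℕ) : ℝ) * (2 : ℝ) ^ (-(n : ℝ) / 2) ≤ κ) {B : Banknote n}
    (hB : 1 / (2 * r) ≤ counterfeitProb C B) :
    r * (2 : ℝ) ^ (-(n : ℝ) / 2) / (4 * (1 + 2 * κ)) ≤ basisProb (basisFinder C K) B := by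
  have h := basisProb_ge_mul C K B
  rw [← guessProb_eq B] at hκ ⊢
  have hε1 : counterfeitProb C B ≤ 1 := by
    rw [counterfeitProb_eq]; exact pairProb_le_one _ _
  have hr' : (0 : ℝ) < r := by exact_mod_cast hr
  have hq0 : 0 < guessProb B.S := by rw [guessProb_eq_pow]; positivity
  have hq1 : guessProb B.S ≤ 1 / 2 ∨ guessProb B.S = 1 := by
    rw [guessProb_eq_pow]
    rcases Nat.eq_zero_or_pos (n / 2) with h | h
    · right; rw [h, pow_zero]
    · left
      calc ((1 : ℝ) / 2) ^ (n / 2) ≤ (1 / 2) ^ 1 :=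
            pow_le_pow_of_le_one (by norm_num) (by norm_num) h
        _ = 1 / 2 := pow_one _
  have hF : ((K.eval n : ℕ) : ℝ) = r * (n + 1) := by rw [hK]; push_cast; ring
  have hε0 : 0 ≤ counterfeitProb C B := le_trans (by positivity) hB
  have f1 := fail_mul_le hε0 hε1 (K.eval n)
  have f2 := fail_mul_le' hq0.le hq1 (K.eval n)
  set q := guessProb B.S with hq
  set ε := counterfeitProb C B with hε
  set x := (1 - ε) * (2 * ε - 1) ^ (2 * K.eval n) with hx
  set y := (1 - q) * (2 * q - 1) ^ (2 * K.eval n) with hy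
  have hx0 : 0 ≤ x := by
    rw [hx, pow_mul]
    exact mul_nonneg (by linarith) (by positivity)
  -- From ε ≥ 1/(2r) and F = r(n+1). Each copying stage then fails with probability x ≤ 1/(2(n+1)),
  -- and (1-x)^n ≥ 1 - nx ≥ 1/2.
  have hFε : 2 * ((n : ℝ) + 1) ≤ 4 * ((K.eval n : ℕ) : ℝ) * ε := by
    rw [hF]
    have : 1 ≤ 2 * r * ε := by
      rw [div_le_iff₀ (by positivity)] at hB
      linarith
    nlinarith
  have hxn : n * x ≤ 1 / 2 := by nlinarith
  have hx1 : x ≤ 1 := by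
    have : 0 ≤ (n : ℝ) := by positivity
    nlinarith
  have hδ : 1 / 2 ≤ (1 - x) ^ n := by
    have := one_add_mul_le_pow (a := -x) (by linarith) n
    rw [← sub_eq_add_neg] at this
    linarith
  have hκ0 : 0 < 1 + 2 * κ := by
    have : 0 ≤ ((K.eval n : ℕ) : ℝ) * q := by positivity
    linarith
  -- With u = Fq, the bound y(1 + 2u) ≤ 1 gives 1 - y ≥ 2u/(1 + 2u); then u ≥ rq is used in the
  -- numerator and u ≤ κ in the denominator.
  have hδ0 : 2 * r * q / (1 + 2 * κ) ≤ 1 - y := by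
    rw [div_le_iff₀ hκ0]
    have e : r * q ≤ ((K.eval n : ℕ) : ℝ) * q := by
      rw [hF]
      refine mul_le_mul_of_nonneg_right ?_ hq0.le
      have : 0 ≤ (n : ℝ) := by positivity
      nlinarith
    have hu : 0 ≤ ((K.eval n : ℕ) : ℝ) * q := by positivity
    set u : ℝ := ((K.eval n : ℕ) : ℝ) * q with hu'
    have f2' : y * (1 + 2 * u) ≤ 1 := by rw [hu']; linarith
    have hy1 : y ≤ 1 := by
      by_contra hy1
      push Not at hy1
      nlinarith
    nlinarith
  have hpos : 0 ≤ 2 * r * q / (1 + 2 * κ) := by positivity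
  have h4 : 2 * r * q / (1 + 2 * κ) * (1 / 2) ≤ 4 * basisProb (basisFinder C K) B :=
    (mul_le_mul hδ0 hδ (by norm_num) (hpos.trans hδ0)).trans h
  have e : r * q / (4 * (1 + 2 * κ)) = 2 * r * q / (1 + 2 * κ) * (1 / 2) / 4 := by
    field_simp
    try ring
  rw [e]
  linarith

theorem average_mul_const (bank : PMF (Banknote n)) (f : Banknote n → ℝ) (c : ℝ≥0∞) :
    ∑' B, bank B * (ENNReal.ofReal (f B) * c) = average bank f * c := by
  rw [average, ← ENNReal.tsum_mul_right]
  simp only [mul_assoc]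

theorem basisProb_nonneg (D : QAlgorithm fun n => n / 2) (B : Banknote n) : 0 ≤ basisProb D B := by
  classical
  refine Finset.sum_nonneg fun x _ => ?_
  split_ifs <;> positivity

theorem average_basisProb_ge {C : QAlgorithm fun _ => 2} {K : Polynomial ℕ} {r : ℕ}
    (hK : K.eval n = r * (n + 1)) {κ : ℝ} (hκ0 : 0 ≤ κ)
    (hκ : ((K.eval n : ℕ) : ℝ) * (2 : ℝ) ^ (-(n : ℝ) / 2) ≤ κ) {bank : PMF (Banknote n)}
    (hC : (r : ℝ≥0∞)⁻¹ ≤ average bank (counterfeitProb C)) :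
    ENNReal.ofReal (1 / (8 * (1 + 2 * κ)) * (2 : ℝ) ^ (-(n : ℝ) / 2)) ≤
      average bank (basisProb (basisFinder C K)) := by
  have hle1 : ∀ B : Banknote n, counterfeitProb C B ≤ 1 := fun B => by
    rw [counterfeitProb_eq]; exact pairProb_le_one _ _
  -- For `r = 0` the inverse in `ℝ≥0∞` is `⊤`, which no average of probabilities reaches.
  have hr : 0 < r := by
    by_contra hr
    obtain rfl : r = 0 := by omega
    have h1 : average bank (counterfeitProb C) ≤ 1 := by
      rw [average, ← bank.tsum_coe]
      refine ENNReal.tsum_le_tsum fun B => ?_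
      exact mul_le_of_le_one_right' (ENNReal.ofReal_le_one.2 (hle1 B))
    have := hC.trans h1
    simp at this
  have hr' : (0 : ℝ) < r := by exact_mod_cast hr
  set q : ℝ := (2 : ℝ) ^ (-(n : ℝ) / 2) with hq
  have hq0 : 0 < q := by positivity
  set b : ℝ := r * q / (4 * (1 + 2 * κ)) with hb
  have hb0 : 0 < b := by positivity
  -- If ε ≥ 1/(2r), the basis probability is at least b and the first summand is at least 1;
  -- otherwise the second summand suffices. This linear inequality can be averaged as it stands.
  have key : ∀ B : Banknote n, ENNReal.ofReal (counterfeitProb C B) ≤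
      ENNReal.ofReal (basisProb (basisFinder C K) B) * ENNReal.ofReal (1 / b) +
        ENNReal.ofReal (1 / (2 * r)) := by
    intro B
    have hn := basisProb_nonneg (basisFinder C K) B
    rw [← ENNReal.ofReal_mul hn, ← ENNReal.ofReal_add (by positivity) (by positivity)]
    refine ENNReal.ofReal_le_ofReal ?_
    rcases le_total (counterfeitProb C B) (1 / (2 * r)) with h | h
    · have : 0 ≤ basisProb (basisFinder C K) B * (1 / b) := by positivity
      linarith
    · have h1 := basisProb_ge_of_counterfeitProb hr hK hκ h
      have h2 : 1 ≤ basisProb (basisFinder C K) B * (1 / b) := by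
        rw [mul_one_div, le_div_iff₀ hb0, one_mul]
        exact h1
      have h3 : (0 : ℝ) ≤ 1 / (2 * r) := by positivity
      linarith [hle1 B]
  have h1 : average bank (counterfeitProb C) ≤ average bank (basisProb (basisFinder C K)) *
      ENNReal.ofReal (1 / b) + ENNReal.ofReal (1 / (2 * r)) := by
    rw [← average_mul_const]
    calc average bank (counterfeitProb C) ≤ ∑' B, (bank B *
          (ENNReal.ofReal (basisProb (basisFinder C K) B) * ENNReal.ofReal (1 / b)) +
          bank B * ENNReal.ofReal (1 / (2 * r))) := by
          refine ENNReal.tsum_le_tsum fun B => ?_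
          rw [← mul_add]
          exact mul_le_mul_right (key B) _
      _ = _ := by
          rw [ENNReal.tsum_add, ENNReal.tsum_mul_right, bank.tsum_coe, one_mul]
  have h2 := hC.trans h1
  by_cases htop : average bank (basisProb (basisFinder C K)) = ⊤
  · rw [htop]; exact le_top
  rw [ENNReal.ofReal_le_iff_le_toReal htop]
  have h3 := ENNReal.toReal_mono (ENNReal.add_ne_top.2 ⟨ENNReal.mul_ne_top htop
    ENNReal.ofReal_ne_top, ENNReal.ofReal_ne_top⟩) h2
  rw [ENNReal.toReal_add (ENNReal.mul_ne_top htop ENNReal.ofReal_ne_top) ENNReal.ofReal_ne_top,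
    ENNReal.toReal_mul, ENNReal.toReal_ofReal (by positivity),
    ENNReal.toReal_ofReal (by positivity), ENNReal.toReal_inv, ENNReal.toReal_natCast] at h3
  set x := (average bank (basisProb (basisFinder C K))).toReal
  have h4 : (r : ℝ)⁻¹ - 1 / (2 * r) = 1 / (2 * r) := by field_simp; norm_num
  have h5 : 1 / (2 * r) ≤ x * (1 / b) := by linarith
  rw [mul_one_div, le_div_iff₀ hb0] at h5
  have h6 : 1 / (8 * (1 + 2 * κ)) * q = 1 / (2 * r) * b := by
    rw [hb]; field_simp; norm_num
  rw [h6]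
  exact h5

theorem exists_basisFinder (C : QAlgorithm fun _ => 2)
    (hC : ∀ K, (basisFinder C K).PolyTime) (r : Polynomial ℕ) :
    ∃ D : QAlgorithm fun n => n / 2, D.PolyTime ∧
      ∃ c : ℝ, 0 < c ∧ ∀ (n : ℕ) (bank : PMF (Banknote n)),
        ((r.eval n : ℕ) : ℝ≥0∞)⁻¹ ≤ average bank (counterfeitProb C) →
        ENNReal.ofReal (c * (2 : ℝ) ^ (-(n : ℝ) / 2)) ≤ average bank (basisProb D) := by
  -- The factor `X + 1` makes the failures of all n copying stages add up to at most 1/2; the factor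
  -- `r` serves both the weak counterfeiter and the gain by r in the first stage.
  set K : Polynomial ℕ := r * (Polynomial.X + 1) with hK
  obtain ⟨κ, h0, h⟩ := exists_polynomial_bound K
  refine ⟨basisFinder C K, hC K, 1 / (8 * (1 + 2 * κ)), by positivity, fun n bank hb => ?_⟩
  exact average_basisProb_ge (by simp [hK]) h0 (h n) hb

end

/-! ### Generating circuits in polynomial time -/

section

variable {β : Type} {env : List (β → List Bool)}

/-- The proof of `f b < g b` makes elements of `Fin` available in the branch. The stack that is
tested contains only `true`s, so the middle branch is never entered. -/
theorem PolyFn.dite_lt {f g : β → ℕ} (hf : PolyNat env f) (hg : PolyNat env g)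
    {x : ∀ b, f b < g b → List Bool}
    (hx : PolyFn (env.map fun e (q : {b // f b < g b}) => e q.1) fun q => x q.1 q.2) :
    PolyFn env fun b => if h : f b < g b then x b h else [] := by
  have hc : PolyFn env fun b => List.replicate (g b - f b) true := hg.sub hf
  refine PolyMany.trim (hc.trans ?_)
  obtain ⟨P, t, hP⟩ := hx.weaken [fun q => List.replicate (g q.1 - f q.1) true]
  obtain ⟨Q, u, hQ⟩ := PolyFn.nil (env := env ++ [fun b => List.replicate (g b - f b) true])
  refine ⟨.branch env.length Q P P, t + u + 1, fun b => ?_⟩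
  have h0 : st (ev (env ++ [fun b => List.replicate (g b - f b) true]) b) env.length
      = List.replicate (g b - f b) true := by simp [st]
  simp only [Polynomial.eval_add, Polynomial.eval_one]
  by_cases hb : f b < g b
  · obtain ⟨k, hk, hkt⟩ := hP ⟨b, hb⟩
    obtain ⟨l, hl⟩ : ∃ l, g b - f b = l + 1 := ⟨g b - f b - 1, by omega⟩
    have he : ev (env.map fun e (q : {b // f b < g b}) => e q.1) ⟨b, hb⟩ = ev env b := by simp [ev]
    rw [hl, List.replicate_succ] at h0
    refine ⟨k + 1, .branch_true h0 (by simpa [he, hb] using hk), ?_⟩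
    simp [he] at hkt ⊢
    omega
  · obtain ⟨k, hk, hkt⟩ := hQ b
    rw [Nat.sub_eq_zero_of_le (by omega)] at h0
    refine ⟨k + 1, .branch_nil h0 (by simpa [hb] using hk), ?_⟩
    omega

theorem flatMap_range_dite {γ : Type} {N : ℕ} (g : Fin N → List γ) :
    ((List.range N).flatMap fun i => if h : i < N then g ⟨i, h⟩ else [])
      = (List.finRange N).flatMap g := by
  rw [← List.map_coe_finRange_eq_range, List.flatMap_map]
  simp

/-- A context extended by a number below a bound in unary notation. -/
def extFin (env : List (β → List Bool)) (N : β → ℕ) : List ((Σ b, Fin (N b)) → List Bool) :=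
  env.map (fun e p => e p.1) ++ [fun p => List.replicate p.2 true]

variable {N : β → ℕ}

theorem PolyFn.liftFin {f : β → List Bool} (hf : PolyFn env f) :
    PolyFn (extFin env N) fun p => f p.1 := by
  refine hf.call (fun p : Σ b, Fin (N b) => p.1) fun e he => PolyFn.var ?_
  exact List.mem_append_left _ (List.mem_map_of_mem he)

theorem PolyNat.liftFin {f : β → ℕ} (hf : PolyNat env f) : PolyNat (extFin env N) fun p => f p.1 :=
  PolyFn.liftFin hf

theorem PolyNat.indexFin : PolyNat (extFin env N) fun p => (p.2 : ℕ) :=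
  PolyFn.var (by simp [extFin])

theorem PolyFn.finRange (hN : PolyNat env N) {g : ∀ b, Fin (N b) → List Bool}
    (hg : PolyFn (extFin env N) fun p => g p.1 p.2) :
    PolyFn env fun b => (List.finRange (N b)).flatMap (g b) := by
  have h := PolyFn.dite_lt (env := ext env) (f := fun p => p.2) (g := fun p => N p.1)
    PolyNat.index hN.lift (x := fun p h => g p.1 ⟨p.2, h⟩) (by
      refine hg.call (fun q : {p : β × ℕ // p.2 < N p.1} => ⟨q.1.1, ⟨q.1.2, q.2⟩⟩) fun e he =>
        PolyFn.var ?_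
      simp only [extFin, ext, List.mem_append, List.mem_map, List.mem_singleton] at he ⊢
      rcases he with ⟨e, he, rfl⟩ | rfl
      · exact ⟨_, Or.inl ⟨e, he, rfl⟩, rfl⟩
      · exact ⟨_, Or.inr rfl, rfl⟩)
  exact (PolyFn.range hN (g := fun b i => if h : i < N b then g b ⟨i, h⟩ else []) h).congr
    fun b => (flatMap_range_dite _).symm

theorem PolyNat.ite_lt {f g x y : β → ℕ} (hf : PolyNat env f) (hg : PolyNat env g)
    (hx : PolyNat env x) (hy : PolyNat env y) : PolyNat env fun b => if f b < g b then x b else y b :=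
  (PolyFn.ite_lt hf hg hx hy).congr fun b => by beta_reduce; split_ifs <;> rfl

theorem PolyNat.congr {f g : β → ℕ} (hf : PolyNat env f) (h : ∀ a, g a = f a) : PolyNat env g := by
  rwa [show g = f from funext h]

theorem PolyFn.hadCode {u : β → ℕ} (hu : PolyNat env u) :
    PolyFn env fun b => unary 0 ++ unary (u b) := (PolyNat.const 0).unary.append hu.unary

theorem PolyFn.phCode {u : β → ℕ} (hu : PolyNat env u) :
    PolyFn env fun b => unary 1 ++ unary (u b) := (PolyNat.const 1).unary.append hu.unary

theorem PolyFn.tofCode {u v w : β → ℕ} (hu : PolyNat env u) (hv : PolyNat env v)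
    (hw : PolyNat env w) :
    PolyFn env fun b => unary 2 ++ unary (u b) ++ unary (v b) ++ unary (w b) :=
  (((PolyNat.const 2).unary.append hu.unary).append hv.unary).append hw.unary

end

/-- The coefficients in the code of a serial number. -/
def SerialNumber.bits {n : ℕ} (s : SerialNumber n) : List Bool :=
  (List.finRange s.m).flatMap (fun i => encodePoly (s.p i))
    ++ (List.finRange s.m).flatMap (fun i => encodePoly (s.q i))

/-! ### Positions of the coefficients in the code of a serial number -/

theorem SerialNumber.encode_eq {n : ℕ} (s : SerialNumber n) :
    s.encode = unary n ++ (unary s.m ++ s.bits) := by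
  simp [SerialNumber.encode, SerialNumber.bits]

theorem length_flatMap_finRange {γ : Type} {N L : ℕ} {f : Fin N → List γ}
    (hf : ∀ i, (f i).length = L) : ((List.finRange N).flatMap f).length = N * L := by
  simp [List.length_flatMap, hf]

theorem getElem?_flatMap_finRange {γ : Type} {N L : ℕ} {f : Fin N → List γ}
    (hf : ∀ i, (f i).length = L) (i : Fin N) {j : ℕ} (hj : j < L) :
    ((List.finRange N).flatMap f)[i * L + j]? = (f i)[j]? := by
  induction N with
  | zero => exact i.elim0
  | succ N ih =>
    rw [List.finRange_succ, List.flatMap_cons, List.flatMap_map]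
    cases i using Fin.cases with
    | zero => rw [List.getElem?_append_left (by simp [hf, hj])]; simp
    | succ i =>
      rw [List.getElem?_append_right (by rw [hf, Fin.val_succ, Nat.succ_mul]; omega), hf,
        show (i.succ : ℕ) * L + j - L = i * L + j by rw [Fin.val_succ, Nat.succ_mul]; omega]
      exact ih (fun i => hf i.succ) i

theorem length_encodePoly {n : ℕ} (f : MvPolynomial (Fin n) (ZMod 2)) :
    (encodePoly f).length = (n + 1) * ((n + 1) * (n + 1)) :=
  length_flatMap_finRange fun _ => length_flatMap_finRange fun _ => by simp

theorem getElem?_encodePoly {n : ℕ} (f : MvPolynomial (Fin n) (ZMod 2)) (u v w : Fin (n + 1)) :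
    (encodePoly f)[(u : ℕ) * ((n + 1) * (n + 1)) + (v * (n + 1) + w)]?
      = some (decide (f.coeff (factor u + factor v + factor w) = 1)) := by
  rw [encodePoly, getElem?_flatMap_finRange (L := (n + 1) * (n + 1))
    (fun _ => length_flatMap_finRange fun _ => by simp) u (mul_add_lt v w),
    getElem?_flatMap_finRange (fun _ => by simp) v w.isLt, List.getElem?_map,
    List.getElem?_eq_getElem (by simp; omega)]
  simp

/-- The position of a coefficient in the code of a list of polynomials. -/
def coeffPos (n i u v w : ℕ) : ℕ :=
  i * ((n + 1) * ((n + 1) * (n + 1))) + (u * ((n + 1) * (n + 1)) + (v * (n + 1) + w))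

theorem getElem?_encodePolys {n m : ℕ} (p : Fin m → MvPolynomial (Fin n) (ZMod 2)) (i : Fin m)
    (u v w : Fin (n + 1)) :
    ((List.finRange m).flatMap fun i => encodePoly (p i))[coeffPos n i u v w]?
      = some (decide ((p i).coeff (factor u + factor v + factor w) = 1)) := by
  have h1 := mul_add_lt v w
  have h2 := mul_add_lt u ⟨_, h1⟩
  rw [coeffPos, getElem?_flatMap_finRange (fun _ => length_encodePoly _) i h2, getElem?_encodePoly]

/-- The offset `0` gives this the same form as the statement for the second list of polynomials, so
that one circuit generator serves both. -/
theorem SerialNumber.getElem?_bits_p {n : ℕ} (s : SerialNumber n) (i : Fin s.m)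
    (u v w : Fin (n + 1)) : s.bits[0 + coeffPos n i u v w]?
      = some (decide ((s.p i).coeff (factor u + factor v + factor w) = 1)) := by
  have h := getElem?_encodePolys s.p i u v w
  rw [SerialNumber.bits, Nat.zero_add, List.getElem?_append_left, h]
  by_contra hlt
  rw [List.getElem?_eq_none (by omega)] at h
  simp at h

theorem SerialNumber.getElem?_bits_q {n : ℕ} (s : SerialNumber n) (i : Fin s.m)
    (u v w : Fin (n + 1)) :
    s.bits[s.m * ((n + 1) * ((n + 1) * (n + 1))) + coeffPos n i u v w]?
      = some (decide ((s.q i).coeff (factor u + factor v + factor w) = 1)) := by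
  have hl := length_flatMap_finRange (f := fun i => encodePoly (s.p i)) fun _ => length_encodePoly _
  rw [SerialNumber.bits, List.getElem?_append_right (by rw [hl]; omega), hl,
    Nat.add_sub_cancel_left, getElem?_encodePolys]

/-- The number of the wire of copy `k` of a counterfeiter that belongs to qubit `w`. -/
def copyNum (n a k w : ℕ) : ℕ :=
  if w < 2 * n then k * n + w else (n + 1) * n + (k * a + (w - 2 * n))

/-- Registers `k` and `k + 1` have consecutive numbers, so the first `2 * n` qubits of a copy are
merely shifted by `k * n`; the ancillas are moved to their own block. -/
theorem addr_copyEmb {n a F T : ℕ} (k : Fin n) (x : Fin (2 * n + a)) :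
    addr (copyEmb a F (T := T) k x) = copyNum n a k x := by
  have hw : ∀ b (i : Fin n), ((wire a b i : Fin (2 * n + a)) : ℕ) = i + n * b := fun b i => by
    simp [wire, finProdFinEquiv]
  refine copy_cases (P := fun x => addr (copyEmb a F (T := T) k x) = copyNum n a k x) a
    (fun i => ?_) (fun i => ?_) (fun j => ?_) x
  · change addr (copyWire a F k _) = _
    rw [copyWire_zero, copyNum, hw, if_pos (by simp; omega)]
    simp [addr]
  · change addr (copyWire a F k _) = _
    rw [copyWire_one, copyNum, hw, if_pos (by simp; omega)]
    simp [addr]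
    ring
  · change addr (copyWire a F k _) = _
    rw [copyWire_anc, copyNum, if_neg (by simp)]
    simp [addr]

/-- The data from which the circuit of a basis finder is generated. -/
structure Inputs where
  n : ℕ
  a : ℕ
  F : ℕ
  s : SerialNumber n
  gs : List (WGate (Fin (2 * n + a)))

/-- The data are computable in polynomial time. -/
structure Known {β : Type} (env : List (β → List Bool)) (D : β → Inputs) : Prop where
  n : PolyNat env fun b => (D b).n
  a : PolyNat env fun b => (D b).a
  F : PolyNat env fun b => (D b).F
  m : PolyNat env fun b => (D b).s.m
  bits : PolyFn env fun b => (D b).s.bits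
  gs : PolyFn env fun b => codes Fin.val (D b).gs

/-- The type of the wires of the circuit of a basis finder. -/
abbrev Inputs.W (d : Inputs) : Type := SWire d.a d.F d.s

/-- The number of a wire is computable in polynomial time. -/
def PolyWire {β : Type} (env : List (β → List Bool)) (D : β → Inputs)
    (w : ∀ b, (D b).W) : Prop :=
  PolyNat env fun b => addr (w b)

/-- The code of a circuit is computable in polynomial time. -/
def PolyGates {β : Type} (env : List (β → List Bool)) (D : β → Inputs)
    (gs : ∀ b, List (WGate (D b).W)) : Prop :=
  PolyFn env fun b => codes addr (gs b)

namespace Known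

variable {β : Type} {env : List (β → List Bool)} {D : β → Inputs}

theorem liftFin (K : Known env D) {N : β → ℕ} : Known (extFin env N) fun p => D p.1 :=
  ⟨K.n.liftFin, K.a.liftFin, K.F.liftFin, K.m.liftFin, K.bits.liftFin, K.gs.liftFin⟩

theorem base (K : Known env D) : PolyNat env fun b => constBase (D b).n (D b).a (D b).F :=
  ((K.n.add (.const 1)).mul K.n |>.add (K.n.mul K.a)).add
    ((K.n.add (.const 1)).mul (K.F.add (.const 1)))

theorem T (K : Known env D) : PolyNat env fun b => nCond (D b).n (D b).a (D b).s.m :=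
  ((((PolyNat.const 4).mul K.m).add K.n).add K.a).add (.const 1)

theorem data (K : Known env D) {k : ∀ b, Fin ((D b).n + 1)} (hk : PolyNat env fun b => (k b : ℕ))
    {i : ∀ b, Fin (D b).n} (hi : PolyNat env fun b => (i b : ℕ)) :
    PolyWire env D fun b => .data (k b) (i b) := (hk.mul K.n).add hi

theorem anc (K : Known env D) {k : ∀ b, Fin (D b).n} (hk : PolyNat env fun b => (k b : ℕ))
    {i : ∀ b, Fin (D b).a} (hi : PolyNat env fun b => (i b : ℕ)) :
    PolyWire env D fun b => .anc (k b) (i b) :=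
  ((K.n.add (.const 1)).mul K.n).add ((hk.mul K.a).add hi)

theorem flag (K : Known env D) {k : ∀ b, Fin ((D b).n + 1)} (hk : PolyNat env fun b => (k b : ℕ))
    {i : ∀ b, Fin ((D b).F + 1)} (hi : PolyNat env fun b => (i b : ℕ)) :
    PolyWire env D fun b => .flag (k b) (i b) :=
  (((K.n.add (.const 1)).mul K.n).add (K.n.mul K.a)).add ((hk.mul (K.F.add (.const 1))).add hi)

theorem o1 (K : Known env D) : PolyWire env D fun _ => .o1 := K.base
theorem o2 (K : Known env D) : PolyWire env D fun _ => .o2 := K.base.add (.const 1)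
theorem mi (K : Known env D) : PolyWire env D fun _ => .mi := K.base.add (.const 2)
theorem sw (K : Known env D) : PolyWire env D fun _ => .s := K.base.add (.const 3)
theorem wA (K : Known env D) : PolyWire env D fun _ => .A := K.base.add (.const 4)
theorem wB (K : Known env D) : PolyWire env D fun _ => .B := K.base.add (.const 5)
theorem wC (K : Known env D) : PolyWire env D fun _ => .C := K.base.add (.const 6)

theorem v (K : Known env D) {j : ∀ b, Fin (nCond (D b).n (D b).a (D b).s.m)}
    (hj : PolyNat env fun b => (j b : ℕ)) : PolyWire env D fun b => .v (j b) :=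
  (K.base.add (.const 7)).add hj

theorem c (K : Known env D) {j : ∀ b, Fin (nCond (D b).n (D b).a (D b).s.m + 1)}
    (hj : PolyNat env fun b => (j b : ℕ)) : PolyWire env D fun b => .c (j b) :=
  ((K.base.add (.const 7)).add K.T).add hj

end Known

namespace PolyGates

variable {β : Type} {env : List (β → List Bool)} {D : β → Inputs}

theorem nil : PolyGates env D fun _ => [] := PolyFn.nil

theorem append {gs hs : ∀ b, List (WGate (D b).W)} (hg : PolyGates env D gs)
    (hh : PolyGates env D hs) : PolyGates env D fun b => gs b ++ hs b :=
  (PolyFn.append hg hh).congr fun _ => codes_append _ _ _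

theorem cons {g : ∀ b, WGate (D b).W} {gs : ∀ b, List (WGate (D b).W)}
    (hg : PolyFn env fun b => (g b).code addr) (hgs : PolyGates env D gs) :
    PolyGates env D fun b => g b :: gs b :=
  (PolyFn.append hg hgs).congr fun _ => codes_cons _ _ _

theorem had {u : ∀ b, (D b).W} (hu : PolyWire env D u) {gs : ∀ b, List (WGate (D b).W)}
    (hgs : PolyGates env D gs) : PolyGates env D fun b => .had (u b) :: gs b :=
  .cons (PolyFn.hadCode hu) hgs

theorem ph {u : ∀ b, (D b).W} (hu : PolyWire env D u) {gs : ∀ b, List (WGate (D b).W)}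
    (hgs : PolyGates env D gs) : PolyGates env D fun b => .ph (u b) :: gs b :=
  .cons (PolyFn.phCode hu) hgs

theorem tof {u v w : ∀ b, (D b).W} (hu : PolyWire env D u) (hv : PolyWire env D v)
    (hw : PolyWire env D w) {huv : ∀ b, u b ≠ v b} {huw : ∀ b, u b ≠ w b} {hvw : ∀ b, v b ≠ w b}
    {gs : ∀ b, List (WGate (D b).W)} (hgs : PolyGates env D gs) :
    PolyGates env D fun b => .tof (u b) (v b) (w b) (huv b) (huw b) (hvw b) :: gs b :=
  .cons (PolyFn.tofCode hu hv hw) hgs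

theorem flatMap {N : β → ℕ} (hN : PolyNat env N) {gs : ∀ b, Fin (N b) → List (WGate (D b).W)}
    (h : PolyGates (extFin env N) (fun p => D p.1) fun p => gs p.1 p.2) :
    PolyGates env D fun b => (List.finRange (N b)).flatMap (gs b) :=
  (PolyFn.finRange hN (g := fun b i => codes addr (gs b i)) h).congr fun _ => codes_flatMap _ _ _

theorem inv {gs : ∀ b, List (WGate (D b).W)} (h : PolyGates env D gs) :
    PolyGates env D fun b => invGates (gs b) :=
  (PolyFn.invCode h).congr fun _ => (invCode_codes _ _).symm

theorem congr {gs hs : ∀ b, List (WGate (D b).W)} (h : PolyGates env D gs)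
    (he : ∀ b, hs b = gs b) : PolyGates env D hs := by rwa [show hs = gs from funext he]

end PolyGates

/-! ### Generating the components of the circuit -/

namespace Known

variable {β : Type} {env : List (β → List Bool)} {D : β → Inputs}

theorem mono (K : Known env D) {j : ∀ b, Fin (nCond (D b).n (D b).a (D b).s.m)}
    (hj : PolyNat env fun b => (j b : ℕ))
    {x y w : ∀ b, Src (D b).n (D b).a (D b).F (nCond (D b).n (D b).a (D b).s.m)}
    (hx : PolyWire env D fun b => (x b).1) (hy : PolyWire env D fun b => (y b).1)
    (hw : PolyWire env D fun b => (w b).1) :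
    PolyGates env D fun b => mono (j b) (x b, y b, w b) := by
  have h := K.v hj
  exact .tof hx K.o1 K.wA <| .tof hy K.o1 K.wB <| .tof hw K.o1 K.wC <| .tof K.wA K.wB K.sw <|
    .tof K.sw K.wC h <| .tof K.wA K.wB K.sw <| .tof hw K.o1 K.wC <| .tof hy K.o1 K.wB <|
    .tof hx K.o1 K.wA .nil

theorem srcOf (K : Known env D) {k : ∀ b, Fin ((D b).n + 1)} (hk : PolyNat env fun b => (k b : ℕ))
    {x : ∀ b, Fin ((D b).n + 1)} (hx : PolyNat env fun b => (x b : ℕ)) :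
    PolyWire env D fun b => (srcOf (k b) (x b)).1 := by
  -- Index 0 stands for the constant 1, carried by `o2`; index i + 1 stands for the variable with
  -- number i.
  refine (PolyNat.ite_lt (.const 0) hx ((hk.mul K.n).add (hx.sub (.const 1))) K.o2).congr fun b => ?_
  beta_reduce
  generalize x b = y
  cases y using Fin.cases with
  | zero => simp [HiddenSubspace.srcOf]
  | succ i => simp [HiddenSubspace.srcOf, addr]

theorem polyCirc (K : Known env D) {k : ∀ b, Fin ((D b).n + 1)}
    (hk : PolyNat env fun b => (k b : ℕ)) {j : ∀ b, Fin (nCond (D b).n (D b).a (D b).s.m)}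
    (hj : PolyNat env fun b => (j b : ℕ)) {p : ∀ b, MvPolynomial (Fin (D b).n) (ZMod 2)}
    {pos i : β → ℕ} (hpos : PolyNat env pos) (hi : PolyNat env i)
    (hp : ∀ b (u v w : Fin ((D b).n + 1)), (D b).s.bits[pos b + coeffPos (D b).n (i b) u v w]?
      = some (decide ((p b).coeff (factor u + factor v + factor w) = 1))) :
    PolyGates env D fun b => polyCirc (j b) (terms (k b) (p b)) := by
  have hn := K.n.add (.const 1)
  simp only [HiddenSubspace.polyCirc, terms, List.flatMap_assoc]
  refine .flatMap hn (.flatMap hn.liftFin (.flatMap hn.liftFin.liftFin ?_))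
  have K3 := ((K.liftFin (N := fun b => (D b).n + 1)).liftFin (N := fun p => (D p.1).n + 1)).liftFin
    (N := fun p => (D p.1.1).n + 1)
  have hk3 := ((hk.liftFin (N := fun b => (D b).n + 1)).liftFin
    (N := fun p => (D p.1).n + 1)).liftFin (N := fun p => (D p.1.1).n + 1)
  have hj3 := ((hj.liftFin (N := fun b => (D b).n + 1)).liftFin
    (N := fun p => (D p.1).n + 1)).liftFin (N := fun p => (D p.1.1).n + 1)
  have hi3 := ((hi.liftFin (N := fun b => (D b).n + 1)).liftFin
    (N := fun p => (D p.1).n + 1)).liftFin (N := fun p => (D p.1.1).n + 1)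
  have hpos3 := ((hpos.liftFin (N := fun b => (D b).n + 1)).liftFin
    (N := fun p => (D p.1).n + 1)).liftFin (N := fun p => (D p.1.1).n + 1)
  have hu := ((PolyNat.indexFin (env := env) (N := fun b => (D b).n + 1)).liftFin
    (N := fun p => (D p.1).n + 1)).liftFin (N := fun p => (D p.1.1).n + 1)
  have hv := (PolyNat.indexFin (env := extFin env fun b => (D b).n + 1)
    (N := fun p => (D p.1).n + 1)).liftFin (N := fun p => (D p.1.1).n + 1)
  have hw := PolyNat.indexFin (env := extFin (extFin env fun b => (D b).n + 1)
    fun p => (D p.1).n + 1) (N := fun p => (D p.1.1).n + 1)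
  have hn3 := K3.n.add (.const 1)
  have hc := hpos3.add ((hi3.mul (hn3.mul (hn3.mul hn3))).add ((hu.mul (hn3.mul hn3)).add
    ((hv.mul hn3).add hw)))
  have hm := K3.mono hj3 (K3.srcOf hk3 hu) (K3.srcOf hk3 hv) (K3.srcOf hk3 hw)
  -- Only strict comparisons are available, so unsorted triples are rejected by v < u and w < v;
  -- then the coefficient bit decides.
  refine (PolyFn.ite_lt hv hu .nil (PolyFn.ite_lt hw hv .nil
    (PolyFn.ite_bit K3.bits hc hm .nil))).congr fun b => ?_
  obtain ⟨⟨⟨b, u⟩, v⟩, w⟩ := b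
  have := hp b u v w
  rw [coeffPos] at this
  simp only [this]
  by_cases h1 : u ≤ v <;> by_cases h2 : v ≤ w <;>
    by_cases h3 : (p b).coeff (factor u + factor v + factor w) = 1 <;>
    simp [h1, h2, h3, not_lt.2, not_le.1]

theorem hads (K : Known env D) {k : ∀ b, Fin ((D b).n + 1)}
    (hk : PolyNat env fun b => (k b : ℕ)) : PolyGates env D fun b => hads (regList (k b)) := by
  refine (PolyGates.flatMap K.n (gs := fun b i => [.had (.data (k b) i)])
    (.had (K.liftFin.data hk.liftFin .indexFin) .nil)).congr fun b => ?_
  rw [HiddenSubspace.hads, regList, List.map_map, List.map_eq_flatMap]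
  rfl

theorem verifyCirc (K : Known env D) {k : ∀ b, Fin ((D b).n + 1)}
    (hk : PolyNat env fun b => (k b : ℕ))
    {j j' : ∀ b, Fin (D b).s.m → Fin (nCond (D b).n (D b).a (D b).s.m)}
    (hj : PolyNat (extFin env fun b => (D b).s.m) fun p => (j p.1 p.2 : ℕ))
    (hj' : PolyNat (extFin env fun b => (D b).s.m) fun p => (j' p.1 p.2 : ℕ)) :
    PolyGates env D fun b => verifyCirc (D b).s (k b) (j b) (j' b) := by
  have hn := K.n.add (.const 1)
  have hp : PolyGates env D fun b => polysCirc (k b) (D b).s.p (j b) :=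
    .flatMap K.m (K.liftFin.polyCirc hk.liftFin hj (.const 0) .indexFin
      fun p => (D p.1).s.getElem?_bits_p p.2)
  have hq : PolyGates env D fun b => polysCirc (k b) (D b).s.q (j' b) :=
    .flatMap K.m (K.liftFin.polyCirc hk.liftFin hj' (K.m.mul (hn.mul (hn.mul hn))).liftFin .indexFin
      fun p => (D p.1).s.getElem?_bits_q p.2)
  exact hp.append (((K.hads hk).append hq).append (K.hads hk))

theorem testOne (K : Known env D) {k : ∀ b, Fin ((D b).n + 1)}
    (hk : PolyNat env fun b => (k b : ℕ)) (c c' : Fin 4) :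
    PolyGates env D fun b => testOne (D b).a (D b).F (D b).s (k b) c c' :=
  K.verifyCirc hk (((PolyNat.const c).mul K.liftFin.m).add .indexFin)
    (((PolyNat.const c').mul K.liftFin.m).add .indexFin)

theorem testReg (K : Known env D) {k : ∀ b, Fin ((D b).n + 1)}
    (hk : PolyNat env fun b => (k b : ℕ)) :
    PolyGates env D fun b => testReg (D b).a (D b).F (D b).s (k b) :=
  .flatMap K.n ((K.liftFin.mono (((PolyNat.const 4).mul K.liftFin.m).add .indexFin)
    (K.liftFin.data hk.liftFin .indexFin) K.liftFin.o2 K.liftFin.o2).append .nil)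

theorem testAnc (K : Known env D) {k : ∀ b, Fin (D b).n}
    (hk : PolyNat env fun b => (k b : ℕ)) :
    PolyGates env D fun b => testAnc (D b).a (D b).F (D b).s (k b) :=
  .flatMap K.a ((K.liftFin.mono
    ((((PolyNat.const 4).mul K.liftFin.m).add K.liftFin.n).add .indexFin)
    (K.liftFin.anc hk.liftFin .indexFin) K.liftFin.o2 K.liftFin.o2).append .nil)

theorem testFlag (K : Known env D) {k : ∀ b, Fin ((D b).n + 1)}
    (hk : PolyNat env fun b => (k b : ℕ)) {j : ∀ b, Fin ((D b).F + 1)}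
    (hj : PolyNat env fun b => (j b : ℕ)) :
    PolyGates env D fun b => testFlag (D b).a (D b).F (D b).s (k b) (j b) :=
  ((K.mono ((((PolyNat.const 4).mul K.m).add K.n).add K.a) (K.flag hk hj) K.o2 K.o2).append
    .nil).append .nil

theorem toggle (K : Known env D) {gs : ∀ b, List (WGate (D b).W)} (h : PolyGates env D gs)
    {t : ∀ b, (D b).W} (ht : PolyWire env D t) {h1 : ∀ b, .c (Fin.last _) ≠ t b}
    {h2 : ∀ b, .o1 ≠ t b} : PolyGates env D fun b => toggle (gs b) (t b) (h1 b) (h2 b) := by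
  have hc : PolyGates env D fun b => chain (nCond (D b).n (D b).a (D b).s.m) := by
    refine (PolyGates.flatMap K.T (gs := fun b j => chainStep j) ?_).congr fun b =>
      flatMap_range_dite _
    have hv := K.liftFin.v (PolyNat.indexFin (env := env)
      (N := fun b => nCond (D b).n (D b).a (D b).s.m))
    exact .tof K.liftFin.o1 K.liftFin.o2 hv <| .tof (K.liftFin.c .indexFin) hv
      (K.liftFin.c (PolyNat.indexFin.add (.const 1))) .nil
  exact (((h.append hc).append (.tof (K.c K.T) K.o1 ht .nil))).append (h.append hc).inv

theorem lift (K : Known env D) : Known (ext env) fun p => D p.1 :=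
  ⟨K.n.lift, K.a.lift, K.F.lift, K.m.lift, K.bits.lift, K.gs.lift⟩

theorem copyNum (K : Known env D) {k w : β → ℕ} (hk : PolyNat env k) (hw : PolyNat env w) :
    PolyNat env fun b => copyNum (D b).n (D b).a (k b) (w b) := by
  have h2 := (PolyNat.const 2).mul K.n
  exact .ite_lt hw h2 ((hk.mul K.n).add hw)
    (((K.n.add (.const 1)).mul K.n).add ((hk.mul K.a).add (hw.sub h2)))

/-- The gates of the counterfeiter are known only through their code, which is parsed gate by gate
and written out again with renumbered wires. -/
theorem copyGates (K : Known env D) {k : ∀ b, Fin (D b).n} (hk : PolyNat env fun b => (k b : ℕ)) :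
    PolyGates env D fun b => copyGates (D b).F (D b).s (D b).gs (k b) := by
  refine PolyFn.congr (f := fun b => mapCode (codes Fin.val (D b).gs)
    (fun w => unary 0 ++ unary (HiddenSubspace.copyNum (D b).n (D b).a (k b) w))
    (fun w => unary 1 ++ unary (HiddenSubspace.copyNum (D b).n (D b).a (k b) w))
    (fun u v w => unary 2 ++ unary (HiddenSubspace.copyNum (D b).n (D b).a (k b) u)
      ++ unary (HiddenSubspace.copyNum (D b).n (D b).a (k b) v) ++ unary (HiddenSubspace.copyNum (D b).n (D b).a (k b) w)))
    ?_ fun b => ?_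
  · refine PolyFn.flatMap K.gs ?_
    have hy := PolyFn.iterate_dropGate K.gs.lift PolyNat.index
    have h1 := K.lift.copyNum hk.lift (PolyNat.lead hy.skipUnary)
    have h2 := K.lift.copyNum hk.lift (PolyNat.lead hy.skipUnary.skipUnary)
    have h3 := K.lift.copyNum hk.lift (PolyNat.lead hy.skipUnary.skipUnary.skipUnary)
    exact PolyFn.onGate hy (.hadCode h1) (.phCode h1) (.tofCode h1 h2 h3)
  · beta_reduce
    rw [mapCode_codes, HiddenSubspace.copyGates, codes, List.flatMap_map]
    congr 1
    funext g
    cases g <;> simp [WGate.map, WGate.code, WGate.elim, addr_copyEmb]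

theorem mark (K : Known env D) {k : ∀ b, Fin (D b).n} (hk : PolyNat env fun b => (k b : ℕ))
    {j : ∀ b, Fin ((D b).F + 1)} (hj : PolyNat env fun b => (j b : ℕ)) :
    PolyGates env D fun b => mark (D b).F (D b).s (D b).gs (k b) (j b) := by
  have hk' := hk.add (.const 1)
  have hc := K.copyGates hk
  exact hc.append ((K.toggle ((K.testOne hk 0 1).append (K.testOne hk' 2 3)) (K.flag hk' hj)).append
    hc.inv)

theorem reflect (K : Known env D) {k : ∀ b, Fin (D b).n} (hk : PolyNat env fun b => (k b : ℕ))
    {j : ∀ b, Fin (D b).F} (hj : PolyNat env fun b => (j b : ℕ)) :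
    PolyGates env D fun b => reflect (D b).a (D b).F (D b).s (k b) (j b) := by
  have hk' := hk.add (.const 1)
  exact K.toggle ((K.testFlag hk' hj).append ((K.testOne hk 0 1).append
    ((K.testReg hk').append (K.testAnc hk)))) K.mi

theorem stage (K : Known env D) {k : ∀ b, Fin (D b).n} (hk : PolyNat env fun b => (k b : ℕ)) :
    PolyGates env D fun b => stage (D b).F (D b).s (D b).gs (k b) := by
  have K' := K.liftFin (N := fun b => (D b).F)
  have hk' := hk.liftFin (N := fun b => (D b).F)
  have hj := PolyNat.indexFin (env := env) (N := fun b => (D b).F)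
  have hz : PolyNat env fun b => ((0 : Fin ((D b).F + 1)) : ℕ) := .const 0
  have h1 := K'.reflect hk' hj
  have h2 := K'.mark hk' (j := fun p => p.2.succ) (hj.add (.const 1))
  have h3 := PolyGates.flatMap K.F (gs := fun b j =>
    HiddenSubspace.reflect (D b).a (D b).F (D b).s (k b) j ++
      HiddenSubspace.mark (D b).F (D b).s (D b).gs (k b) j.succ) (h1.append h2)
  exact ((K.mark hk hz).append h3).append (K.copyGates hk)

theorem firstStage (K : Known env D) :
    PolyGates env D fun b => firstStage (D b).a (D b).F (D b).s := by
  have h0 : PolyNat env fun b => ((0 : Fin ((D b).n + 1)) : ℕ) := .const 0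
  refine PolyGates.append (K.toggle (K.testOne h0 0 1) (K.flag h0 (.const 0))) (.flatMap K.F ?_)
  exact (K.liftFin.toggle ((K.liftFin.testFlag h0.liftFin .indexFin).append
    (K.liftFin.testReg h0.liftFin)) K.liftFin.mi).append
    (K.liftFin.toggle (K.liftFin.testOne h0.liftFin 0 1)
      (K.liftFin.flag h0.liftFin (PolyNat.indexFin.add (.const 1))))

theorem flipGates {w : ∀ b, (D b).W} (hw : PolyWire env D w) :
    PolyGates env D fun b => flipGates (w b) :=
  .had hw <| .ph hw <| .ph hw <| .had hw .nil

theorem allGates (K : Known env D) :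
    PolyGates env D fun b => allGates (D b).F (D b).s (D b).gs := by
  have h0 : PolyGates env D fun b => prepGates (D b).a (D b).F (D b).s :=
    ((((flipGates K.o1).append (flipGates K.o2)).append
      (flipGates (K.c (.const 0)))).append (flipGates K.mi)).append (.had K.mi .nil)
  exact (h0.append K.firstStage).append (.flatMap K.n (K.liftFin.stage .indexFin))

end Known

theorem codes_map_toGate {ι : Type} {N : ℕ} (e : ι ↪ Fin N) (gs : List (WGate ι)) :
    (gs.map fun g => (g.map e).toGate).flatMap Gate.encode = codes (fun i => (e i : ℕ)) gs := by
  rw [List.flatMap_map, codes]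
  congr 1
  funext g
  rw [WGate.encode_eq, WGate.ofGate_toGate, WGate.code_map]
  rfl

/-- The generator of the counterfeiter is called as a subroutine on the same serial number. Parsing
its output and the serial number provides all of `Known`, from which the number of ancillas and the
gates are written. -/
theorem polyTime_basisFinder {C : QAlgorithm fun _ => 2} (hC : C.PolyTime) (K : Polynomial ℕ) :
    (basisFinder C K).PolyTime := by
  obtain ⟨P, t, hP⟩ := hC
  let e : (Σ n, SerialNumber n) → List Bool := fun x => x.2.encode
  have hCode : PolyFn [e] fun x => (C x.1 x.2).encode := PolyFn.of_runs P t fun x => hP x.1 x.2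
  have he : PolyFn [e] fun x => unary x.1 ++ (unary x.2.m ++ x.2.bits) :=
    (PolyFn.var (by simp [e])).congr fun x => x.2.encode_eq.symm
  have hn : PolyNat [e] fun x => x.1 := (PolyNat.lead he).congr fun x => by simp
  have hC1 : PolyNat [e] fun x => (C x.1 x.2).ancillas :=
    (PolyNat.lead hCode).congr fun x => by simp [QCircuit.encode]
  have hK : Known [e] fun x =>
      ⟨x.1, (C x.1 x.2).ancillas, K.eval x.1, x.2, (C x.1 x.2).gates.map WGate.ofGate⟩ :=
    { n := hn
      a := hC1
      F := hn.eval K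
      m := (PolyNat.lead he.skipUnary).congr fun x => by simp
      bits := he.skipUnary.skipUnary.congr fun x => by simp
      gs := hCode.skipUnary.congr fun x => by
        simp only [QCircuit.encode, skipUnary_unary_append, codes, List.flatMap_map]
        congr 1
        funext g
        rw [WGate.encode_eq] }
  have hN := (((hK.base.add (.const 7)).add hK.T).add (hK.T.add (.const 1))).unary
  obtain ⟨Q, u, hQ⟩ := (hN.append hK.allGates).exists_prog
  refine ⟨Q, u, fun n s => ?_⟩
  obtain ⟨k, τ, h1, h2, h3⟩ := hQ ⟨n, s⟩
  refine ⟨k, τ, h1, h2, h3.trans ?_⟩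
  rw [QCircuit.encode, basisFinder]
  simp only [wireCircuit]
  rw [codes_map_toGate]
  rfl

end HiddenSubspace

end

theorem mainTheorem12 (C : HiddenSubspace.QAlgorithm fun _ => 2) (hC : C.PolyTime)
    (r : Polynomial ℕ) :
    ∃ D : HiddenSubspace.QAlgorithm fun n => n / 2, D.PolyTime ∧
      ∃ c : ℝ, 0 < c ∧ ∀ (n : ℕ) (bank : PMF (HiddenSubspace.Banknote n)),
        ((r.eval n : ℕ) : ENNReal)⁻¹ ≤
            HiddenSubspace.average bank (HiddenSubspace.counterfeitProb C) →
        ENNReal.ofReal (c * (2 : ℝ) ^ (-(n : ℝ) / 2)) ≤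
            HiddenSubspace.average bank (HiddenSubspace.basisProb D) := by
  exact HiddenSubspace.exists_basisFinder C (fun K => HiddenSubspace.polyTime_basisFinder hC K) r
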